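/- The following is a theorem of $\mathrm{ZF}$ (Zermelo–Fraenkel set theory without the axiom of choice), that is, it holds in every model of the first-order theory $\mathrm{ZF}$. For a group $G$ with trivial center, the automorphism tower $\langle G^\alpha : \alpha\in\mathbf{Ord}\rangle$ is defined by $G^0=G$, $G^{\alpha+1}=\mathrm{Aut}(G^\alpha)$, where $G^\alpha$ is identified with the group $\mathrm{Inn}(G^\alpha)\le \mathrm{Aut}(G^\alpha)$ of inner automorphisms, and $G^\delta=\bigcup_{\alpha<\delta}G^\alpha$ for limit $\delta$. Let $\tau_G=\min\{\alpha : G^{\alpha+1}=G^\alpha\}$. For a set $k$, let $\tau_{|k|}$ be the least ordinal $\alpha$ such that $\tau_G<\alpha$ for every centerless group $G$ with $|G|\le|k|$ (that is, for which there is an injection of $G$ into $k$). For a set $A$, let $\theta_A$ be the least ordinal $\alpha>0$ such that there is no function from $A$ onto $\alpha$. Let ${}^{\omega>}k$ be the set of finite sequences of elements of $k$, and $\mathcal P$ the power set. Then $\tau_G$ exists for every centerless group $G$, and for every set $k$ the ordinals $\tau_{|k|}$ and $\theta_{\mathcal P({}^{\omega>}k)}$ exist and $$\tau_{|k|}<\theta_{\mathcal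 P({}^{\omega>}k)}.$$ In particular, there are an ordinal $\alpha$ and a function from $\mathcal P({}^{\omega>}k)$ onto $\alpha$ such that $\tau_G<\alpha$ for every centerless group $G$ with $|G|\le|k|$. -/

import Mathlib

universe u

/-!
Theorems of `ZF` are stated here as statements true in every model of the first-order theory `ZF`.
A model is a type `M` with a binary relation `x ∈ₘ y`.  Apart from the replacement schema, every
definition below is a first-order condition: all its quantifiers range over the elements of `M`,
so that ordinals, natural numbers, finite sequences, functions, groups, automorphisms and towers
are those of the model.
-/

namespace ZFModel

/-- A structure for the language of set theory. -/
class EpsStructure (M : Type u) where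
  /-- the membership relation of the structure -/
  eps : M → M → Prop

infix:50 " ∈ₘ " => EpsStructure.eps

/-- The only symbol of the language of set theory is a binary relation symbol. -/
inductive MemSymbol : ℕ → Type
  | mem : MemSymbol 2

/-- The first-order language of set theory. -/
def setLanguage : FirstOrder.Language.{0, 0} := ⟨fun _ => Empty, MemSymbol⟩

instance instStructure (M : Type u) [EpsStructure M] : setLanguage.Structure M where
  funMap := fun f _ => Empty.elim f
  RelMap := fun r => match r with
    | MemSymbol.mem => fun v => v 0 ∈ₘ v 1

section Basic

variable {M : Type u} [EpsStructure M]

/-- `x ⊆ y` -/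
def Incl (x y : M) : Prop := ∀ z, z ∈ₘ x → z ∈ₘ y

/-- `x = ∅` -/
def IsEmptySet (x : M) : Prop := ∀ z, ¬ z ∈ₘ x

/-- `s = {x, y}` -/
def IsUPair (s x y : M) : Prop := ∀ z, z ∈ₘ s ↔ z = x ∨ z = y

/-- `p = (x, y) = {{x}, {x, y}}` -/
def IsOPair (p x y : M) : Prop := ∃ s t, IsUPair s x x ∧ IsUPair t x y ∧ IsUPair p s t

/-- `s = x ∪ {x}` -/
def IsSucc (s x : M) : Prop := ∀ z, z ∈ₘ s ↔ z ∈ₘ x ∨ z = x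

/-- `u = ⋃ x` -/
def IsUnion (u x : M) : Prop := ∀ z, z ∈ₘ u ↔ ∃ y, y ∈ₘ x ∧ z ∈ₘ y

/-- `p = 𝒫(x)` -/
def IsPowerset (p x : M) : Prop := ∀ z, z ∈ₘ p ↔ Incl z x

end Basic

/-- `M` is a model of Zermelo–Fraenkel set theory without choice.  Replacement is the first-order
schema: it is required of the relations that are definable in `M` by a first-order formula with
parameters. -/
structure IsModelZF (M : Type u) [EpsStructure M] : Prop where
  extensionality : ∀ x y : M, (∀ z, z ∈ₘ x ↔ z ∈ₘ y) → x = y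
  foundation : ∀ x : M, (∃ y, y ∈ₘ x) → ∃ y, y ∈ₘ x ∧ ∀ z, z ∈ₘ y → ¬ z ∈ₘ x
  pairing : ∀ x y : M, ∃ s, IsUPair s x y
  union : ∀ x : M, ∃ u, IsUnion u x
  powerset : ∀ x : M, ∃ p, IsPowerset p x
  infinity : ∃ w : M, (∃ z, IsEmptySet z ∧ z ∈ₘ w) ∧ ∀ x, x ∈ₘ w → ∃ s, IsSucc s x ∧ s ∈ₘ w
  replacement : ∀ R : M → M → Prop,
    Set.Definable₂ (Set.univ : Set M) setLanguage {q : M × M | R q.1 q.2} →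
    ∀ a : M, (∀ x, x ∈ₘ a → ∀ y z, R x y → R x z → y = z) →
      ∃ b : M, ∀ y, y ∈ₘ b ↔ ∃ x, x ∈ₘ a ∧ R x y

section Internal

variable {M : Type u} [EpsStructure M]

/-! ### Functions -/

/-- `(x, y) ∈ f` -/
def AppRel (f x y : M) : Prop := ∃ p, IsOPair p x y ∧ p ∈ₘ f

/-- `f` is a function with domain `a`. -/
def IsFunOn (f a : M) : Prop :=
  (∀ p, p ∈ₘ f → ∃ x y, x ∈ₘ a ∧ IsOPair p x y) ∧ ∀ x, x ∈ₘ a → ∃! y, AppRel f x y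

/-- `f : a → b` -/
def IsFun (f a b : M) : Prop := IsFunOn f a ∧ ∀ x y, AppRel f x y → y ∈ₘ b

/-- `f` is an injection from `a` to `b`. -/
def IsInjection (f a b : M) : Prop :=
  IsFun f a b ∧ ∀ x x' y, AppRel f x y → AppRel f x' y → x = x'

/-- `f` is a function from `a` onto `b`. -/
def IsSurjection (f a b : M) : Prop :=
  IsFun f a b ∧ ∀ y, y ∈ₘ b → ∃ x, AppRel f x y

/-- `|a| ≤ |b|` -/
def CardLE (a b : M) : Prop := ∃ f, IsInjection f a b

/-! ### Ordinals and finite sequences -/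

/-- `x` is a transitive set. -/
def IsTransitive (x : M) : Prop := ∀ y, y ∈ₘ x → Incl y x

/-- `α` is a (von Neumann) ordinal: a transitive set of transitive sets. -/
def IsOrd (α : M) : Prop := IsTransitive α ∧ ∀ y, y ∈ₘ α → IsTransitive y

/-- `δ` is a limit ordinal (`0` is not a limit). -/
def IsLimit (δ : M) : Prop := IsOrd δ ∧ ¬ IsEmptySet δ ∧ ∀ β, ¬ IsSucc δ β

/-- `α` is the least ordinal with the property `Q`. -/
def IsLeastOrd (Q : M → Prop) (α : M) : Prop := IsOrd α ∧ Q α ∧ ∀ β, β ∈ₘ α → ¬ Q β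

/-- `x` is zero or a successor. -/
def IsZeroOrSucc (x : M) : Prop := IsEmptySet x ∨ ∃ y, IsSucc x y

/-- `n ∈ ω`: `n` is an ordinal, and it and all smaller ordinals are zero or successors. -/
def IsNat (n : M) : Prop := IsOrd n ∧ IsZeroOrSucc n ∧ ∀ m, m ∈ₘ n → IsZeroOrSucc m

/-- `S` is the set of all finite sequences of elements of `k`, that is, of all functions
`s : n → k` with `n ∈ ω`. -/
def IsFinSeqSet (S k : M) : Prop := ∀ s, s ∈ₘ S ↔ ∃ n, IsNat n ∧ IsFun s n k

/-- `θ = θ_A`, the first ordinal `α > 0` such that there is no function from `A` onto `α`. -/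
def IsTheta (A θ : M) : Prop :=
  IsLeastOrd (fun α => ¬ IsEmptySet α ∧ ¬ ∃ f, IsSurjection f A α) θ

/-! ### Groups -/

/-- `x · y = z`, that is, `((x, y), z) ∈ m`. -/
def MulRel (m x y z : M) : Prop := ∃ q, IsOPair q x y ∧ AppRel m q z

/-- `m : X × X → X` -/
def IsBinOp (X m : M) : Prop :=
  (∀ t, t ∈ₘ m → ∃ x y z q, x ∈ₘ X ∧ y ∈ₘ X ∧ z ∈ₘ X ∧ IsOPair q x y ∧ IsOPair t q z) ∧
  ∀ x y, x ∈ₘ X → y ∈ₘ X → ∃! z, MulRel m x y z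

/-- `e` is the identity element of `(X, m)`. -/
def IsIdentity (X m e : M) : Prop := e ∈ₘ X ∧ ∀ x, x ∈ₘ X → MulRel m e x x ∧ MulRel m x e x

/-- `(X, m)` is a group. -/
def IsGroup (X m : M) : Prop :=
  IsBinOp X m ∧
  (∀ x y z u v w, MulRel m x y u → MulRel m y z v → MulRel m u z w → MulRel m x v w) ∧
  ∃ e, IsIdentity X m e ∧ ∀ x, x ∈ₘ X → ∃ y, y ∈ₘ X ∧ MulRel m x y e ∧ MulRel m y x e

/-- `(X, m)` is a group whose center is trivial. -/
def IsCenterlessGroup (X m : M) : Prop :=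
  IsGroup X m ∧
  ∀ c, c ∈ₘ X → (∀ x z, x ∈ₘ X → (MulRel m c x z ↔ MulRel m x c z)) → IsIdentity X m c

/-- `Φ` is an isomorphism from `(X, m)` onto `(Y, n)`. -/
def IsIso (Φ X m Y n : M) : Prop :=
  IsInjection Φ X Y ∧ IsSurjection Φ X Y ∧
  ∀ x y z x' y' z', AppRel Φ x x' → AppRel Φ y y' → AppRel Φ z z' → MulRel m x y z → MulRel n x' y' z'

/-- `σ` is an automorphism of `(X, m)`. -/
def IsAut (σ X m : M) : Prop := IsIso σ X m X m

/-- `(A, c)` is `Aut(X, m)`: the set of all automorphisms with composition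
`(σ · τ)(x) = σ(τ(x))`. -/
def IsAutGroup (A c X m : M) : Prop :=
  (∀ σ, σ ∈ₘ A ↔ IsAut σ X m) ∧ IsBinOp A c ∧
  ∀ σ τ ρ, MulRel c σ τ ρ → ∀ x y z, AppRel τ x y → AppRel σ y z → AppRel ρ x z

/-- `σ` is the inner automorphism `g ↦ x g x⁻¹` of `(X, m)`. -/
def IsInnerBy (σ x X m : M) : Prop :=
  IsAut σ X m ∧ ∀ g h, AppRel σ g h → ∃ w, MulRel m x g w ∧ MulRel m h x w

/-- `(Y, n)` is `Aut(X, m)` after the identification of `(X, m)` with `Inn(X, m)`: it is a group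
with `(X, m)` as a subgroup, and there is an isomorphism from `(Y, n)` onto `Aut(X, m)` that sends
each `x ∈ X` to the inner automorphism by `x`. -/
def IsAutExtension (X m Y n : M) : Prop :=
  IsGroup Y n ∧ Incl X Y ∧ Incl m n ∧
  ∃ A c Φ, IsAutGroup A c X m ∧ IsIso Φ Y n A c ∧
    ∀ x σ, x ∈ₘ X → AppRel Φ x σ → IsInnerBy σ x X m

/-! ### The automorphism tower -/

/-- `T(β) = (Y, n)` -/
def TowerAt (T β Y n : M) : Prop := ∃ g, IsOPair g Y n ∧ AppRel T β g

/-- `T = ⟨G^β : β < l⟩` is the automorphism tower of `G = (X, m)` up to the ordinal `l`: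
`G^0 = G`, `G^(β+1) = Aut(G^β)` with `G^β` identified with `Inn(G^β)`, and `G^δ = ⋃ G^β` over
`β < δ` for limit `δ`.  The identifications leave the names of the new elements of `G^(β+1)` open;
so the tower is determined up to an isomorphism that is the identity on `G`. -/
def IsAutTower (T l X m : M) : Prop :=
  IsOrd l ∧ IsFunOn T l ∧ (∀ β, β ∈ₘ l → ∃ Y n, TowerAt T β Y n) ∧
  (∀ β, β ∈ₘ l → IsEmptySet β → TowerAt T β X m) ∧
  (∀ β γ Y n Z r, γ ∈ₘ l → IsSucc γ β → TowerAt T β Y n → TowerAt T γ Z r →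
    IsAutExtension Y n Z r) ∧
  (∀ δ Y n, δ ∈ₘ l → IsLimit δ → TowerAt T δ Y n →
    (∀ y, y ∈ₘ Y ↔ ∃ β Z r, β ∈ₘ δ ∧ TowerAt T β Z r ∧ y ∈ₘ Z) ∧
    (∀ t, t ∈ₘ n ↔ ∃ β Z r, β ∈ₘ δ ∧ TowerAt T β Z r ∧ t ∈ₘ r))

/-- `G^(α+1) = G^α` in the automorphism tower of `G = (X, m)`. -/
def StabilizesAt (X m α : M) : Prop :=
  ∃ s l T Y n, IsSucc s α ∧ IsSucc l s ∧ IsAutTower T l X m ∧ TowerAt T α Y n ∧ TowerAt T s Y n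

/-- `α = τ_G = min {α | G^(α+1) = G^α}` for `G = (X, m)`. -/
def IsTowerHeight (X m α : M) : Prop := IsLeastOrd (StabilizesAt X m) α

/-- `α > τ_G` for all centerless groups `G` with `|G| ≤ |k|`. -/
def BoundsHeights (k α : M) : Prop :=
  ∀ X m β, IsCenterlessGroup X m → CardLE X k → IsTowerHeight X m β → β ∈ₘ α

/-- `τ = τ_{|k|}`, the smallest ordinal `α` such that `α > τ_G` for all centerless groups `G` with
`|G| ≤ |k|`. -/
def IsTau (k τ : M) : Prop := IsLeastOrd (BoundsHeights k) τ

end Internal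

end ZFModel

set_option linter.unusedSectionVars false

/-! Write `G = (X, m)`. Each level `G^β` is normal in `G^(β+1)`, so conjugating an element of `G` by
some `h ∈ G^(β+1)` gives an element of `G^β`. Hence if `y₀ = g` lies somewhere in the tower and
`y_(i+1) = y_i a_i y_i⁻¹` with `a_i ∈ G`, the level of `y_i` falls until it reaches `G`. The type of
`g` is the set of finite sequences `⟨a_0, …, a_(l-1), b⟩` with `y_l = b ∈ G`; for `g` in any level
it is a set of finite sequences over `G`.

The type determines `g`. The centralizer of `G` in every level of the tower is trivial
(`Tower.centralizer`), so two elements are equal as soon as they conjugate each `a ∈ G` in the same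
way. Since these conjugates have smaller level, induction on the level reduces equality of elements
to equality of the final values in `G`, which the types record (`Tower.eq_of_typeMem`).

Let an injection of `G` into `k` label the elements of `G`. The multiplication table is a set of
triples of labels, and together with the type of `g` it forms one subset of the set of finite
sequences of `k`, the code of `g`. Two labelled groups with the same table are isomorphic over the
labels; the isomorphism extends to all common levels of the two towers (`Tower.exists_iso`) and
preserves types (`typeMem_map`). So the code determines the step `γ` with `g ∈ G^(γ+1) \ G^γ`
(`CodesRank.unique`), although it mentions neither the tower nor `γ`.

By replacement the steps so coded form a set. Restricting to steps up to which the tower grows makes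
this set an ordinal `σ`. A tower that grew at every step up to `σ` would give `σ ∈ σ`, so every
tower in question stops, and at most at `σ`. Sending a code to its step and every other set, such as
`∅`, to `σ` maps the power set onto `σ + 1`; hence `τ ≤ σ + 1 < θ`. No choice is involved: wherever
objects must be selected they are unique.

All of this takes place inside a model in which replacement is available for definable relations
only, so every construction is accompanied by a proof of definability, which instance search
assembles. -/

namespace ZFModel

open FirstOrder FirstOrder.Language

/-! ### Definability with parameters, closed under the logical operations and composition -/

section Definability

variable {M : Type u} [EpsStructure M]

/-- `P` is definable with parameters, where the variables are numbered by `ℕ`. -/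
class Dfn (P : (ℕ → M) → Prop) : Prop where
  out : (Set.univ : Set M).Definable setLanguage {v : ℕ → M | P v}

/-- The graph of `t` is definable with parameters. -/
class DFn (t : (ℕ → M) → M) : Prop where
  graph : Dfn (fun v : ℕ → M => v 0 = t (fun i => v (i + 1)))

theorem Dfn.congr {P Q : (ℕ → M) → Prop} (h : Dfn P) (e : ∀ v, Q v ↔ P v) : Dfn Q := by
  have : Q = P := funext fun v => propext (e v)
  rwa [this]

instance Dfn.and {P Q : (ℕ → M) → Prop} [hP : Dfn P] [hQ : Dfn Q] :
    Dfn (fun v => P v ∧ Q v) :=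
  ⟨hP.out.inter hQ.out⟩

instance Dfn.or {P Q : (ℕ → M) → Prop} [hP : Dfn P] [hQ : Dfn Q] :
    Dfn (fun v => P v ∨ Q v) :=
  ⟨hP.out.union hQ.out⟩

instance Dfn.not {P : (ℕ → M) → Prop} [hP : Dfn P] : Dfn (fun v => ¬ P v) :=
  ⟨hP.out.compl⟩

instance Dfn.imp {P Q : (ℕ → M) → Prop} [hP : Dfn P] [hQ : Dfn Q] :
    Dfn (fun v => P v → Q v) :=
  Dfn.congr (P := fun v => ¬ P v ∨ Q v) inferInstance fun _ => imp_iff_not_or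

instance Dfn.iff {P Q : (ℕ → M) → Prop} [hP : Dfn P] [hQ : Dfn Q] :
    Dfn (fun v => P v ↔ Q v) :=
  Dfn.congr (P := fun v => (P v → Q v) ∧ (Q v → P v)) inferInstance
    fun _ => iff_iff_implies_and_implies

theorem Dfn.rename {P : (ℕ → M) → Prop} (hP : Dfn P) (ρ : ℕ → ℕ) :
    Dfn (fun v => P (fun i => v (ρ i))) :=
  ⟨hP.out.preimage_comp ρ⟩

/-- De Bruijn convention: under a binder the bound variable has number `0` and the variables of the
context move up by one. All instances for binders below follow this pattern, so that instance search
can recurse through a formula. -/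
instance Dfn.ex {P : (ℕ → M) → M → Prop} [h : Dfn (fun v => P (fun i => v (i + 1)) (v 0))] :
    Dfn (fun v => ∃ x, P v x) := by
  have h1 := h.out.preimage_comp
    (fun n : ℕ => Nat.casesOn n (Sum.inr ()) (fun i => Sum.inl i) : ℕ → ℕ ⊕ Unit)
  refine ⟨?_⟩
  convert h1.exists_of_finite using 1
  ext v
  constructor
  · rintro ⟨x, hx⟩
    exact ⟨fun _ => x, hx⟩
  · rintro ⟨x, hx⟩
    exact ⟨x (), hx⟩

instance Dfn.all {P : (ℕ → M) → M → Prop} [h : Dfn (fun v => P (fun i => v (i + 1)) (v 0))] :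
    Dfn (fun v => ∀ x, P v x) :=
  Dfn.congr (P := fun v => ¬ ∃ x, ¬ P v x) inferInstance fun _ => by push Not; rfl

instance DFn.var (i : ℕ) : DFn (fun v : ℕ → M => v i) :=
  ⟨⟨(Term.var 0).equal (Term.var (i + 1)), by ext v; simp⟩⟩

instance DFn.const (c : M) : DFn (fun _ : ℕ → M => c) :=
  ⟨⟨(Term.var 0).equal (setLanguage.con (⟨c, trivial⟩ : (Set.univ : Set M))).term,
    by ext v; simp⟩⟩

theorem Dfn.mem_var (i j : ℕ) : Dfn (fun v : ℕ → M => v i ∈ₘ v j) := by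
  refine ⟨Relations.formula₂ (Sum.inl MemSymbol.mem : setLanguage[[(Set.univ : Set M)]].Relations 2)
    (Term.var i) (Term.var j), ?_⟩
  ext v
  simp only [Set.mem_ofPred_eq]
  exact Iff.rfl

theorem DFn.shift {t : (ℕ → M) → M} (h : DFn t) (ρ : ℕ → ℕ) : DFn (fun v => t (fun i => v (ρ i))) :=
  ⟨(h.graph.rename (fun n => Nat.casesOn n 0 fun i => ρ i + 1)).congr fun _ => Iff.rfl⟩

theorem DFn.graph_var {t : (ℕ → M) → M} (h : DFn t) (i : ℕ) (ρ : ℕ → ℕ) :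
    Dfn (fun v => v i = t (fun n => v (ρ n))) :=
  (h.graph.rename (fun n => Nat.casesOn n i fun n => ρ n)).congr fun _ => Iff.rfl

/-- A definable term is eliminated by naming its value: `P (t v)` says that some `x` with `x = t v`
satisfies `P`. The lemmas `Dfn.app1` to `Dfn.app6` substitute the arguments of a relation in this
way one at a time. -/
theorem Dfn.subst {P : (ℕ → M) → M → Prop} {t : (ℕ → M) → M}
    (h : Dfn (fun v => P (fun i => v (i + 1)) (v 0))) (ht : DFn t) : Dfn (fun v => P v (t v)) := by
  have := ht.graph
  exact Dfn.congr (P := fun v => ∃ x, x = t v ∧ P v x) inferInstance fun v => by simp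

theorem Dfn.app1 {R : M → Prop} (h : Dfn (fun v : ℕ → M => R (v 0)))
    {a : (ℕ → M) → M} [ha : DFn a] : Dfn (fun v => R (a v)) :=
  Dfn.subst (P := fun _ x => R x) h ha

theorem Dfn.app2 {R : M → M → Prop} (h : Dfn (fun v : ℕ → M => R (v 0) (v 1)))
    {a b : (ℕ → M) → M} [ha : DFn a] [hb : DFn b] : Dfn (fun v => R (a v) (b v)) := by
  refine Dfn.subst (P := fun v x => R x (b v)) ?_ ha
  refine Dfn.subst (P := fun v x => R (v 0) x) ?_ (hb.shift _)
  exact h.rename (fun n => Nat.casesOn n 1 fun _ => 0)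

theorem Dfn.app3 {R : M → M → M → Prop} (h : Dfn (fun v : ℕ → M => R (v 0) (v 1) (v 2)))
    {a b c : (ℕ → M) → M} [ha : DFn a] [hb : DFn b] [hc : DFn c] :
    Dfn (fun v => R (a v) (b v) (c v)) := by
  refine Dfn.subst (P := fun v x => R x (b v) (c v)) ?_ ha
  refine Dfn.subst (P := fun v x => R (v 0) x (c (fun i => v (i + 1)))) ?_ (hb.shift _)
  refine Dfn.subst (P := fun v x => R (v 1) (v 0) x) ?_ (hc.shift (· + 2))
  exact h.rename (fun n => match n with | 0 => 2 | 1 => 1 | _ => 0)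

theorem Dfn.app4 {R : M → M → M → M → Prop}
    (h : Dfn (fun v : ℕ → M => R (v 0) (v 1) (v 2) (v 3)))
    {a b c d : (ℕ → M) → M} [ha : DFn a] [hb : DFn b] [hc : DFn c] [hd : DFn d] :
    Dfn (fun v => R (a v) (b v) (c v) (d v)) := by
  refine Dfn.subst (P := fun v x => R x (b v) (c v) (d v)) ?_ ha
  refine Dfn.subst (P := fun v x => R (v 0) x (c (fun i => v (i + 1))) (d (fun i => v (i + 1)))) ?_
    (hb.shift _)
  refine Dfn.subst (P := fun v x => R (v 1) (v 0) x (d (fun i => v (i + 2)))) ?_ (hc.shift (· + 2))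
  refine Dfn.subst (P := fun v x => R (v 2) (v 1) (v 0) x) ?_ (hd.shift (· + 3))
  exact h.rename (fun n => match n with | 0 => 3 | 1 => 2 | 2 => 1 | _ => 0)

theorem Dfn.app5 {R : M → M → M → M → M → Prop}
    (h : Dfn (fun v : ℕ → M => R (v 0) (v 1) (v 2) (v 3) (v 4)))
    {a b c d e : (ℕ → M) → M} [ha : DFn a] [hb : DFn b] [hc : DFn c] [hd : DFn d] [he : DFn e] :
    Dfn (fun v => R (a v) (b v) (c v) (d v) (e v)) := by
  refine Dfn.subst (P := fun v x => R x (b v) (c v) (d v) (e v)) ?_ ha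
  refine Dfn.subst (P := fun v x => R (v 0) x (c (fun i => v (i + 1))) (d (fun i => v (i + 1)))
    (e (fun i => v (i + 1)))) ?_ (hb.shift _)
  refine Dfn.subst (P := fun v x => R (v 1) (v 0) x (d (fun i => v (i + 2)))
    (e (fun i => v (i + 2)))) ?_ (hc.shift (· + 2))
  refine Dfn.subst (P := fun v x => R (v 2) (v 1) (v 0) x (e (fun i => v (i + 3)))) ?_
    (hd.shift (· + 3))
  refine Dfn.subst (P := fun v x => R (v 3) (v 2) (v 1) (v 0) x) ?_ (he.shift (· + 4))
  exact h.rename (fun n => match n with | 0 => 4 | 1 => 3 | 2 => 2 | 3 => 1 | _ => 0)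

theorem Dfn.app6 {R : M → M → M → M → M → M → Prop}
    (h : Dfn (fun v : ℕ → M => R (v 0) (v 1) (v 2) (v 3) (v 4) (v 5)))
    {a b c d e f : (ℕ → M) → M} [ha : DFn a] [hb : DFn b] [hc : DFn c] [hd : DFn d] [he : DFn e]
    [hf : DFn f] : Dfn (fun v => R (a v) (b v) (c v) (d v) (e v) (f v)) := by
  refine Dfn.subst (P := fun v x => R x (b v) (c v) (d v) (e v) (f v)) ?_ ha
  refine Dfn.subst (P := fun v x => R (v 0) x (c (fun i => v (i + 1))) (d (fun i => v (i + 1)))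
    (e (fun i => v (i + 1))) (f (fun i => v (i + 1)))) ?_ (hb.shift _)
  refine Dfn.subst (P := fun v x => R (v 1) (v 0) x (d (fun i => v (i + 2)))
    (e (fun i => v (i + 2))) (f (fun i => v (i + 2)))) ?_ (hc.shift (· + 2))
  refine Dfn.subst (P := fun v x => R (v 2) (v 1) (v 0) x (e (fun i => v (i + 3)))
    (f (fun i => v (i + 3)))) ?_ (hd.shift (· + 3))
  refine Dfn.subst (P := fun v x => R (v 3) (v 2) (v 1) (v 0) x (f (fun i => v (i + 4)))) ?_
    (he.shift (· + 4))
  refine Dfn.subst (P := fun v x => R (v 4) (v 3) (v 2) (v 1) (v 0) x) ?_ (hf.shift (· + 5))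
  exact h.rename (fun n => match n with | 0 => 5 | 1 => 4 | 2 => 3 | 3 => 2 | 4 => 1 | _ => 0)

/-- A function is definable when its values have a definable description. -/
theorem DFn.of_spec {t : (ℕ → M) → M} {Q : (ℕ → M) → M → Prop}
    (h : Dfn (fun v => Q (fun i => v (i + 1)) (v 0))) (e : ∀ v y, y = t v ↔ Q v y) : DFn t :=
  ⟨h.congr fun v => e (fun i => v (i + 1)) (v 0)⟩

theorem DFn.app1 {F : M → M} (h : Dfn (fun v : ℕ → M => v 0 = F (v 1)))
    {a : (ℕ → M) → M} [ha : DFn a] : DFn (fun v => F (a v)) :=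
  have := ha.shift (· + 1)
  ⟨Dfn.app2 (R := fun y x => y = F x) h⟩

theorem DFn.app2 {F : M → M → M} (h : Dfn (fun v : ℕ → M => v 0 = F (v 1) (v 2)))
    {a b : (ℕ → M) → M} [ha : DFn a] [hb : DFn b] : DFn (fun v => F (a v) (b v)) :=
  have := ha.shift (· + 1)
  have := hb.shift (· + 1)
  ⟨Dfn.app3 (R := fun y x z => y = F x z) h⟩

theorem DFn.app3 {F : M → M → M → M} (h : Dfn (fun v : ℕ → M => v 0 = F (v 1) (v 2) (v 3)))
    {a b c : (ℕ → M) → M} [ha : DFn a] [hb : DFn b] [hc : DFn c] :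
    DFn (fun v => F (a v) (b v) (c v)) :=
  have := ha.shift (· + 1)
  have := hb.shift (· + 1)
  have := hc.shift (· + 1)
  ⟨Dfn.app4 (R := fun y x z w => y = F x z w) h⟩

theorem DFn.app4 {F : M → M → M → M → M}
    (h : Dfn (fun v : ℕ → M => v 0 = F (v 1) (v 2) (v 3) (v 4)))
    {a b c d : (ℕ → M) → M} [ha : DFn a] [hb : DFn b] [hc : DFn c] [hd : DFn d] :
    DFn (fun v => F (a v) (b v) (c v) (d v)) :=
  have := ha.shift (· + 1)
  have := hb.shift (· + 1)
  have := hc.shift (· + 1)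
  have := hd.shift (· + 1)
  ⟨Dfn.app5 (R := fun y x z w u => y = F x z w u) h⟩

instance Dfn.mem {a b : (ℕ → M) → M} [DFn a] [DFn b] : Dfn (fun v => a v ∈ₘ b v) :=
  Dfn.app2 (R := fun x y => x ∈ₘ y) (Dfn.mem_var 0 1)

instance Dfn.eq {a b : (ℕ → M) → M} [DFn a] [DFn b] : Dfn (fun v => a v = b v) :=
  Dfn.app2 (R := fun x y => x = y) ((DFn.var 0).graph_var 0 (· + 1))

instance Dfn.existsUnique {P : (ℕ → M) → M → Prop}
    [h : Dfn (fun v => P (fun i => v (i + 1)) (v 0))] : Dfn (fun v => ∃! x, P v x) := by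
  have h2 : Dfn (fun v => P (fun i => v (i + 2)) (v 0)) :=
    h.rename (fun n => Nat.casesOn n 0 fun i => i + 2)
  exact Dfn.congr (P := fun v => ∃ x, P v x ∧ ∀ y, P v y → y = x) inferInstance fun _ => Iff.rfl

instance {a b : (ℕ → M) → M} [DFn a] [DFn b] : Dfn (fun v => Incl (a v) (b v)) :=
  Dfn.app2 (by unfold Incl; infer_instance)

instance {a : (ℕ → M) → M} [DFn a] : Dfn (fun v => IsEmptySet (a v)) :=
  Dfn.app1 (by unfold IsEmptySet; infer_instance)

instance {a b c : (ℕ → M) → M} [DFn a] [DFn b] [DFn c] : Dfn (fun v => IsUPair (a v) (b v) (c v)) :=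
  Dfn.app3 (by unfold IsUPair; infer_instance)

instance {a b c : (ℕ → M) → M} [DFn a] [DFn b] [DFn c] : Dfn (fun v => IsOPair (a v) (b v) (c v)) :=
  Dfn.app3 (by unfold IsOPair; infer_instance)

instance {a b : (ℕ → M) → M} [DFn a] [DFn b] : Dfn (fun v => IsSucc (a v) (b v)) :=
  Dfn.app2 (by unfold IsSucc; infer_instance)

instance {a b : (ℕ → M) → M} [DFn a] [DFn b] : Dfn (fun v => IsUnion (a v) (b v)) :=
  Dfn.app2 (by unfold IsUnion; infer_instance)

instance {a b : (ℕ → M) → M} [DFn a] [DFn b] : Dfn (fun v => IsPowerset (a v) (b v)) :=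
  Dfn.app2 (by unfold IsPowerset; infer_instance)

instance {a b c : (ℕ → M) → M} [DFn a] [DFn b] [DFn c] : Dfn (fun v => AppRel (a v) (b v) (c v)) :=
  Dfn.app3 (by unfold AppRel; infer_instance)

instance {a b : (ℕ → M) → M} [DFn a] [DFn b] : Dfn (fun v => IsFunOn (a v) (b v)) :=
  Dfn.app2 (by unfold IsFunOn; infer_instance)

instance {a b c : (ℕ → M) → M} [DFn a] [DFn b] [DFn c] : Dfn (fun v => IsFun (a v) (b v) (c v)) :=
  Dfn.app3 (by unfold IsFun; infer_instance)

instance {a b c : (ℕ → M) → M} [DFn a] [DFn b] [DFn c] :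
    Dfn (fun v => IsInjection (a v) (b v) (c v)) :=
  Dfn.app3 (by unfold IsInjection; infer_instance)

instance {a b c : (ℕ → M) → M} [DFn a] [DFn b] [DFn c] :
    Dfn (fun v => IsSurjection (a v) (b v) (c v)) :=
  Dfn.app3 (by unfold IsSurjection; infer_instance)

instance {a b : (ℕ → M) → M} [DFn a] [DFn b] : Dfn (fun v => CardLE (a v) (b v)) :=
  Dfn.app2 (by unfold CardLE; infer_instance)

instance {a : (ℕ → M) → M} [DFn a] : Dfn (fun v => IsTransitive (a v)) :=
  Dfn.app1 (by unfold IsTransitive; infer_instance)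

instance {a : (ℕ → M) → M} [DFn a] : Dfn (fun v => IsOrd (a v)) :=
  Dfn.app1 (by unfold IsOrd; infer_instance)

instance {a : (ℕ → M) → M} [DFn a] : Dfn (fun v => IsLimit (a v)) :=
  Dfn.app1 (by unfold IsLimit; infer_instance)

instance {a : (ℕ → M) → M} [DFn a] : Dfn (fun v => IsZeroOrSucc (a v)) :=
  Dfn.app1 (by unfold IsZeroOrSucc; infer_instance)

instance {a : (ℕ → M) → M} [DFn a] : Dfn (fun v => IsNat (a v)) :=
  Dfn.app1 (by unfold IsNat; infer_instance)

instance {m a b c : (ℕ → M) → M} [DFn m] [DFn a] [DFn b] [DFn c] :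
    Dfn (fun v => MulRel (m v) (a v) (b v) (c v)) :=
  Dfn.app4 (by unfold MulRel; infer_instance)

instance {a b : (ℕ → M) → M} [DFn a] [DFn b] : Dfn (fun v => IsBinOp (a v) (b v)) :=
  Dfn.app2 (by unfold IsBinOp; infer_instance)

instance {a b c : (ℕ → M) → M} [DFn a] [DFn b] [DFn c] :
    Dfn (fun v => IsIdentity (a v) (b v) (c v)) :=
  Dfn.app3 (by unfold IsIdentity; infer_instance)

instance {a b : (ℕ → M) → M} [DFn a] [DFn b] : Dfn (fun v => IsGroup (a v) (b v)) :=
  Dfn.app2 (by unfold IsGroup; infer_instance)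

instance {a b : (ℕ → M) → M} [DFn a] [DFn b] : Dfn (fun v => IsCenterlessGroup (a v) (b v)) :=
  Dfn.app2 (by unfold IsCenterlessGroup; infer_instance)

instance {a b c d e : (ℕ → M) → M} [DFn a] [DFn b] [DFn c] [DFn d] [DFn e] :
    Dfn (fun v => IsIso (a v) (b v) (c v) (d v) (e v)) :=
  Dfn.app5 (by unfold IsIso; infer_instance)

instance {a b c : (ℕ → M) → M} [DFn a] [DFn b] [DFn c] :
    Dfn (fun v => IsAut (a v) (b v) (c v)) :=
  Dfn.app3 (by unfold IsAut; infer_instance)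

instance {a b c d : (ℕ → M) → M} [DFn a] [DFn b] [DFn c] [DFn d] :
    Dfn (fun v => IsAutGroup (a v) (b v) (c v) (d v)) :=
  Dfn.app4 (by unfold IsAutGroup; infer_instance)

instance {a b c d : (ℕ → M) → M} [DFn a] [DFn b] [DFn c] [DFn d] :
    Dfn (fun v => IsInnerBy (a v) (b v) (c v) (d v)) :=
  Dfn.app4 (by unfold IsInnerBy; infer_instance)

instance {a b c d : (ℕ → M) → M} [DFn a] [DFn b] [DFn c] [DFn d] :
    Dfn (fun v => IsAutExtension (a v) (b v) (c v) (d v)) :=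
  Dfn.app4 (by unfold IsAutExtension; infer_instance)

instance {a b c d : (ℕ → M) → M} [DFn a] [DFn b] [DFn c] [DFn d] :
    Dfn (fun v => TowerAt (a v) (b v) (c v) (d v)) :=
  Dfn.app4 (by unfold TowerAt; infer_instance)

instance {a b c d : (ℕ → M) → M} [DFn a] [DFn b] [DFn c] [DFn d] :
    Dfn (fun v => IsAutTower (a v) (b v) (c v) (d v)) :=
  Dfn.app4 (by unfold IsAutTower; infer_instance)

instance {a b c : (ℕ → M) → M} [DFn a] [DFn b] [DFn c] :
    Dfn (fun v => StabilizesAt (a v) (b v) (c v)) :=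
  Dfn.app3 (by unfold StabilizesAt; infer_instance)

instance {a b c : (ℕ → M) → M} [DFn a] [DFn b] [DFn c] :
    Dfn (fun v => IsTowerHeight (a v) (b v) (c v)) :=
  Dfn.app3 (by unfold IsTowerHeight IsLeastOrd; infer_instance)

instance {a b : (ℕ → M) → M} [DFn a] [DFn b] : Dfn (fun v => BoundsHeights (a v) (b v)) :=
  Dfn.app2 (by unfold BoundsHeights; infer_instance)

end Definability

/-- `M` is a model of `ZF`, as a class. -/
class ZF (M : Type u) [EpsStructure M] : Prop where
  out : IsModelZF M

/-! ### Basic set constructions and functions in a model -/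

section Basic

variable {M : Type u} [EpsStructure M] [ZF M]

theorem ext {x y : M} (h : ∀ z, z ∈ₘ x ↔ z ∈ₘ y) : x = y :=
  ZF.out.extensionality x y h

theorem Incl.antisymm {x y : M} (h : Incl x y) (h' : Incl y x) : x = y :=
  ext fun z => ⟨h z, h' z⟩

/-- The schema is stated with two variables indexed by `Fin 2`, while definability here uses
variables indexed by `ℕ`; renaming variables connects the two. -/
theorem exists_repl (R : M → M → Prop) [h : Dfn (fun v : ℕ → M => R (v 0) (v 1))] (a : M)
    (hR : ∀ x, x ∈ₘ a → ∀ y z, R x y → R x z → y = z) :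
    ∃ b : M, ∀ y, y ∈ₘ b ↔ ∃ x, x ∈ₘ a ∧ R x y := by
  let f : ℕ → Fin 2 := fun n => Nat.casesOn n 0 fun _ => 1
  exact ZF.out.replacement R (h.out.preimage_comp f) a hR

theorem exists_sep (a : M) (P : M → Prop) [Dfn (fun v : ℕ → M => P (v 0))] :
    ∃ b : M, ∀ x, x ∈ₘ b ↔ x ∈ₘ a ∧ P x := by
  have : Dfn (fun v : ℕ → M => P (v 1)) := Dfn.app1 (a := fun v => v 1) ‹_›
  obtain ⟨b, hb⟩ := exists_repl (fun x y => y = x ∧ P y)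
    (h := by
      have : Dfn (fun v : ℕ → M => P (v 1)) := Dfn.app1 (a := fun v => v 1) ‹_›
      infer_instance) a (by rintro x - y z ⟨rfl, -⟩ ⟨rfl, -⟩; rfl)
  exact ⟨b, fun x => (hb x).trans ⟨by rintro ⟨y, hy, rfl, h⟩; exact ⟨hy, h⟩,
    fun h => ⟨x, h.1, rfl, h.2⟩⟩⟩

theorem exists_empty : ∃ x : M, IsEmptySet x := by
  obtain ⟨w, ⟨z, hz, -⟩, -⟩ := (ZF.out : IsModelZF M).infinity
  exact ⟨z, hz⟩

/-- The empty set. -/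
noncomputable def emp : M := exists_empty.choose

@[simp] theorem not_mem_emp (x : M) : ¬ x ∈ₘ (emp : M) := exists_empty.choose_spec x

theorem isEmptySet_iff {x : M} : IsEmptySet x ↔ x = emp :=
  ⟨fun h => ext fun z => by simp [h z], by rintro rfl; exact not_mem_emp⟩

open Classical in
/-- The unique element with property `P`, or the empty set when there is none. -/
noncomputable def iota (P : M → Prop) : M := if h : ∃! x, P x then h.choose else emp

theorem iota_spec {P : M → Prop} (h : ∃! x, P x) : P (iota P) := by
  rw [iota, dif_pos h]; exact h.choose_spec.1

theorem iota_eq {P : M → Prop} {x : M} (hx : P x) (h : ∀ y, P y → y = x) : iota P = x :=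
  h _ (iota_spec ⟨x, hx, h⟩)

theorem iota_eq_emp {P : M → Prop} (h : ¬ ∃! x, P x) : iota P = emp := by
  rw [iota, dif_neg h]

/-- The default value `emp` makes descriptions total, and the graph remains definable by
distinguishing whether the described element exists uniquely. -/
instance {P : (ℕ → M) → M → Prop} [h : Dfn (fun v => P (fun i => v (i + 1)) (v 0))] :
    DFn (fun v => iota (P v)) := by
  have h2 : Dfn (fun v => P (fun i => v (i + 2)) (v 0)) :=
    h.rename (fun n => Nat.casesOn n 0 fun i => i + 2)
  refine DFn.of_spec (Q := fun v y => (P v y ∧ ∃! x, P v x) ∨ ((¬ ∃! x, P v x) ∧ y = emp))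
    inferInstance fun v y => ?_
  by_cases hu : ∃! x, P v x
  · simp only [hu, and_true, not_true_eq_false, false_and, or_false]
    exact ⟨fun e => e ▸ iota_spec hu, fun e => hu.unique e (iota_spec hu)⟩
  · simp [hu, iota_eq_emp hu]

/-- `a` if `p` holds, and `b` otherwise. -/
noncomputable def ifte (p : Prop) (a b : M) : M := iota fun y => (p ∧ y = a) ∨ (¬ p ∧ y = b)

theorem ifte_pos {p : Prop} (h : p) (a b : M) : ifte p a b = a :=
  iota_eq (by simp [h]) (by simp [h])

theorem ifte_neg {p : Prop} (h : ¬ p) (a b : M) : ifte p a b = b :=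
  iota_eq (by simp [h]) (by simp [h])

instance {p : (ℕ → M) → Prop} {a b : (ℕ → M) → M} [hp : Dfn p] [ha : DFn a] [hb : DFn b] :
    DFn (fun v => ifte (p v) (a v) (b v)) := by
  have := hp.rename (· + 1)
  have := ha.shift (· + 1)
  have := hb.shift (· + 1)
  unfold ifte
  infer_instance

/-- `{x, y}` -/
noncomputable def upair (x y : M) : M := (ZF.out.pairing x y).choose

@[simp] theorem mem_upair {x y z : M} : z ∈ₘ upair x y ↔ z = x ∨ z = y :=
  (ZF.out.pairing x y).choose_spec z

theorem isUPair_iff {s x y : M} : IsUPair s x y ↔ s = upair x y :=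
  ⟨fun h => ext fun z => by rw [h z, mem_upair], by rintro rfl z; exact mem_upair⟩

instance {a b : (ℕ → M) → M} [DFn a] [DFn b] : DFn (fun v => upair (a v) (b v)) :=
  DFn.app2 (by simp only [← isUPair_iff]; infer_instance)

/-- The ordered pair `(x, y)`. -/
noncomputable def opair (x y : M) : M := upair (upair x x) (upair x y)

theorem isOPair_iff {p x y : M} : IsOPair p x y ↔ p = opair x y := by
  simp [IsOPair, isUPair_iff, opair]

instance {a b : (ℕ → M) → M} [DFn a] [DFn b] : DFn (fun v => opair (a v) (b v)) := by
  unfold opair; infer_instance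

theorem upair_self_inj {x y z : M} (h : upair x x = upair y z) : x = y ∧ x = z := by
  have hy : y ∈ₘ upair x x := h ▸ mem_upair.2 (Or.inl rfl)
  have hz : z ∈ₘ upair x x := h ▸ mem_upair.2 (Or.inr rfl)
  simp only [mem_upair, or_self] at hy hz
  exact ⟨hy.symm, hz.symm⟩

theorem upair_left_inj {x y z : M} (h : upair x y = upair x z) : y = z := by
  have hy : y ∈ₘ upair x z := h ▸ mem_upair.2 (Or.inr rfl)
  have hz : z ∈ₘ upair x y := h ▸ mem_upair.2 (Or.inr rfl)
  simp only [mem_upair] at hy hz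
  rcases hy with rfl | rfl
  · rcases hz with rfl | rfl <;> rfl
  · rfl

@[simp] theorem opair_inj {x y x' y' : M} : opair x y = opair x' y' ↔ x = x' ∧ y = y' := by
  refine ⟨fun h => ?_, by rintro ⟨rfl, rfl⟩; rfl⟩
  have h1 : upair x x ∈ₘ opair x' y' := h ▸ mem_upair.2 (Or.inl rfl)
  have hx : x = x' := by
    rcases mem_upair.1 h1 with e | e <;> exact (upair_self_inj e).1
  subst hx
  exact ⟨rfl, upair_left_inj (upair_left_inj h)⟩

/-- The union of a set. -/
noncomputable def sUnion (x : M) : M := (ZF.out.union x).choose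

@[simp] theorem mem_sUnion {x z : M} : z ∈ₘ sUnion x ↔ ∃ y, y ∈ₘ x ∧ z ∈ₘ y :=
  (ZF.out.union x).choose_spec z

instance {a : (ℕ → M) → M} [DFn a] : DFn (fun v => sUnion (a v)) := by
  refine DFn.app1 (Dfn.congr (P := fun v => IsUnion (v 0) (v 1)) inferInstance fun v => ?_)
  exact ⟨fun h z => by rw [h, mem_sUnion], fun h => ext fun z => by rw [h z, mem_sUnion]⟩

/-- The power set. -/
noncomputable def pow (x : M) : M := (ZF.out.powerset x).choose

@[simp] theorem mem_pow {x z : M} : z ∈ₘ pow x ↔ Incl z x :=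
  (ZF.out.powerset x).choose_spec z

instance {a : (ℕ → M) → M} [DFn a] : DFn (fun v => pow (a v)) := by
  refine DFn.app1 (Dfn.congr (P := fun v => IsPowerset (v 0) (v 1)) inferInstance fun v => ?_)
  exact ⟨fun h z => by rw [h, mem_pow], fun h => ext fun z => by rw [h z, mem_pow]⟩

/-- `x ∪ y` -/
noncomputable def cup (x y : M) : M := sUnion (upair x y)

@[simp] theorem mem_cup {x y z : M} : z ∈ₘ cup x y ↔ z ∈ₘ x ∨ z ∈ₘ y := by
  simp [cup]

instance {a b : (ℕ → M) → M} [DFn a] [DFn b] : DFn (fun v => cup (a v) (b v)) := by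
  unfold cup; infer_instance

/-- `x ∪ {x}` -/
noncomputable def succ (x : M) : M := cup x (upair x x)

@[simp] theorem mem_succ {x z : M} : z ∈ₘ succ x ↔ z ∈ₘ x ∨ z = x := by
  simp [succ]

theorem isSucc_iff {s x : M} : IsSucc s x ↔ s = succ x :=
  ⟨fun h => ext fun z => by rw [h z, mem_succ], by rintro rfl z; exact mem_succ⟩

theorem self_mem_succ (x : M) : x ∈ₘ succ x := mem_succ.2 (Or.inr rfl)

instance {a : (ℕ → M) → M} [DFn a] : DFn (fun v => succ (a v)) := by
  unfold succ; infer_instance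

/-- `{x ∈ a | P x}` -/
noncomputable def sep (a : M) (P : M → Prop) : M := iota fun b => ∀ x, x ∈ₘ b ↔ x ∈ₘ a ∧ P x

@[simp] theorem mem_sep {a : M} {P : M → Prop} [Dfn (fun v : ℕ → M => P (v 0))] {x : M} :
    x ∈ₘ sep a P ↔ x ∈ₘ a ∧ P x := by
  obtain ⟨b, hb⟩ := exists_sep a P
  have : sep a P = b := iota_eq hb fun c hc => ext fun z => by rw [hb, hc]
  rw [this, hb]

instance {a : (ℕ → M) → M} {P : (ℕ → M) → M → Prop} [ha : DFn a]
    [h : Dfn (fun v => P (fun i => v (i + 1)) (v 0))] : DFn (fun v => sep (a v) (P v)) := by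
  have h2 : Dfn (fun v => P (fun i => v (i + 2)) (v 0)) :=
    h.rename (fun n => Nat.casesOn n 0 fun i => i + 2)
  have := ha.shift (· + 2)
  unfold sep
  infer_instance

/-- `{F x | x ∈ a}` -/
noncomputable def img (a : M) (F : M → M) : M := iota fun b => ∀ y, y ∈ₘ b ↔ ∃ x, x ∈ₘ a ∧ y = F x

@[simp] theorem mem_img {a : M} {F : M → M} [h : DFn (fun v : ℕ → M => F (v 0))] {y : M} :
    y ∈ₘ img a F ↔ ∃ x, x ∈ₘ a ∧ y = F x := by
  obtain ⟨b, hb⟩ := exists_repl (fun x y => y = F x)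
    (h := by
      have := h.shift (fun _ => 0)
      exact Dfn.eq (a := fun v => v 1) (b := fun v => F (v 0))) a
    (by rintro x - y z rfl rfl; rfl)
  have : img a F = b := iota_eq hb fun c hc => ext fun z => by rw [hb, hc]
  rw [this, hb]

instance {a : (ℕ → M) → M} {F : (ℕ → M) → M → M} [ha : DFn a]
    [h : DFn (fun v => F (fun i => v (i + 1)) (v 0))] : DFn (fun v => img (a v) (F v)) := by
  have h2 : DFn (fun v => F (fun i => v (i + 3)) (v 0)) :=
    h.shift (fun n => Nat.casesOn n 0 fun i => i + 3)
  have := ha.shift (· + 3)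
  unfold img
  infer_instance

/-- The function `x ↦ F x` on `a`. -/
noncomputable def lam (a : M) (F : M → M) : M := img a fun x => opair x (F x)

theorem mem_lam {a : M} {F : M → M} [DFn (fun v : ℕ → M => F (v 0))] {p : M} :
    p ∈ₘ lam a F ↔ ∃ x, x ∈ₘ a ∧ p = opair x (F x) := mem_img

@[simp] theorem opair_mem_lam {a : M} {F : M → M} [DFn (fun v : ℕ → M => F (v 0))] {x y : M} :
    opair x y ∈ₘ lam a F ↔ x ∈ₘ a ∧ y = F x := by
  rw [mem_lam]
  constructor
  · rintro ⟨z, hz, e⟩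
    obtain ⟨rfl, rfl⟩ := opair_inj.1 e
    exact ⟨hz, rfl⟩
  · rintro ⟨hx, rfl⟩
    exact ⟨x, hx, rfl⟩

instance {a : (ℕ → M) → M} {F : (ℕ → M) → M → M} [ha : DFn a]
    [h : DFn (fun v => F (fun i => v (i + 1)) (v 0))] : DFn (fun v => lam (a v) (F v)) := by
  unfold lam
  infer_instance

/-- The value of the function `f` at `x`. -/
noncomputable def app (f x : M) : M := iota fun y => opair x y ∈ₘ f

instance {a b : (ℕ → M) → M} [DFn a] [DFn b] : DFn (fun v => app (a v) (b v)) :=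
  DFn.app2 (by unfold app; infer_instance)

@[simp] theorem app_lam {a : M} {F : M → M} [DFn (fun v : ℕ → M => F (v 0))] {x : M}
    (hx : x ∈ₘ a) : app (lam a F) x = F x :=
  iota_eq (by simp [hx]) (by simp [hx])

/-- Definability of `F` and `G` is not needed: the two descriptions that define the sets are
equivalent, so their `iota` agree even if no such set exists. -/
theorem lam_congr {a : M} {F G : M → M} (h : ∀ x, x ∈ₘ a → F x = G x) : lam a F = lam a G := by
  unfold lam img
  congr
  funext b
  congr! 2 with y
  exact exists_congr fun x => and_congr_right fun hx => by beta_reduce; rw [h x hx]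

/-- `a × b` -/
noncomputable def prod (a b : M) : M :=
  sep (pow (pow (cup a b))) fun p => ∃ x y, x ∈ₘ a ∧ y ∈ₘ b ∧ p = opair x y

theorem mem_prod {a b p : M} : p ∈ₘ prod a b ↔ ∃ x y, x ∈ₘ a ∧ y ∈ₘ b ∧ p = opair x y := by
  rw [prod, mem_sep, and_iff_right_iff_imp]
  rintro ⟨x, y, hx, hy, rfl⟩
  rw [mem_pow]
  intro s hs
  rw [mem_pow]
  intro z hz
  rcases mem_upair.1 hs with rfl | rfl <;> rcases mem_upair.1 hz with rfl | rfl <;> simp [hx, hy]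

@[simp] theorem opair_mem_prod {a b x y : M} : opair x y ∈ₘ prod a b ↔ x ∈ₘ a ∧ y ∈ₘ b := by
  rw [mem_prod]
  constructor
  · rintro ⟨x', y', hx, hy, e⟩
    obtain ⟨rfl, rfl⟩ := opair_inj.1 e
    exact ⟨hx, hy⟩
  · rintro ⟨hx, hy⟩
    exact ⟨x, y, hx, hy, rfl⟩

instance {a b : (ℕ → M) → M} [DFn a] [DFn b] : DFn (fun v => prod (a v) (b v)) :=
  DFn.app2 (by unfold prod; infer_instance)

/-- The first component of an ordered pair. -/
noncomputable def fst (p : M) : M := iota fun x => ∃ y, p = opair x y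

/-- The second component of an ordered pair. -/
noncomputable def snd (p : M) : M := iota fun y => ∃ x, p = opair x y

@[simp] theorem fst_opair (x y : M) : fst (opair x y) = x :=
  iota_eq ⟨y, rfl⟩ (by rintro z ⟨w, h⟩; exact (opair_inj.1 h).1.symm)

@[simp] theorem snd_opair (x y : M) : snd (opair x y) = y :=
  iota_eq ⟨x, rfl⟩ (by rintro z ⟨w, h⟩; exact (opair_inj.1 h).2.symm)

instance {a : (ℕ → M) → M} [DFn a] : DFn (fun v => fst (a v)) :=
  DFn.app1 (by unfold fst; infer_instance)

instance {a : (ℕ → M) → M} [DFn a] : DFn (fun v => snd (a v)) :=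
  DFn.app1 (by unfold snd; infer_instance)

/-! ### Functions -/

@[simp] theorem appRel_iff {f x y : M} : AppRel f x y ↔ opair x y ∈ₘ f := by
  simp [AppRel, isOPair_iff]

theorem isFunOn_iff {f a : M} : IsFunOn f a ↔
    (∀ p, p ∈ₘ f → ∃ x y, x ∈ₘ a ∧ p = opair x y) ∧ ∀ x, x ∈ₘ a → ∃! y, opair x y ∈ₘ f := by
  simp [IsFunOn, isOPair_iff]

theorem IsFunOn.mem_dom {f a x y : M} (h : IsFunOn f a) (hxy : opair x y ∈ₘ f) : x ∈ₘ a := by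
  obtain ⟨x', y', hx, e⟩ := (isFunOn_iff.1 h).1 _ hxy
  rwa [(opair_inj.1 e).1]

theorem IsFunOn.mem_iff {f a x y : M} (h : IsFunOn f a) :
    opair x y ∈ₘ f ↔ x ∈ₘ a ∧ y = app f x := by
  have h2 := (isFunOn_iff.1 h).2
  constructor
  · intro hxy
    have hx := h.mem_dom hxy
    exact ⟨hx, (h2 x hx).unique hxy (iota_spec (h2 x hx))⟩
  · rintro ⟨hx, rfl⟩
    exact iota_spec (h2 x hx)

theorem IsFunOn.app_mem {f a x : M} (h : IsFunOn f a) (hx : x ∈ₘ a) : opair x (app f x) ∈ₘ f :=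
  h.mem_iff.2 ⟨hx, rfl⟩

theorem IsFunOn.app_eq {f a x y : M} (h : IsFunOn f a) (hxy : opair x y ∈ₘ f) : app f x = y :=
  (h.mem_iff.1 hxy).2.symm

theorem IsFunOn.eq_lam {f a : M} (h : IsFunOn f a) : f = lam a (app f) := by
  refine ext fun p => ⟨fun hp => ?_, fun hp => ?_⟩
  · obtain ⟨x, y, hx, rfl⟩ := (isFunOn_iff.1 h).1 p hp
    exact opair_mem_lam.2 (h.mem_iff.1 hp)
  · obtain ⟨x, hx, rfl⟩ := mem_lam.1 hp
    exact h.app_mem hx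

theorem isFunOn_lam (a : M) (F : M → M) [DFn (fun v : ℕ → M => F (v 0))] : IsFunOn (lam a F) a := by
  refine isFunOn_iff.2 ⟨fun p hp => ?_, fun x hx => ⟨F x, by simp [hx], by simp⟩⟩
  obtain ⟨x, hx, rfl⟩ := mem_lam.1 hp
  exact ⟨x, F x, hx, rfl⟩

theorem IsFun.app_mem {f a b x : M} (h : IsFun f a b) (hx : x ∈ₘ a) : app f x ∈ₘ b :=
  h.2 x _ (appRel_iff.2 (h.1.app_mem hx))

theorem isFun_lam {a b : M} {F : M → M} [DFn (fun v : ℕ → M => F (v 0))]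
    (h : ∀ x, x ∈ₘ a → F x ∈ₘ b) : IsFun (lam a F) a b :=
  ⟨isFunOn_lam a F, fun x y hxy => by
    rw [appRel_iff, opair_mem_lam] at hxy
    rw [hxy.2]
    exact h x hxy.1⟩

theorem IsFunOn.ext {f g a : M} (hf : IsFunOn f a) (hg : IsFunOn g a)
    (h : ∀ x, x ∈ₘ a → app f x = app g x) : f = g := by
  rw [hf.eq_lam, hg.eq_lam]
  exact lam_congr h

theorem IsFun.incl_prod {f a b : M} (h : IsFun f a b) : Incl f (prod a b) := fun p hp => by
  obtain ⟨x, y, hx, rfl⟩ := (isFunOn_iff.1 h.1).1 p hp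
  exact opair_mem_prod.2 ⟨hx, h.2 x y (appRel_iff.2 hp)⟩

theorem IsInjection.app_inj {f a b x y : M} (h : IsInjection f a b) (hx : x ∈ₘ a) (hy : y ∈ₘ a)
    (e : app f x = app f y) : x = y :=
  h.2 x y (app f x) (appRel_iff.2 (h.1.1.app_mem hx)) (appRel_iff.2 (e ▸ h.1.1.app_mem hy))

theorem isInjection_lam {a b : M} {F : M → M} [DFn (fun v : ℕ → M => F (v 0))]
    (h : ∀ x, x ∈ₘ a → F x ∈ₘ b) (hi : ∀ x y, x ∈ₘ a → y ∈ₘ a → F x = F y → x = y) :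
    IsInjection (lam a F) a b := by
  refine ⟨isFun_lam h, fun x x' y hx hx' => ?_⟩
  rw [appRel_iff, opair_mem_lam] at hx hx'
  exact hi x x' hx.1 hx'.1 (hx.2.symm.trans hx'.2)

theorem isSurjection_lam {a b : M} {F : M → M} [DFn (fun v : ℕ → M => F (v 0))]
    (h : ∀ x, x ∈ₘ a → F x ∈ₘ b) (hs : ∀ y, y ∈ₘ b → ∃ x, x ∈ₘ a ∧ y = F x) :
    IsSurjection (lam a F) a b := by
  refine ⟨isFun_lam h, fun y hy => ?_⟩
  obtain ⟨x, hx, e⟩ := hs y hy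
  exact ⟨x, appRel_iff.2 (opair_mem_lam.2 ⟨hx, e⟩)⟩

theorem IsSurjection.exists_app {f a b y : M} (h : IsSurjection f a b) (hy : y ∈ₘ b) :
    ∃ x, x ∈ₘ a ∧ app f x = y := by
  obtain ⟨x, hx⟩ := h.2 y hy
  rw [appRel_iff] at hx
  exact ⟨x, h.1.1.mem_dom hx, h.1.1.app_eq hx⟩

end Basic

/-! ### Ordinals, natural numbers and transfinite recursion -/

section Ordinals

variable {M : Type u} [EpsStructure M]

theorem IsOrd.mem {α β : M} (h : IsOrd α) (hβ : β ∈ₘ α) : IsOrd β :=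
  ⟨h.2 β hβ, fun γ hγ => h.2 γ (h.1 β hβ γ hγ)⟩

theorem IsOrd.trans {α β γ : M} (h : IsOrd α) (hγ : γ ∈ₘ β) (hβ : β ∈ₘ α) : γ ∈ₘ α :=
  h.1 β hβ γ hγ

theorem IsNat.mem {n m : M} (h : IsNat n) (hm : m ∈ₘ n) : IsNat m :=
  ⟨h.1.mem hm, h.2.2 m hm, fun i hi => h.2.2 i (h.1.trans hi hm)⟩

variable [ZF M]

/-- `x` is an `∈`-minimal element of `a`. -/
theorem exists_min {a y : M} (hy : y ∈ₘ a) : ∃ x, x ∈ₘ a ∧ ∀ z, z ∈ₘ x → ¬ z ∈ₘ a :=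
  ZF.out.foundation a ⟨y, hy⟩

theorem mem_irrefl (x : M) : ¬ x ∈ₘ x := fun h => by
  obtain ⟨y, hy, hm⟩ := exists_min (a := upair x x) (y := x) (by simp)
  obtain rfl : y = x := by simpa using hy
  exact hm y h hy

theorem mem_asymm {x y : M} (h : x ∈ₘ y) : ¬ y ∈ₘ x := fun h' => by
  obtain ⟨z, hz, hm⟩ := exists_min (a := upair x y) (y := x) (by simp)
  rcases mem_upair.1 hz with rfl | rfl
  · exact hm _ h' (by simp)
  · exact hm _ h (by simp)

/-- Otherwise `x ∈ {x} ∈ (x, y) ∈ x` is a cycle, against foundation. This makes the pairs `(X, σ)`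
available as new elements outside `X` when the automorphism group is built over `X`. -/
theorem opair_not_mem_left (x y : M) : ¬ opair x y ∈ₘ x := fun h => by
  obtain ⟨z, hz, hm⟩ := exists_min (a := cup (upair x (upair x x)) (upair (opair x y) x)) (y := x)
    (by simp)
  simp only [mem_cup, mem_upair] at hz hm
  rcases hz with (rfl | rfl) | (rfl | rfl)
  · exact hm _ h (by simp)
  · exact hm x (by simp) (by simp)
  · exact hm (upair x x) (by simp [opair]) (by simp)
  · exact hm _ h (by simp)

theorem isOrd_emp : IsOrd (emp : M) := ⟨fun y hy => by simp at hy, fun y hy => by simp at hy⟩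

theorem IsOrd.succ {α : M} (h : IsOrd α) : IsOrd (succ α) := by
  constructor
  · intro y hy z hz
    rcases mem_succ.1 hy with hy | rfl
    · exact mem_succ.2 (Or.inl (h.trans hz hy))
    · exact mem_succ.2 (Or.inl hz)
  · intro y hy
    rcases mem_succ.1 hy with hy | rfl
    · exact h.2 y hy
    · exact h.1

theorem exists_isLeastOrd {P : M → Prop} [Dfn (fun v : ℕ → M => P (v 0))] {α : M} (hα : IsOrd α)
    (h : P α) : ∃ β, IsLeastOrd P β := by
  obtain ⟨β, hβ, hm⟩ := exists_min (a := sep (succ α) P) (y := α) (by simp [h])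
  rw [mem_sep] at hβ
  refine ⟨β, hα.succ.mem hβ.1, hβ.2, fun γ hγ hP => hm γ hγ ?_⟩
  exact mem_sep.2 ⟨hα.succ.trans hγ hβ.1, hP⟩

theorem ord_induction {P : M → Prop} [Dfn (fun v : ℕ → M => P (v 0))]
    (h : ∀ α, IsOrd α → (∀ β, β ∈ₘ α → P β) → P α) {α : M} (hα : IsOrd α) : P α := by
  by_contra hn
  obtain ⟨β, hβ, hnβ, hm⟩ := exists_isLeastOrd (P := fun x => ¬ P x) hα hn
  exact hnβ (h β hβ fun γ hγ => not_not.1 (hm γ hγ))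

theorem IsOrd.trichotomy {α β : M} (hα : IsOrd α) (hβ : IsOrd β) :
    α ∈ₘ β ∨ α = β ∨ β ∈ₘ α := by
  revert β
  -- Double induction: the outer one over `α` for all `β`, the inner one over `β` for this `α`.
  refine ord_induction (P := fun α => ∀ {β}, IsOrd β → α ∈ₘ β ∨ α = β ∨ β ∈ₘ α) ?_ hα
  intro α hα ih β hβ
  refine ord_induction (P := fun β => α ∈ₘ β ∨ α = β ∨ β ∈ₘ α) ?_ hβ
  intro β hβ ih'
  by_cases h1 : Incl α β
  · by_cases h2 : Incl β α
    · exact Or.inr (Or.inl (h1.antisymm h2))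
    · simp only [Incl, not_forall] at h2
      obtain ⟨γ, hγ, hn⟩ := h2
      rcases ih' γ hγ with h | rfl | h
      · exact Or.inl (hβ.trans h hγ)
      · exact Or.inl hγ
      · exact absurd h hn
  · simp only [Incl, not_forall] at h1
    obtain ⟨γ, hγ, hn⟩ := h1
    rcases ih γ hγ hβ with h | rfl | h
    · exact absurd h hn
    · exact Or.inr (Or.inr hγ)
    · exact Or.inr (Or.inr (hα.trans h hγ))

theorem IsOrd.mem_or_eq_of_incl {α β : M} (hα : IsOrd α) (hβ : IsOrd β) (h : Incl α β) :
    α ∈ₘ β ∨ α = β := by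
  rcases hα.trichotomy hβ with h' | h' | h'
  · exact Or.inl h'
  · exact Or.inr h'
  · exact absurd (h _ h') (mem_irrefl _)

theorem IsOrd.succ_mem_or_eq {α β : M} (hα : IsOrd α) (h : β ∈ₘ α) :
    ZFModel.succ β ∈ₘ α ∨ ZFModel.succ β = α := by
  refine (hα.mem h).succ.mem_or_eq_of_incl hα fun z hz => ?_
  rcases mem_succ.1 hz with hz | rfl
  · exact hα.trans hz h
  · exact h

theorem succ_inj {α β : M} (h : succ α = succ β) : α = β := by
  have h1 : α ∈ₘ succ β := h ▸ self_mem_succ α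
  have h2 : β ∈ₘ succ α := h ▸ self_mem_succ β
  rcases mem_succ.1 h1 with h1 | h1
  · rcases mem_succ.1 h2 with h2 | h2
    · exact absurd h2 (mem_asymm h1)
    · exact h2.symm
  · exact h1

theorem succ_ne_emp (α : M) : succ α ≠ emp := fun h => not_mem_emp α (h ▸ self_mem_succ α)

theorem sUnion_succ {α : M} (h : IsOrd α) : sUnion (succ α) = α := by
  refine ext fun z => ?_
  simp only [mem_sUnion, mem_succ]
  constructor
  · rintro ⟨y, hy | rfl, hz⟩
    · exact h.trans hz hy
    · exact hz
  · exact fun hz => ⟨α, Or.inr rfl, hz⟩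

theorem isLimit_iff {δ : M} : IsLimit δ ↔ IsOrd δ ∧ δ ≠ emp ∧ ∀ β, δ ≠ succ β := by
  simp [IsLimit, isEmptySet_iff, isSucc_iff]

theorem IsOrd.emp_mem {α : M} (h : IsOrd α) (h0 : α ≠ emp) : emp ∈ₘ α := by
  rcases isOrd_emp.trichotomy h with h' | h' | h'
  · exact h'
  · exact absurd h'.symm h0
  · simp at h'

theorem IsOrd.cases {α : M} (h : IsOrd α) :
    α = emp ∨ (∃ β, IsOrd β ∧ α = ZFModel.succ β) ∨ IsLimit α := by
  by_cases h0 : α = emp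
  · exact Or.inl h0
  by_cases h1 : ∃ β, α = ZFModel.succ β
  · obtain ⟨β, rfl⟩ := h1
    exact Or.inr (Or.inl ⟨β, h.mem (self_mem_succ β), rfl⟩)
  · exact Or.inr (Or.inr (isLimit_iff.2 ⟨h, h0, not_exists.1 h1⟩))

/-- Transfinite induction below the ordinal `l`. -/
theorem ord_induction_below {l : M} (hl : IsOrd l) {P : M → Prop} [Dfn (fun v : ℕ → M => P (v 0))]
    (h0 : emp ∈ₘ l → P emp) (hs : ∀ β, β ∈ₘ l → succ β ∈ₘ l → P β → P (succ β))
    (hlim : ∀ δ, δ ∈ₘ l → IsLimit δ → (∀ β, β ∈ₘ δ → P β) → P δ) {α : M} (hα : α ∈ₘ l) : P α := by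
  refine ord_induction (P := fun α => α ∈ₘ l → P α) ?_ (hl.mem hα) hα
  intro α hα ih hαl
  rcases hα.cases with rfl | ⟨β, hβ, rfl⟩ | hδ
  · exact h0 hαl
  · have := hl.trans (self_mem_succ β) hαl
    exact hs β this hαl (ih β (self_mem_succ β) this)
  · exact hlim α hαl hδ fun β hβ => ih β hβ (hl.trans hβ hαl)

/-! ### Natural numbers -/

theorem isZeroOrSucc_iff {x : M} : IsZeroOrSucc x ↔ x = emp ∨ ∃ y, x = succ y := by
  simp [IsZeroOrSucc, isEmptySet_iff, isSucc_iff]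

theorem isNat_emp : IsNat (emp : M) :=
  ⟨isOrd_emp, isZeroOrSucc_iff.2 (Or.inl rfl), fun m hm => by simp at hm⟩

theorem IsNat.succ {n : M} (h : IsNat n) : IsNat (succ n) := by
  refine ⟨h.1.succ, isZeroOrSucc_iff.2 (Or.inr ⟨n, rfl⟩), fun m hm => ?_⟩
  rcases mem_succ.1 hm with hm | rfl
  · exact h.2.2 m hm
  · exact h.2.1

theorem nat_induction {P : M → Prop} [Dfn (fun v : ℕ → M => P (v 0))] (h0 : P emp)
    (hs : ∀ n, IsNat n → P n → P (succ n)) {n : M} (hn : IsNat n) : P n := by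
  refine ord_induction (P := fun n => IsNat n → P n) ?_ hn.1 hn
  intro n _ ih hn
  rcases isZeroOrSucc_iff.1 hn.2.1 with rfl | ⟨m, rfl⟩
  · exact h0
  · have hm := hn.mem (self_mem_succ m)
    exact hs m hm (ih m (self_mem_succ m) hm)

theorem exists_omega : ∃ w : M, ∀ n, n ∈ₘ w ↔ IsNat n := by
  obtain ⟨w, ⟨z, hz, hzw⟩, hs⟩ := (ZF.out : IsModelZF M).infinity
  rw [isEmptySet_iff] at hz
  subst hz
  refine ⟨sep w IsNat, fun n => ?_⟩
  rw [mem_sep, and_iff_right_iff_imp]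
  refine nat_induction (P := fun n => n ∈ₘ w) hzw fun n _ hn => ?_
  obtain ⟨s, h, hsw⟩ := hs n hn
  rwa [isSucc_iff.1 h] at hsw

/-! ### Transfinite recursion -/

/-- `f` is the restriction to `α` of the function defined by recursion from `F`. -/
def IsApprox (F : M → M → M) (f α : M) : Prop :=
  f = lam α (app f) ∧ ∀ β, β ∈ₘ α → app f β = F β (lam β (app f))

/-- The function `H` on the ordinals with `H α = F α (H ↾ α)`. -/
noncomputable def trec (F : M → M → M) (α : M) : M := F α (iota fun f => IsApprox F f α)

instance {F : (ℕ → M) → M → M → M} {a : (ℕ → M) → M}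
    [h : DFn (fun v => F (fun i => v (i + 2)) (v 1) (v 0))] [ha : DFn a] :
    DFn (fun v => trec (F v) (a v)) := by
  have h1 : DFn (fun v => F (fun i => v (i + 3)) (v 0) (v 1)) :=
    h.shift (fun n => match n with | 0 => 1 | 1 => 0 | i + 2 => i + 3)
  have h2 : DFn (fun v => F (fun i => v (i + 2)) (v 0) (lam (v 0) (app (v 1)))) := by
    refine ⟨Dfn.subst (P := fun v x => v 0 = F (fun i => v (i + 3)) (v 1) x)
      (t := fun v => lam (v 1) (app (v 2))) ?_ inferInstance⟩
    exact DFn.graph_var h 1 (fun n => match n with | 0 => 0 | 1 => 2 | i + 2 => i + 4)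
  have ha1 := ha.shift (· + 1)
  have ha2 := ha.shift (· + 2)
  have h3 : DFn (fun v => iota fun f => IsApprox (F v) f (a v)) := by
    unfold IsApprox
    infer_instance
  refine ⟨Dfn.subst (P := fun v x => v 0 = F (fun i => v (i + 1)) (a (fun i => v (i + 1))) x)
    ?_ (h3.shift (· + 1))⟩
  refine Dfn.subst (P := fun v x => v 1 = F (fun i => v (i + 2)) x (v 0)) ?_ ha2
  exact DFn.graph_var h 2 (fun n => match n with | 0 => 1 | 1 => 0 | i + 2 => i + 3)

/-- Existence and uniqueness of the approximation are proved together by induction: uniqueness below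
`α` identifies the restrictions of an approximation with the values of `trec F`. That `trec F`
restricted to `α` is a set is replacement, since `trec F` is definable. -/
theorem isApprox_trec {F : M → M → M} [h : DFn (fun v : ℕ → M => F (v 1) (v 0))] {α : M}
    (hα : IsOrd α) : IsApprox F (lam α (trec F)) α ∧
      ∀ f, IsApprox F f α → f = lam α (trec F) := by
  have key : ∀ (f β : M), lam β (app f) = lam β (app (lam β (app f))) := fun f β =>
    lam_congr fun x hx => (app_lam hx).symm
  have hF : ∀ {a b : (ℕ → M) → M} [DFn a] [DFn b], DFn (fun v => F (a v) (b v)) :=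
    DFn.app2 (h.graph_var 0 fun n => Nat.casesOn n 2 fun _ => 1)
  have hA : ∀ {a b : (ℕ → M) → M} [DFn a] [DFn b], Dfn (fun v => IsApprox F (a v) (b v)) :=
    Dfn.app2 (by unfold IsApprox; infer_instance)
  refine ord_induction (P := fun α => IsApprox F (lam α (trec F)) α ∧
      ∀ f, IsApprox F f α → f = lam α (trec F)) ?_ hα
  intro α hα ih
  have hrec : ∀ β, β ∈ₘ α → trec F β = F β (lam β (trec F)) := fun β hβ => by
    rw [trec, iota_eq (P := fun f => IsApprox F f β) (ih β hβ).1 (ih β hβ).2]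
  refine ⟨⟨lam_congr fun x hx => (app_lam hx).symm, fun β hβ => ?_⟩, fun f hf => ?_⟩
  · rw [app_lam hβ, hrec β hβ]
    congr 1
    exact lam_congr fun x hx => (app_lam (hα.trans hx hβ)).symm
  · rw [hf.1]
    refine lam_congr fun β hβ => ?_
    rw [hf.2 β hβ, hrec β hβ]
    congr 1
    refine (ih β hβ).2 _ ⟨key _ _, fun γ hγ => ?_⟩
    rw [app_lam hγ, hf.2 γ (hα.trans hγ hβ)]
    congr 1
    exact lam_congr fun x hx => (app_lam ((hα.mem hβ).trans hx hγ)).symm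

theorem trec_eq (F : M → M → M) [DFn (fun v : ℕ → M => F (v 1) (v 0))] {α : M} (hα : IsOrd α) :
    trec F α = F α (lam α (trec F)) := by
  rw [trec, iota_eq (P := fun f => IsApprox F f α) (isApprox_trec hα).1 (isApprox_trec hα).2]

end Ordinals

/-! ### Finite sequences, iteration, and the ordinal `θ` of a set -/

section Sequences

variable {M : Type u} [EpsStructure M] [ZF M]

/-- The set of natural numbers. -/
noncomputable def omega : M := exists_omega.choose

@[simp] theorem mem_omega {n : M} : n ∈ₘ (omega : M) ↔ IsNat n := exists_omega.choose_spec n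

/-- The set of finite sequences of elements of `k`. -/
noncomputable def finseq (k : M) : M :=
  sep (pow (prod omega k)) fun s => ∃ n, IsNat n ∧ IsFun s n k

theorem mem_finseq {k s : M} : s ∈ₘ finseq k ↔ ∃ n, IsNat n ∧ IsFun s n k := by
  rw [finseq, mem_sep, and_iff_right_iff_imp]
  rintro ⟨n, hn, hs⟩
  rw [mem_pow]
  intro p hp
  obtain ⟨x, y, hx, hy, rfl⟩ := mem_prod.1 (hs.incl_prod p hp)
  exact opair_mem_prod.2 ⟨mem_omega.2 (hn.mem hx), hy⟩

instance {a : (ℕ → M) → M} [DFn a] : DFn (fun v => finseq (a v)) :=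
  DFn.app1 (by unfold finseq; infer_instance)

/-- The extension of the function `s` by the value `a` at `n`. -/
noncomputable def snoc (s n a : M) : M := cup s (upair (opair n a) (opair n a))

instance {a b c : (ℕ → M) → M} [DFn a] [DFn b] [DFn c] : DFn (fun v => snoc (a v) (b v) (c v)) := by
  unfold snoc; infer_instance

theorem mem_snoc {s n a p : M} : p ∈ₘ snoc s n a ↔ p ∈ₘ s ∨ p = opair n a := by
  simp [snoc]

theorem IsFun.snoc {s n k a : M} (hs : IsFun s n k) (ha : a ∈ₘ k) :
    IsFun (snoc s n a) (succ n) k := by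
  refine ⟨isFunOn_iff.2 ⟨fun p hp => ?_, fun x hx => ?_⟩, fun x y hxy => ?_⟩
  · rcases mem_snoc.1 hp with hp | rfl
    · obtain ⟨x, y, hx, rfl⟩ := (isFunOn_iff.1 hs.1).1 p hp
      exact ⟨x, y, mem_succ.2 (Or.inl hx), rfl⟩
    · exact ⟨n, a, self_mem_succ n, rfl⟩
  · rcases mem_succ.1 hx with hx | rfl
    · refine ⟨app s x, mem_snoc.2 (Or.inl (hs.1.app_mem hx)), fun y hy => ?_⟩
      rcases mem_snoc.1 hy with hy | hy
      · exact (hs.1.mem_iff.1 hy).2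
      · exact absurd ((opair_inj.1 hy).1 ▸ hx) (mem_irrefl n)
    · refine ⟨a, mem_snoc.2 (Or.inr rfl), fun y hy => ?_⟩
      rcases mem_snoc.1 hy with hy | hy
      · exact absurd (hs.1.mem_dom hy) (mem_irrefl x)
      · exact (opair_inj.1 hy).2
  · rcases mem_snoc.1 (appRel_iff.1 hxy) with h | h
    · exact hs.2 x y (appRel_iff.2 h)
    · rw [(opair_inj.1 h).2]
      exact ha

theorem IsFun.app_snoc_of_mem {s n k a i : M} (hs : IsFun s n k) (ha : a ∈ₘ k) (hi : i ∈ₘ n) :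
    app (ZFModel.snoc s n a) i = app s i :=
  (hs.snoc ha).1.app_eq (mem_snoc.2 (Or.inl (hs.1.app_mem hi)))

theorem IsFun.app_snoc_self {s n k a : M} (hs : IsFun s n k) (ha : a ∈ₘ k) :
    app (ZFModel.snoc s n a) n = a :=
  (hs.snoc ha).1.app_eq (mem_snoc.2 (Or.inr rfl))

theorem isFun_emp (k : M) : IsFun emp emp k :=
  ⟨isFunOn_iff.2 ⟨fun p hp => absurd hp (not_mem_emp p), fun x hx => absurd hx (not_mem_emp x)⟩,
    fun _ _ h => absurd (appRel_iff.1 h) (not_mem_emp _)⟩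

theorem IsFunOn.dom_unique {f a b : M} (ha : IsFunOn f a) (hb : IsFunOn f b) : a = b :=
  ZFModel.ext fun _ => ⟨fun hx => hb.mem_dom (ha.app_mem hx), fun hx => ha.mem_dom (hb.app_mem hx)⟩

/-- The `i`-th iterate from `g` with the step `F`. -/
noncomputable def nrec (g : M) (F : M → M → M) (i : M) : M :=
  trec (fun i r => ifte (i = emp) g (F (sUnion i) (app r (sUnion i)))) i

theorem nrec_emp (g : M) (F : M → M → M) [h : DFn (fun v : ℕ → M => F (v 1) (v 0))] :
    nrec g F emp = g := by
  have hF : ∀ {a b : (ℕ → M) → M} [DFn a] [DFn b], DFn (fun v => F (a v) (b v)) :=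
    DFn.app2 (h.graph_var 0 fun n => Nat.casesOn n 2 fun _ => 1)
  rw [nrec, trec_eq _ isOrd_emp, ifte_pos rfl]

theorem nrec_succ (g : M) (F : M → M → M) [h : DFn (fun v : ℕ → M => F (v 1) (v 0))] {i : M}
    (hi : IsOrd i) : nrec g F (succ i) = F i (nrec g F i) := by
  have hF : ∀ {a b : (ℕ → M) → M} [DFn a] [DFn b], DFn (fun v => F (a v) (b v)) :=
    DFn.app2 (h.graph_var 0 fun n => Nat.casesOn n 2 fun _ => 1)
  -- The step function finds the predecessor of a successor ordinal as its union.
  rw [nrec, trec_eq _ hi.succ, ifte_neg (succ_ne_emp i), sUnion_succ hi, app_lam (self_mem_succ i)]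
  rfl

instance {g : (ℕ → M) → M} {F : (ℕ → M) → M → M → M} {a : (ℕ → M) → M} [hg : DFn g]
    [h : DFn (fun v => F (fun i => v (i + 2)) (v 1) (v 0))] [ha : DFn a] :
    DFn (fun v => nrec (g v) (F v) (a v)) := by
  have hg2 := hg.shift (· + 2)
  have h1 : DFn (fun v => F (fun i => v (i + 2)) (sUnion (v 1)) (app (v 0) (sUnion (v 1)))) := by
    refine ⟨Dfn.subst (P := fun v x => v 0 = F (fun i => v (i + 3)) x (app (v 1) x))
      (t := fun v => sUnion (v 2)) ?_ inferInstance⟩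
    refine Dfn.subst (P := fun v x => v 1 = F (fun i => v (i + 4)) (v 0) x)
      (t := fun v => app (v 2) (v 0)) ?_ inferInstance
    exact DFn.graph_var h 2 (fun n => match n with | 0 => 0 | 1 => 1 | i + 2 => i + 5)
  unfold nrec
  infer_instance

/-! ### Ordinals onto which a set can be mapped -/

/-- A map onto an ordinal is the transitive collapse of the relation that it pulls back from `∈`, so
the relation determines both the map and the ordinal. -/
theorem surjection_ord_unique {A α α' f f' : M} (hα : IsOrd α) (hα' : IsOrd α')
    (hf : IsSurjection f A α) (hf' : IsSurjection f' A α')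
    (h : ∀ x y, x ∈ₘ A → y ∈ₘ A → (app f x ∈ₘ app f y ↔ app f' x ∈ₘ app f' y)) : α = α' := by
  have key : ∀ β, IsOrd β → ∀ x, x ∈ₘ A → app f x = β → app f' x = β := by
    intro β hβ
    refine ord_induction (P := fun β => ∀ x, x ∈ₘ A → app f x = β → app f' x = β) ?_ hβ
    rintro β hβ ih x hx rfl
    refine ext fun γ => ⟨fun hγ => ?_, fun hγ => ?_⟩
    · obtain ⟨y, hy, rfl⟩ := hf'.exists_app (hα'.trans hγ (hf'.1.app_mem hx))
      have h1 := (h y x hy hx).2 hγ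
      rwa [ih _ h1 y hy rfl]
    · obtain ⟨y, hy, rfl⟩ := hf.exists_app (hα.trans hγ (hf.1.app_mem hx))
      have h1 := (h y x hy hx).1 hγ
      rwa [ih _ hγ y hy rfl] at h1
  have key' : ∀ x, x ∈ₘ A → app f' x = app f x := fun x hx =>
    key _ (hα.mem (hf.1.app_mem hx)) x hx rfl
  refine ext fun γ => ⟨fun hγ => ?_, fun hγ => ?_⟩
  · obtain ⟨y, hy, rfl⟩ := hf.exists_app hγ
    rw [← key' y hy]
    exact hf'.1.app_mem hy
  · obtain ⟨y, hy, rfl⟩ := hf'.exists_app hγ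
    rw [key' y hy]
    exact hf.1.app_mem hy

theorem IsSurjection.of_mem {A α β f : M} (hα : IsOrd α) (hf : IsSurjection f A α) (hβ : β ∈ₘ α)
    (h0 : β ≠ emp) : IsSurjection (lam A fun x => ifte (app f x ∈ₘ β) (app f x) emp) A β := by
  refine isSurjection_lam (fun x _ => ?_) fun y hy => ?_
  · by_cases h : app f x ∈ₘ β
    · rwa [ifte_pos h]
    · rw [ifte_neg h]
      exact (hα.mem hβ).emp_mem h0
  · obtain ⟨x, hx, rfl⟩ := hf.exists_app (hα.trans hy hβ)
    exact ⟨x, hx, by rw [ifte_pos hy]⟩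

/-- The ordinals onto which `A` can be mapped form a set: each is determined by the pulled-back
relation on `A`, so they are the image of `𝒫(A × A)` under a definable partial function. They are
closed downwards apart from `0`, which is adjoined; the resulting ordinal is `θ`. -/
theorem exists_theta (A : M) :
    ∃ θ, IsTheta A θ ∧ ∀ α, α ∈ₘ θ ↔ IsOrd α ∧ (α = emp ∨ ∃ f, IsSurjection f A α) := by
  obtain ⟨b, hb⟩ := exists_repl (fun r α : M => IsOrd α ∧ ∃ f, IsSurjection f A α ∧
    r = sep (prod A A) fun p => ∃ x y, p = opair x y ∧ app f x ∈ₘ app f y) (pow (prod A A)) (by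
      rintro r - α α' ⟨hα, f, hf, rfl⟩ ⟨hα', f', hf', e⟩
      refine surjection_ord_unique hα hα' hf hf' fun x y hx hy => ?_
      have h := iff_of_eq (congrArg (fun r => opair x y ∈ₘ r) e)
      simpa [hx, hy] using h)
  have hb' : ∀ α, α ∈ₘ b ↔ IsOrd α ∧ ∃ f, IsSurjection f A α := fun α => by
    rw [hb]
    refine ⟨fun ⟨r, _, h, f, hf, _⟩ => ⟨h, f, hf⟩, fun ⟨h, f, hf⟩ => ⟨_, ?_, h, f, hf, rfl⟩⟩
    rw [mem_pow]
    exact fun p hp => (mem_sep.1 hp).1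
  -- A nonempty `A` has no map onto `0`, so `0` has to be put in separately.
  let θ := cup b (upair emp emp)
  have hθ : ∀ α, α ∈ₘ θ ↔ IsOrd α ∧ (α = emp ∨ ∃ f, IsSurjection f A α) := fun α => by
    simp only [θ, mem_cup, mem_upair, or_self, hb']
    constructor
    · rintro (⟨h, h'⟩ | rfl)
      · exact ⟨h, Or.inr h'⟩
      · exact ⟨isOrd_emp, Or.inl rfl⟩
    · rintro ⟨h, h' | h'⟩
      · exact Or.inr h'
      · exact Or.inl ⟨h, h'⟩
  have hord : IsOrd θ := by
    refine ⟨fun α hα β hβ => ?_, fun α hα => ((hθ α).1 hα).1.1⟩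
    obtain ⟨h, rfl | ⟨f, hf⟩⟩ := (hθ α).1 hα
    · simp at hβ
    · refine (hθ β).2 ⟨h.mem hβ, ?_⟩
      by_cases h0 : β = emp
      · exact Or.inl h0
      · exact Or.inr ⟨_, hf.of_mem h hβ h0⟩
  refine ⟨θ, ⟨hord, ⟨?_, fun h => mem_irrefl θ ((hθ θ).2 ⟨hord, Or.inr h⟩)⟩, ?_⟩, hθ⟩
  · exact fun h => h emp ((hθ emp).2 ⟨isOrd_emp, Or.inl rfl⟩)
  · rintro β hβ ⟨h1, h2⟩
    rcases ((hθ β).1 hβ).2 with rfl | h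
    · exact h1 not_mem_emp
    · exact h2 h

end Sequences

/-! ### Groups of the model and their elements as groups in Lean -/

section Groups

variable {M : Type u} [EpsStructure M] [ZF M]

theorem mulRel_iff {m x y z : M} : MulRel m x y z ↔ opair (opair x y) z ∈ₘ m := by
  simp [MulRel, isOPair_iff]

theorem MulRel.mono {m n x y z : M} (h : MulRel m x y z) (hmn : Incl m n) : MulRel n x y z :=
  mulRel_iff.2 (hmn _ (mulRel_iff.1 h))

/-- The product of `x` and `y` for the operation `m`. -/
noncomputable def mul (m x y : M) : M := iota fun z => MulRel m x y z

/-- The identity element of the group operation `m`. -/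
noncomputable def one (m : M) : M := iota fun e => MulRel m e e e

/-- The inverse of `x` for the group operation `m`. -/
noncomputable def inv (m x : M) : M := iota fun y => MulRel m x y (one m)

/-- The conjugate `g x g⁻¹` for the group operation `m`. -/
noncomputable def conj (m g x : M) : M := iota fun y => ∃ w, MulRel m g x w ∧ MulRel m y g w

instance {a : (ℕ → M) → M} [DFn a] : DFn (fun v => one (a v)) :=
  DFn.app1 (by unfold one; infer_instance)

instance {a b c : (ℕ → M) → M} [DFn a] [DFn b] [DFn c] : DFn (fun v => conj (a v) (b v) (c v)) :=
  DFn.app3 (by unfold conj; infer_instance)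

theorem IsBinOp.mulRel_mem {X m x y z : M} (h : IsBinOp X m) (hz : MulRel m x y z) :
    x ∈ₘ X ∧ y ∈ₘ X ∧ z ∈ₘ X := by
  obtain ⟨x', y', z', q, hx, hy, hz', hq, ht⟩ := h.1 _ (mulRel_iff.1 hz)
  rw [isOPair_iff.1 hq, isOPair_iff, opair_inj, opair_inj] at ht
  obtain ⟨⟨rfl, rfl⟩, rfl⟩ := ht
  exact ⟨hx, hy, hz'⟩

theorem IsBinOp.mulRel_iff {X m x y z : M} (h : IsBinOp X m) :
    MulRel m x y z ↔ x ∈ₘ X ∧ y ∈ₘ X ∧ z = mul m x y := by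
  constructor
  · intro hz
    obtain ⟨hx, hy, -⟩ := h.mulRel_mem hz
    exact ⟨hx, hy, (h.2 x y hx hy).unique hz (iota_spec (h.2 x y hx hy))⟩
  · rintro ⟨hx, hy, rfl⟩
    exact iota_spec (h.2 x y hx hy)

theorem IsBinOp.mulRel_mul {X m x y : M} (h : IsBinOp X m) (hx : x ∈ₘ X) (hy : y ∈ₘ X) :
    MulRel m x y (mul m x y) :=
  h.mulRel_iff.2 ⟨hx, hy, rfl⟩

theorem IsBinOp.mul_mem {X m x y : M} (h : IsBinOp X m) (hx : x ∈ₘ X) (hy : y ∈ₘ X) :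
    mul m x y ∈ₘ X :=
  (h.mulRel_mem (h.mulRel_mul hx hy)).2.2

theorem IsBinOp.mul_eq {X m x y z : M} (h : IsBinOp X m) (hz : MulRel m x y z) : mul m x y = z :=
  (h.mulRel_iff.1 hz).2.2.symm

/-- Totality of the smaller operation and single-valuedness of the larger leave no room between
them. At a step of the tower where the underlying set does not grow, this gives equality of the
operations as well. -/
theorem IsBinOp.eq_of_incl {X m n : M} (hm : IsBinOp X m) (hn : IsBinOp X n) (h : Incl m n) :
    m = n := by
  refine h.antisymm fun t ht => ?_
  obtain ⟨x, y, z, q, hx, hy, hz, hq, hqt⟩ := hn.1 t ht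
  obtain rfl := isOPair_iff.1 hq
  obtain rfl := isOPair_iff.1 hqt
  have h1 := hm.mulRel_mul hx hy
  rw [← hn.mul_eq (ZFModel.mulRel_iff.2 ht), hn.mul_eq (h1.mono h)]
  exact ZFModel.mulRel_iff.1 h1

/-- The elements of the set `X` as a type. -/
abbrev El (X : M) : Type u := {x : M // x ∈ₘ X}

theorem El.mem {X : M} (a : El X) : a.1 ∈ₘ X := a.2

/-- The group on the elements of `X`. -/
noncomputable abbrev IsGroup.group {X m : M} (h : IsGroup X m) : Group (El X) :=
  let e := h.2.2.choose
  have he : IsIdentity X m e := h.2.2.choose_spec.1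
  have hinv := h.2.2.choose_spec.2
  letI : Mul (El X) := ⟨fun a b => ⟨mul m a b, h.1.mul_mem a.2 b.2⟩⟩
  letI : One (El X) := ⟨⟨e, he.1⟩⟩
  letI : Inv (El X) := ⟨fun a => ⟨(hinv a.1 a.2).choose, (hinv a.1 a.2).choose_spec.1⟩⟩
  Group.ofLeftAxioms
    (fun a b c => Subtype.ext <| (h.1.mul_eq <|
      h.2.1 _ _ _ _ _ _ (h.1.mulRel_mul a.2 b.2) (h.1.mulRel_mul b.2 c.2)
        (h.1.mulRel_mul (h.1.mul_mem a.2 b.2) c.2)).symm)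
    (fun a => Subtype.ext (h.1.mul_eq (he.2 a.1 a.2).1))
    (fun a => Subtype.ext (h.1.mul_eq (hinv a.1 a.2).choose_spec.2.2))

theorem IsGroup.coe_mul {X m : M} (h : IsGroup X m) (a b : El X) :
    letI := h.group; ((a * b : El X) : M) = mul m a b := rfl

theorem IsGroup.coe_one {X m : M} (h : IsGroup X m) :
    letI := h.group; ((1 : El X) : M) = one m := by
  let := h.group
  refine (iota_eq (P := fun e => MulRel m e e e) ?_ fun y hy => ?_).symm
  · rw [h.1.mulRel_iff]
    refine ⟨El.mem _, El.mem _, ?_⟩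
    rw [← h.coe_mul, one_mul]
  · obtain ⟨hy1, -, e⟩ := h.1.mulRel_iff.1 hy
    have : (⟨y, hy1⟩ : El X) * ⟨y, hy1⟩ = ⟨y, hy1⟩ := Subtype.ext e.symm
    exact congrArg Subtype.val (mul_eq_left.1 this)

theorem IsGroup.coe_inv {X m : M} (h : IsGroup X m) (a : El X) :
    letI := h.group; ((a⁻¹ : El X) : M) = inv m a := by
  let := h.group
  refine (iota_eq (P := fun y => MulRel m a y (one m)) ?_ fun y hy => ?_).symm
  · rw [h.1.mulRel_iff]
    refine ⟨El.mem _, El.mem _, ?_⟩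
    rw [← h.coe_mul, mul_inv_cancel, h.coe_one]
  · obtain ⟨-, hy1, e⟩ := h.1.mulRel_iff.1 hy
    have : a * ⟨y, hy1⟩ = 1 := Subtype.ext (e.symm.trans h.coe_one.symm)
    exact congrArg Subtype.val (inv_eq_of_mul_eq_one_right this).symm

theorem IsGroup.coe_conj {X m : M} (h : IsGroup X m) (a b : El X) :
    letI := h.group; ((a * b * a⁻¹ : El X) : M) = conj m a b := by
  let := h.group
  refine (iota_eq (P := fun y => ∃ w, MulRel m a b w ∧ MulRel m y a w) ?_ fun y hy => ?_).symm
  · refine ⟨mul m a b, h.1.mulRel_mul a.2 b.2, ?_⟩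
    rw [h.1.mulRel_iff]
    refine ⟨El.mem _, a.2, ?_⟩
    exact congrArg Subtype.val (inv_mul_cancel_right (a * b) a).symm
  · obtain ⟨w, hw, hyw⟩ := hy
    obtain ⟨-, -, rfl⟩ := h.1.mulRel_iff.1 hw
    obtain ⟨hy1, -, e⟩ := h.1.mulRel_iff.1 hyw
    have : a * b = ⟨y, hy1⟩ * a := Subtype.ext e
    rw [this, mul_inv_cancel_right]

section

variable {X m : M} {g x y z : M}

theorem IsGroup.one_mem (h : IsGroup X m) : one m ∈ₘ X := by
  let := h.group
  rw [← h.coe_one]; exact El.mem _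

theorem IsGroup.inv_mem (h : IsGroup X m) (hx : x ∈ₘ X) : inv m x ∈ₘ X := by
  let := h.group
  rw [← h.coe_inv ⟨x, hx⟩]; exact El.mem _

theorem IsGroup.mul_mem (h : IsGroup X m) (hx : x ∈ₘ X) (hy : y ∈ₘ X) : mul m x y ∈ₘ X :=
    h.1.mul_mem hx hy

theorem IsGroup.conj_mem (h : IsGroup X m) (hg : g ∈ₘ X) (hx : x ∈ₘ X) : conj m g x ∈ₘ X := by
  let := h.group
  rw [← h.coe_conj ⟨g, hg⟩ ⟨x, hx⟩]; exact El.mem _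

theorem IsGroup.one_mul (h : IsGroup X m) (hx : x ∈ₘ X) : mul m (one m) x = x := by
  let := h.group
  rw [← h.coe_one]
  exact congrArg Subtype.val (_root_.one_mul (⟨x, hx⟩ : El X))

theorem IsGroup.mul_one (h : IsGroup X m) (hx : x ∈ₘ X) : mul m x (one m) = x := by
  let := h.group
  rw [← h.coe_one]
  exact congrArg Subtype.val (_root_.mul_one (⟨x, hx⟩ : El X))

theorem IsGroup.eq_one_of_mul_self (h : IsGroup X m) (hx : x ∈ₘ X) (e : mul m x x = x) :
    x = one m := by
  let := h.group
  have : (⟨x, hx⟩ : El X) * ⟨x, hx⟩ = ⟨x, hx⟩ := Subtype.ext e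
  rw [← h.coe_one]
  exact congrArg Subtype.val (mul_eq_left.1 this)

theorem IsGroup.mul_inv (h : IsGroup X m) (hx : x ∈ₘ X) : mul m x (inv m x) = one m := by
  let := h.group
  have := congrArg Subtype.val (mul_inv_cancel (⟨x, hx⟩ : El X))
  rwa [h.coe_mul, h.coe_inv, h.coe_one] at this

theorem IsGroup.inv_mul (h : IsGroup X m) (hx : x ∈ₘ X) : mul m (inv m x) x = one m := by
  let := h.group
  have := congrArg Subtype.val (inv_mul_cancel (⟨x, hx⟩ : El X))
  rwa [h.coe_mul, h.coe_inv, h.coe_one] at this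

theorem IsGroup.mul_assoc (h : IsGroup X m) (hx : x ∈ₘ X) (hy : y ∈ₘ X) (hz : z ∈ₘ X) :
    mul m (mul m x y) z = mul m x (mul m y z) := by
  let := h.group
  exact congrArg Subtype.val (_root_.mul_assoc (⟨x, hx⟩ : El X) ⟨y, hy⟩ ⟨z, hz⟩)

theorem IsGroup.isIdentity_iff (h : IsGroup X m) : IsIdentity X m x ↔ x = one m := by
  constructor
  · intro hx
    rw [← h.one_mul hx.1]
    exact (h.1.mul_eq (hx.2 _ h.one_mem).2).symm ▸ rfl
  · rintro rfl
    refine ⟨h.one_mem, fun y hy => ⟨?_, ?_⟩⟩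
    · exact h.1.mulRel_iff.2 ⟨h.one_mem, hy, (h.one_mul hy).symm⟩
    · exact h.1.mulRel_iff.2 ⟨hy, h.one_mem, (h.mul_one hy).symm⟩

theorem IsGroup.conj_eq_iff (h : IsGroup X m) (hg : g ∈ₘ X) (hx : x ∈ₘ X) (hy : y ∈ₘ X) :
    conj m g x = y ↔ mul m g x = mul m y g := by
  let := h.group
  have := mul_inv_eq_iff_eq_mul (a := (⟨g, hg⟩ : El X) * ⟨x, hx⟩) (b := ⟨g, hg⟩) (c := ⟨y, hy⟩)
  simpa only [Subtype.ext_iff, h.coe_conj, h.coe_mul] using this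

theorem IsGroup.conj_mul_left (h : IsGroup X m) (hx : x ∈ₘ X) (hy : y ∈ₘ X) (hz : z ∈ₘ X) :
    conj m (mul m x y) z = conj m x (conj m y z) := by
  let := h.group
  have : ∀ a b c : El X, (a * b) * c * (a * b)⁻¹ = a * (b * c * b⁻¹) * a⁻¹ := fun a b c => by group
  have := congrArg Subtype.val (this ⟨x, hx⟩ ⟨y, hy⟩ ⟨z, hz⟩)
  simpa only [h.coe_conj, h.coe_mul] using this

theorem IsGroup.conj_mul (h : IsGroup X m) (hg : g ∈ₘ X) (hx : x ∈ₘ X) (hy : y ∈ₘ X) :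
    conj m g (mul m x y) = mul m (conj m g x) (conj m g y) := by
  let := h.group
  have : ∀ a b c : El X, a * (b * c) * a⁻¹ = (a * b * a⁻¹) * (a * c * a⁻¹) :=
    fun a b c => by group
  have := congrArg Subtype.val (this ⟨g, hg⟩ ⟨x, hx⟩ ⟨y, hy⟩)
  simpa only [h.coe_conj, h.coe_mul] using this

theorem IsGroup.conj_conj (h : IsGroup X m) (hg : g ∈ₘ X) (hx : x ∈ₘ X) (hy : y ∈ₘ X) :
    conj m g (conj m x y) = conj m (conj m g x) (conj m g y) := by
  let := h.group
  have : ∀ a b c : El X, a * (b * c * b⁻¹) * a⁻¹ =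
      (a * b * a⁻¹) * (a * c * a⁻¹) * (a * b * a⁻¹)⁻¹ := fun a b c => by group
  have := congrArg Subtype.val (this ⟨g, hg⟩ ⟨x, hx⟩ ⟨y, hy⟩)
  simpa only [h.coe_conj] using this

theorem IsGroup.conj_one_left (h : IsGroup X m) (hx : x ∈ₘ X) : conj m (one m) x = x := by
  rw [h.conj_eq_iff h.one_mem hx hx, h.one_mul hx, h.mul_one hx]

theorem IsGroup.conj_inv_conj (h : IsGroup X m) (hg : g ∈ₘ X) (hx : x ∈ₘ X) : conj m (inv m g)
    (conj m g x) = x := by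
  rw [← h.conj_mul_left (h.inv_mem hg) hg hx, h.inv_mul hg, h.conj_one_left hx]

theorem IsGroup.conj_conj_inv (h : IsGroup X m) (hg : g ∈ₘ X) (hx : x ∈ₘ X) : conj m g
    (conj m (inv m g) x) = x := by
  rw [← h.conj_mul_left hg (h.inv_mem hg) hx, h.mul_inv hg, h.conj_one_left hx]

theorem IsGroup.eq_of_inv_mul_eq_one (h : IsGroup X m) (hx : x ∈ₘ X) (hy : y ∈ₘ X)
    (e : mul m (inv m x) y = one m) : x = y := by
  rw [← h.one_mul hy, ← h.mul_inv hx, h.mul_assoc hx (h.inv_mem hx) hy, e, h.mul_one hx]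

end

/-- `(X, m)` is a subgroup of `(Y, n)`. -/
structure SubGrp (X m Y n : M) : Prop where
  left : IsGroup X m
  right : IsGroup Y n
  incl : Incl X Y
  incl_op : Incl m n

namespace SubGrp

variable {X m Y n : M} {x y : M}

theorem mul_eq (h : SubGrp X m Y n) (hx : x ∈ₘ X) (hy : y ∈ₘ X) : mul n x y = mul m x y :=
  h.right.1.mul_eq ((h.left.1.mulRel_mul hx hy).mono h.incl_op)

theorem conj_eq (h : SubGrp X m Y n) (hx : x ∈ₘ X) (hy : y ∈ₘ X) : conj n x y = conj m x y := by
  rw [h.right.conj_eq_iff (h.incl _ hx) (h.incl _ hy) (h.incl _ (h.left.conj_mem hx hy)),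
    h.mul_eq hx hy, h.mul_eq (h.left.conj_mem hx hy) hx]
  exact (h.left.conj_eq_iff hx hy (h.left.conj_mem hx hy)).1 rfl

theorem one_eq (h : SubGrp X m Y n) : one n = one m := by
  refine (h.right.eq_one_of_mul_self (h.incl _ h.left.one_mem) ?_).symm
  rw [h.mul_eq h.left.one_mem h.left.one_mem, h.left.one_mul h.left.one_mem]

theorem trans (h : SubGrp X m Y n) {Z r : M} (h' : SubGrp Y n Z r) : SubGrp X m Z r :=
  ⟨h.left, h'.right, fun x hx => h'.incl x (h.incl x hx), fun x hx => h'.incl_op x (h.incl_op x hx)⟩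

end SubGrp

theorem IsGroup.subGrp_refl {X m : M} (h : IsGroup X m) : SubGrp X m X m :=
  ⟨h, h, fun _ hx => hx, fun _ hx => hx⟩

end Groups

/-! ### Isomorphisms, inner automorphisms and the automorphism group -/

section Automorphisms

variable {M : Type u} [EpsStructure M] [ZF M]

theorem IsGroup.isCenterlessGroup_iff {X m : M} (h : IsGroup X m) :
    IsCenterlessGroup X m ↔ ∀ c, c ∈ₘ X → (∀ x, x ∈ₘ X → conj m c x = x) → c = one m := by
  have key : ∀ c, c ∈ₘ X → ((∀ x z, x ∈ₘ X → (MulRel m c x z ↔ MulRel m x c z)) ↔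
      ∀ x, x ∈ₘ X → conj m c x = x) := fun c hc => by
    refine ⟨fun H x hx => ?_, fun H x z hx => ?_⟩
    · rw [h.conj_eq_iff hc hx hx]
      exact h.1.mul_eq ((H x _ hx).2 (h.1.mulRel_mul hx hc))
    · rw [h.1.mulRel_iff, h.1.mulRel_iff, (h.conj_eq_iff hc hx hx).1 (H x hx)]
      tauto
  refine ⟨fun H c hc hx => ?_, fun H => ⟨h, fun c hc hx => ?_⟩⟩
  · exact h.isIdentity_iff.1 (H.2 c hc ((key c hc).2 hx))
  · exact h.isIdentity_iff.2 (H c hc ((key c hc).1 hx))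

theorem isIso_iff {Φ X m Y n : M} (hX : IsBinOp X m) (hY : IsBinOp Y n) : IsIso Φ X m Y n ↔
    IsInjection Φ X Y ∧ IsSurjection Φ X Y ∧
      ∀ x y, x ∈ₘ X → y ∈ₘ X → app Φ (mul m x y) = mul n (app Φ x) (app Φ y) := by
  refine and_congr_right fun h1 => and_congr_right fun h2 => ⟨fun h x y hx hy => ?_, ?_⟩
  · refine (hY.mul_eq (h x y (mul m x y) _ _ _ ?_ ?_ ?_ (hX.mulRel_mul hx hy))).symm <;>
      exact appRel_iff.2 (h1.1.1.app_mem (by first | assumption | exact hX.mul_mem hx hy))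
  · intro h x y z x' y' z' hx hy hz hm
    rw [appRel_iff, h1.1.1.mem_iff] at hx hy hz
    obtain ⟨hx, rfl⟩ := hx
    obtain ⟨hy, rfl⟩ := hy
    obtain ⟨hz, rfl⟩ := hz
    rw [← hX.mul_eq hm, h x y hx hy]
    exact hY.mulRel_mul (h1.1.app_mem hx) (h1.1.app_mem hy)

namespace IsIso

variable {Φ X m Y n x y : M}

theorem isFun (h : IsIso Φ X m Y n) : IsFun Φ X Y := h.1.1

theorem app_mem (h : IsIso Φ X m Y n) (hx : x ∈ₘ X) : app Φ x ∈ₘ Y := h.1.1.app_mem hx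

theorem app_inj (h : IsIso Φ X m Y n) (hx : x ∈ₘ X) (hy : y ∈ₘ X) (e : app Φ x = app Φ y) : x = y :=
    h.1.app_inj hx hy e

theorem exists_app (h : IsIso Φ X m Y n) (hy : y ∈ₘ Y) : ∃ x, x ∈ₘ X ∧ app Φ x = y :=
    h.2.1.exists_app hy

theorem app_mul (h : IsIso Φ X m Y n) (hX : IsBinOp X m) (hY : IsBinOp Y n) (hx : x ∈ₘ X)
    (hy : y ∈ₘ X) :
    app Φ (mul m x y) = mul n (app Φ x) (app Φ y) :=
  ((isIso_iff hX hY).1 h).2.2 x y hx hy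

theorem app_conj (h : IsIso Φ X m Y n) (hX : IsGroup X m) (hY : IsGroup Y n) (hx : x ∈ₘ X)
    (hy : y ∈ₘ X) :
    app Φ (conj m x y) = conj n (app Φ x) (app Φ y) := by
  have hc := hX.conj_mem hx hy
  rw [eq_comm, hY.conj_eq_iff (h.app_mem hx) (h.app_mem hy) (h.app_mem hc),
    ← h.app_mul hX.1 hY.1 hx hy, ← h.app_mul hX.1 hY.1 hc hx,
    (hX.conj_eq_iff hx hy hc).1 rfl]

end IsIso

theorem isIso_lam {X m Y n : M} {F : M → M} [DFn (fun v : ℕ → M => F (v 0))] (hX : IsBinOp X m)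
    (hY : IsBinOp Y n) (hF : ∀ x, x ∈ₘ X → F x ∈ₘ Y)
    (hi : ∀ x y, x ∈ₘ X → y ∈ₘ X → F x = F y → x = y) (hs : ∀ y, y ∈ₘ Y → ∃ x, x ∈ₘ X ∧ y = F x)
    (hm : ∀ x y, x ∈ₘ X → y ∈ₘ X → F (mul m x y) = mul n (F x) (F y)) :
    IsIso (lam X F) X m Y n := by
  refine (isIso_iff hX hY).2 ⟨isInjection_lam hF hi, isSurjection_lam hF hs, fun x y hx hy => ?_⟩
  rw [app_lam hx, app_lam hy, app_lam (hX.mul_mem hx hy), hm x y hx hy]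

/-- The inverse of the bijection `f : X → Y`. -/
noncomputable def finv (f X Y : M) : M := lam Y fun y => iota fun x => x ∈ₘ X ∧ app f x = y

theorem IsIso.app_finv_app {Φ X m Y n x : M} (h : IsIso Φ X m Y n) (hx : x ∈ₘ X) :
    app (finv Φ X Y) (app Φ x) = x := by
  rw [finv, app_lam (h.app_mem hx)]
  exact iota_eq ⟨hx, rfl⟩ fun y hy => h.app_inj hy.1 hx hy.2

theorem IsIso.symm {Φ X m Y n : M} (h : IsIso Φ X m Y n) (hX : IsBinOp X m) (hY : IsBinOp Y n) :
    IsIso (finv Φ X Y) Y n X m := by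
  have key : ∀ y, y ∈ₘ Y → (iota fun x => x ∈ₘ X ∧ app Φ x = y) ∈ₘ X ∧
      app Φ (iota fun x => x ∈ₘ X ∧ app Φ x = y) = y := fun y hy => by
    obtain ⟨x, hx, e⟩ := h.exists_app hy
    exact iota_spec (P := fun x => x ∈ₘ X ∧ app Φ x = y)
      ⟨x, ⟨hx, e⟩, fun z hz => h.app_inj hz.1 hx (hz.2.trans e.symm)⟩
  refine isIso_lam hY hX (fun y hy => (key y hy).1) (fun x y hx hy e => ?_) (fun x hx => ?_) ?_
  · rw [← (key x hx).2, e, (key y hy).2]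
  · refine ⟨app Φ x, h.app_mem hx, ?_⟩
    exact h.app_inj hx (key _ (h.app_mem hx)).1 (key _ (h.app_mem hx)).2.symm
  · intro x y hx hy
    refine h.app_inj (key _ (hY.mul_mem hx hy)).1 (hX.mul_mem (key x hx).1 (key y hy).1) ?_
    rw [(key _ (hY.mul_mem hx hy)).2, h.app_mul hX hY (key x hx).1 (key y hy).1, (key x hx).2,
      (key y hy).2]

/-- The composition `x ↦ σ(τ(x))` on `X`. -/
noncomputable def comp (X σ τ : M) : M := lam X fun x => app σ (app τ x)

instance {a b c : (ℕ → M) → M} [DFn a] [DFn b] [DFn c] : DFn (fun v => comp (a v) (b v) (c v)) :=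
  DFn.app3 (by unfold comp; infer_instance)

theorem IsIso.comp {X m Y n Z r σ τ : M} (hσ : IsIso σ Y n Z r) (hτ : IsIso τ X m Y n)
    (hX : IsBinOp X m) (hY : IsBinOp Y n) (hZ : IsBinOp Z r) : IsIso (comp X σ τ) X m Z r := by
  refine isIso_lam hX hZ (fun x hx => hσ.app_mem (hτ.app_mem hx)) (fun x y hx hy e => ?_)
    (fun z hz => ?_) fun x y hx hy => ?_
  · exact hτ.app_inj hx hy (hσ.app_inj (hτ.app_mem hx) (hτ.app_mem hy) e)
  · obtain ⟨y, hy, rfl⟩ := hσ.exists_app hz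
    obtain ⟨x, hx, rfl⟩ := hτ.exists_app hy
    exact ⟨x, hx, rfl⟩
  · rw [hτ.app_mul hX hY hx hy, hσ.app_mul hY hZ (hτ.app_mem hx) (hτ.app_mem hy)]

/-- The inner automorphism `g ↦ x g x⁻¹`. -/
noncomputable def inn (X m x : M) : M := lam X fun g => conj m x g

instance {a b c : (ℕ → M) → M} [DFn a] [DFn b] [DFn c] : DFn (fun v => inn (a v) (b v) (c v)) :=
  DFn.app3 (by unfold inn; infer_instance)

theorem IsGroup.isAut_inn {X m x : M} (h : IsGroup X m) (hx : x ∈ₘ X) : IsAut (inn X m x) X m := by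
  refine isIso_lam h.1 h.1 (fun g hg => h.conj_mem hx hg) (fun g g' hg hg' e => ?_)
    (fun g hg => ?_) fun g g' hg hg' => h.conj_mul hx hg hg'
  · rw [← h.conj_inv_conj hx hg, e, h.conj_inv_conj hx hg']
  · exact ⟨conj m (inv m x) g, h.conj_mem (h.inv_mem hx) hg, (h.conj_conj_inv hx hg).symm⟩

theorem IsGroup.isInnerBy_iff {X m x σ : M} (h : IsGroup X m) (hx : x ∈ₘ X) :
    IsInnerBy σ x X m ↔ σ = inn X m x := by
  constructor
  · rintro ⟨hσ, H⟩
    rw [hσ.isFun.1.eq_lam]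
    refine lam_congr fun g hg => ?_
    obtain ⟨w, h1, h2⟩ := H g (app σ g) (appRel_iff.2 (hσ.isFun.1.app_mem hg))
    rw [eq_comm, h.conj_eq_iff hx hg (hσ.app_mem hg), h.1.mul_eq h1, h.1.mul_eq h2]
  · rintro rfl
    refine ⟨h.isAut_inn hx, fun g g' hg => ?_⟩
    rw [appRel_iff, inn, opair_mem_lam] at hg
    obtain ⟨hg, rfl⟩ := hg
    refine ⟨mul m x g, h.1.mulRel_mul hx hg, ?_⟩
    rw [(h.conj_eq_iff hx hg (h.conj_mem hx hg)).1 rfl]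
    exact h.1.mulRel_mul (h.conj_mem hx hg) hx

/-! ### The group of automorphisms -/

/-- The set of automorphisms. -/
noncomputable def autSet (X m : M) : M := sep (pow (prod X X)) fun σ => IsAut σ X m

instance {a b : (ℕ → M) → M} [DFn a] [DFn b] : DFn (fun v => autSet (a v) (b v)) :=
  DFn.app2 (by unfold autSet; infer_instance)

@[simp] theorem mem_autSet {X m σ : M} : σ ∈ₘ autSet X m ↔ IsAut σ X m := by
  rw [autSet, mem_sep, mem_pow, and_iff_right_iff_imp]
  exact fun h => h.isFun.incl_prod

/-- The composition of automorphisms, as an operation. -/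
noncomputable def autOp (X m : M) : M :=
  lam (prod (autSet X m) (autSet X m)) fun p => comp X (fst p) (snd p)

theorem mulRel_autOp {X m σ τ ρ : M} :
    MulRel (autOp X m) σ τ ρ ↔ IsAut σ X m ∧ IsAut τ X m ∧ ρ = comp X σ τ := by
  rw [mulRel_iff, autOp, opair_mem_lam]
  simp [and_assoc]

theorem IsGroup.isAutGroup {X m : M} (h : IsGroup X m) :
    IsAutGroup (autSet X m) (autOp X m) X m := by
  refine ⟨fun σ => mem_autSet, ⟨fun t ht => ?_, fun σ τ hσ hτ => ⟨comp X σ τ, ?_, ?_⟩⟩, ?_⟩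
  · obtain ⟨p, hp, rfl⟩ := mem_lam.1 ht
    obtain ⟨σ, τ, hσ, hτ, rfl⟩ := mem_prod.1 hp
    refine ⟨σ, τ, comp X σ τ, opair σ τ, hσ, hτ, ?_, isOPair_iff.2 rfl, isOPair_iff.2 (by simp)⟩
    rw [mem_autSet] at *
    exact IsIso.comp hσ hτ h.1 h.1 h.1
  · rw [mem_autSet] at hσ hτ
    exact mulRel_autOp.2 ⟨hσ, hτ, rfl⟩
  · exact fun ρ hρ => (mulRel_autOp.1 hρ).2.2
  · intro σ τ ρ hρ x y z hx hy
    obtain ⟨hσ, hτ, rfl⟩ := mulRel_autOp.1 hρ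
    rw [appRel_iff, hτ.isFun.1.mem_iff] at hx
    obtain ⟨hx, rfl⟩ := hx
    rw [appRel_iff, hσ.isFun.1.mem_iff] at hy
    obtain ⟨hy, rfl⟩ := hy
    rw [appRel_iff, comp, opair_mem_lam]
    exact ⟨hx, rfl⟩

/-- What an extension of `(X, m)` to its automorphism group amounts to. -/
structure AutExt (X m Y n : M) : Prop extends SubGrp X m Y n where
  conj_mem : ∀ {g x}, g ∈ₘ Y → x ∈ₘ X → conj n g x ∈ₘ X
  conj_ext : ∀ {g h}, g ∈ₘ Y → h ∈ₘ Y → (∀ x, x ∈ₘ X → conj n g x = conj n h x) → g = h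
  exists_conj : ∀ {σ}, IsAut σ X m → ∃ g, g ∈ₘ Y ∧ ∀ x, x ∈ₘ X → conj n g x = app σ x

/-- Conjugation by `g ∈ Y` acts on `X` as the automorphism `Φ(g)`. The three clauses then say that
`Φ` takes values in automorphisms of `X`, is injective, and is onto. The later arguments use only
conjugation and never `Φ` itself. -/
theorem IsAutExtension.autExt {X m Y n : M} (hX : IsGroup X m) (h : IsAutExtension X m Y n) :
    AutExt X m Y n := by
  obtain ⟨hY, hXY, hmn, A, c, Φ, ⟨hA, hc, hcomp⟩, hΦ, hinn⟩ := h
  have haut : ∀ g, g ∈ₘ Y → IsAut (app Φ g) X m := fun g hg => (hA _).1 (hΦ.app_mem hg)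
  have hin : ∀ x z, x ∈ₘ X → z ∈ₘ X → app (app Φ x) z = conj m x z := fun x z hx hz => by
    rw [(hX.isInnerBy_iff hx).1
      (hinn x (app Φ x) hx (appRel_iff.2 (hΦ.isFun.1.app_mem (hXY _ hx)))), inn, app_lam hz]
  have hmul : ∀ g g' z, g ∈ₘ Y → g' ∈ₘ Y → z ∈ₘ X →
      app (app Φ (mul n g g')) z = app (app Φ g) (app (app Φ g') z) := fun g g' z hg hg' hz => by
    rw [hΦ.app_mul hY.1 hc hg hg']
    have h1 := hc.mulRel_mul (hΦ.app_mem hg) (hΦ.app_mem hg')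
    have h2 := hcomp _ _ _ h1 z _ _ (appRel_iff.2 ((haut g' hg').isFun.1.app_mem hz))
      (appRel_iff.2 ((haut g hg).isFun.1.app_mem ((haut g' hg').app_mem hz)))
    have h3 := haut _ (hY.mul_mem hg hg')
    rw [hΦ.app_mul hY.1 hc hg hg'] at h3
    exact h3.isFun.1.app_eq (appRel_iff.1 h2)
  have hext : ∀ g g', g ∈ₘ Y → g' ∈ₘ Y →
      (∀ z, z ∈ₘ X → app (app Φ g) z = app (app Φ g') z) → g = g' := fun g g' hg hg' e =>
    hΦ.app_inj hg hg' ((haut g hg).isFun.1.ext (haut g' hg').isFun.1 e)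
  -- With `σ = Φ(g)`, the identity `σ ∘ inn(x) = inn(σ(x)) ∘ σ` says that `g x` and `σ(x) g` have
  -- the same image under the injective `Φ`.
  have key : ∀ g x, g ∈ₘ Y → x ∈ₘ X → conj n g x = app (app Φ g) x := fun g x hg hx => by
    have hy := (haut g hg).app_mem hx
    rw [hY.conj_eq_iff hg (hXY _ hx) (hXY _ hy)]
    refine hext _ _ (hY.mul_mem hg (hXY _ hx)) (hY.mul_mem (hXY _ hy) hg) fun z hz => ?_
    rw [hmul g x z hg (hXY _ hx) hz, hmul _ g z (hXY _ hy) hg hz, hin x z hx hz,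
      hin _ _ hy ((haut g hg).app_mem hz), (haut g hg).app_conj hX hX hx hz]
  refine ⟨⟨hX, hY, hXY, hmn⟩, fun hg hx => ?_, fun hg hh e => ?_, fun {σ} hσ => ?_⟩
  · rw [key _ _ hg hx]
    exact (haut _ hg).app_mem hx
  · refine hext _ _ hg hh fun z hz => ?_
    rw [← key _ _ hg hz, ← key _ _ hh hz, e z hz]
  · obtain ⟨g, hg, rfl⟩ := hΦ.exists_app ((hA σ).2 hσ)
    exact ⟨g, hg, fun x hx => key g x hg hx⟩

end Automorphisms

/-! ### A concrete automorphism group containing the given centerless group -/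

section AutomorphismExtension

variable {M : Type u} [EpsStructure M] [ZF M]

/-- The elements of the automorphism group of `(X, m)`, with the elements of `X` in place of the
inner automorphisms, and pairs `(X, σ)` in place of the others. -/
noncomputable def extSet (X m : M) : M :=
  cup X (img (sep (autSet X m) fun σ => ∀ x, x ∈ₘ X → σ ≠ inn X m x) fun σ => opair X σ)

/-- The automorphism of `(X, m)` that the element `y` of `extSet X m` stands for. -/
noncomputable def act (X m y : M) : M := ifte (y ∈ₘ X) (inn X m y) (snd y)

/-- The operation of the automorphism group on `extSet X m`. -/
noncomputable def extOp (X m : M) : M :=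
  sep (prod (prod (extSet X m) (extSet X m)) (extSet X m)) fun t => ∃ a b c,
    t = opair (opair a b) c ∧ comp X (act X m a) (act X m b) = act X m c

instance {a b : (ℕ → M) → M} [DFn a] [DFn b] : DFn (fun v => extSet (a v) (b v)) :=
  DFn.app2 (by unfold extSet; infer_instance)

instance {a b c : (ℕ → M) → M} [DFn a] [DFn b] [DFn c] : DFn (fun v => act (a v) (b v) (c v)) :=
  DFn.app3 (by unfold act; infer_instance)

instance {a b : (ℕ → M) → M} [DFn a] [DFn b] : DFn (fun v => extOp (a v) (b v)) :=
  DFn.app2 (by unfold extOp; infer_instance)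

theorem mem_extSet {X m y : M} : y ∈ₘ extSet X m ↔ y ∈ₘ X ∨
    ∃ σ, IsAut σ X m ∧ (∀ x, x ∈ₘ X → σ ≠ inn X m x) ∧ y = opair X σ := by
  simp [extSet, and_assoc]

theorem act_of_mem {X m x : M} (hx : x ∈ₘ X) : act X m x = inn X m x := ifte_pos hx _ _

theorem act_opair (X m σ : M) : act X m (opair X σ) = σ := by
  rw [act, ifte_neg (opair_not_mem_left X σ), snd_opair]

theorem mulRel_extOp {X m a b c : M} : MulRel (extOp X m) a b c ↔ a ∈ₘ extSet X m ∧
    b ∈ₘ extSet X m ∧ c ∈ₘ extSet X m ∧ comp X (act X m a) (act X m b) = act X m c := by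
  rw [mulRel_iff, extOp, mem_sep, opair_mem_prod, opair_mem_prod, and_assoc, and_assoc]
  refine and_congr_right fun _ => and_congr_right fun _ => and_congr_right fun _ => ⟨?_, ?_⟩
  · rintro ⟨a', b', c', e, h⟩
    obtain ⟨⟨rfl, rfl⟩, rfl⟩ := by simpa using e
    exact h
  · exact fun h => ⟨a, b, c, rfl, h⟩

theorem comp_assoc {X ρ σ τ : M} (hτ : IsFun τ X X) :
    comp X (comp X ρ σ) τ = comp X ρ (comp X σ τ) := by
  refine lam_congr fun x hx => ?_
  rw [comp, comp, app_lam hx, app_lam (hτ.app_mem hx)]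

variable {X m : M}

theorem IsCenterlessGroup.eq_of_conj (h : IsCenterlessGroup X m) {x y : M} (hx : x ∈ₘ X)
    (hy : y ∈ₘ X)
    (e : ∀ z, z ∈ₘ X → conj m x z = conj m y z) : x = y := by
  have hX := h.1
  refine hX.eq_of_inv_mul_eq_one hx hy (hX.isCenterlessGroup_iff.1 h _
    (hX.mul_mem (hX.inv_mem hx) hy) fun z hz => ?_)
  rw [hX.conj_mul_left (hX.inv_mem hx) hy hz, ← e z hz, hX.conj_inv_conj hx hz]

theorem IsCenterlessGroup.inn_inj (h : IsCenterlessGroup X m) {x y : M} (hx : x ∈ₘ X) (hy : y ∈ₘ X)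
    (e : inn X m x = inn X m y) : x = y := by
  refine h.eq_of_conj hx hy fun z hz => ?_
  have := congrArg (fun f => app f z) e
  simpa only [inn, app_lam hz] using this

theorem IsCenterlessGroup.isAut_act (h : IsCenterlessGroup X m) {y : M} (hy : y ∈ₘ extSet X m) :
    IsAut (act X m y) X m := by
  rcases mem_extSet.1 hy with hy | ⟨σ, hσ, -, rfl⟩
  · rw [act_of_mem hy]
    exact h.1.isAut_inn hy
  · rwa [act_opair]

theorem IsCenterlessGroup.act_inj (h : IsCenterlessGroup X m) {x y : M} (hx : x ∈ₘ extSet X m)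
    (hy : y ∈ₘ extSet X m)
    (e : act X m x = act X m y) : x = y := by
  rcases mem_extSet.1 hx with hx | ⟨σ, hσ, hn, rfl⟩ <;>
    rcases mem_extSet.1 hy with hy | ⟨τ, hτ, hn', rfl⟩
  · rw [act_of_mem hx, act_of_mem hy] at e
    exact h.inn_inj hx hy e
  · rw [act_of_mem hx, act_opair] at e
    exact absurd e.symm (hn' x hx)
  · rw [act_of_mem hy, act_opair] at e
    exact absurd e (hn y hy)
  · rw [act_opair, act_opair] at e
    rw [e]

theorem exists_act {σ : M} (hσ : IsAut σ X m) :
    ∃ y, y ∈ₘ extSet X m ∧ act X m y = σ := by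
  by_cases hn : ∀ x, x ∈ₘ X → σ ≠ inn X m x
  · exact ⟨opair X σ, mem_extSet.2 (Or.inr ⟨σ, hσ, hn, rfl⟩), act_opair X m σ⟩
  · push Not at hn
    obtain ⟨x, hx, rfl⟩ := hn
    exact ⟨x, mem_extSet.2 (Or.inl hx), act_of_mem hx⟩

theorem IsCenterlessGroup.isBinOp_extOp (h : IsCenterlessGroup X m) : IsBinOp (extSet X m)
    (extOp X m) := by
  refine ⟨fun t ht => ?_, fun a b ha hb => ?_⟩
  · obtain ⟨ht, a, b, c, rfl, -⟩ := mem_sep.1 ht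
    simp only [opair_mem_prod] at ht
    exact ⟨a, b, c, opair a b, ht.1.1, ht.1.2, ht.2, isOPair_iff.2 rfl, isOPair_iff.2 rfl⟩
  · obtain ⟨c, hc, e⟩ := exists_act
      (IsIso.comp (h.isAut_act ha) (h.isAut_act hb) h.1.1 h.1.1 h.1.1)
    refine ⟨c, mulRel_extOp.2 ⟨ha, hb, hc, e.symm⟩, fun d hd => ?_⟩
    obtain ⟨-, -, hd, e'⟩ := mulRel_extOp.1 hd
    exact h.act_inj hd hc (e'.symm.trans e.symm)

theorem IsCenterlessGroup.comp_inn (h : IsCenterlessGroup X m) {x : M} {σ : M} (hσ : IsAut σ X m)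
    (hx : x = one m) :
    comp X σ (inn X m x) = σ ∧ comp X (inn X m x) σ = σ := by
  subst hx
  constructor <;> conv_rhs => rw [hσ.isFun.1.eq_lam]
  · refine lam_congr fun z hz => ?_
    rw [inn, app_lam hz, h.1.conj_one_left hz]
  · refine lam_congr fun z hz => ?_
    rw [inn, app_lam (hσ.app_mem hz), h.1.conj_one_left (hσ.app_mem hz)]

/-- The group structure is pulled back along `act`, a bijection from `extSet X m` to the
automorphisms. Its injectivity on `X` is where the trivial center enters. -/
theorem IsCenterlessGroup.isGroup_ext (h : IsCenterlessGroup X m) : IsGroup (extSet X m)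
    (extOp X m) := by
  have h1 : one m ∈ₘ extSet X m := mem_extSet.2 (Or.inl h.1.one_mem)
  refine ⟨h.isBinOp_extOp, fun x y z u v w hu hv hw => ?_, one m, ⟨h1, fun x hx => ?_⟩,
    fun x hx => ?_⟩
  · obtain ⟨hx, hy, hu, e1⟩ := mulRel_extOp.1 hu
    obtain ⟨-, hz, hv, e2⟩ := mulRel_extOp.1 hv
    obtain ⟨-, -, hw, e3⟩ := mulRel_extOp.1 hw
    refine mulRel_extOp.2 ⟨hx, hv, hw, ?_⟩
    rw [← e3, ← e1, ← e2, comp_assoc (h.isAut_act hz).isFun]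
  · have := h.comp_inn (h.isAut_act hx) rfl
    rw [mulRel_extOp, mulRel_extOp, act_of_mem h.1.one_mem]
    exact ⟨⟨h1, hx, hx, this.2⟩, ⟨hx, h1, hx, this.1⟩⟩
  · have hx' := h.isAut_act hx
    have hs : IsAut (finv (act X m x) X X) X m := IsIso.symm hx' h.1.1 h.1.1
    obtain ⟨y, hy, e⟩ := exists_act hs
    refine ⟨y, hy, ?_, ?_⟩ <;> rw [mulRel_extOp, e, act_of_mem h.1.one_mem]
    · refine ⟨hx, hy, h1, lam_congr fun z hz => ?_⟩
      rw [h.1.conj_one_left hz]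
      obtain ⟨w, hw, rfl⟩ := hx'.exists_app hz
      rw [hx'.app_finv_app hw]
    · refine ⟨hy, hx, h1, lam_congr fun z hz => ?_⟩
      rw [h.1.conj_one_left hz, hx'.app_finv_app hz]

theorem IsCenterlessGroup.isAutExtension (h : IsCenterlessGroup X m) : IsAutExtension X m
    (extSet X m) (extOp X m) := by
  refine ⟨h.isGroup_ext, fun x hx => mem_extSet.2 (Or.inl hx), fun t ht => ?_,
    autSet X m, autOp X m, lam (extSet X m) (act X m), h.1.isAutGroup, ?_, fun x σ hx hσ => ?_⟩
  · obtain ⟨x, y, z, q, hx, hy, hz, hq, hqt⟩ := h.1.1.1 t ht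
    obtain rfl := isOPair_iff.1 hq
    obtain rfl := isOPair_iff.1 hqt
    rw [← h.1.1.mul_eq (mulRel_iff.2 ht)]
    refine mulRel_iff.1 (mulRel_extOp.2 ⟨mem_extSet.2 (Or.inl hx), mem_extSet.2 (Or.inl hy),
      mem_extSet.2 (Or.inl (h.1.mul_mem hx hy)), ?_⟩)
    rw [act_of_mem hx, act_of_mem hy, act_of_mem (h.1.mul_mem hx hy)]
    refine lam_congr fun w hw => ?_
    rw [inn, inn, app_lam hw, app_lam (h.1.conj_mem hy hw), h.1.conj_mul_left hx hy hw]
  · have hb := h.1.isAutGroup.2.1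
    refine isIso_lam h.isBinOp_extOp hb (fun y hy => mem_autSet.2 (h.isAut_act hy))
      (fun x y hx hy e => h.act_inj hx hy e) (fun σ hσ => ?_) fun x y hx hy => ?_
    · obtain ⟨y, hy, e⟩ := exists_act (mem_autSet.1 hσ)
      exact ⟨y, hy, e.symm⟩
    · have := h.isBinOp_extOp.mulRel_mul hx hy
      rw [← (mulRel_extOp.1 this).2.2.2]
      exact (hb.mul_eq (mulRel_autOp.2 ⟨h.isAut_act hx, h.isAut_act hy, rfl⟩)).symm
  · rw [appRel_iff, opair_mem_lam, act_of_mem hx] at hσ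
    exact (h.1.isInnerBy_iff hx).2 hσ.2

end AutomorphismExtension

/-! ### Structure of the tower: levels as subgroups, trivial centralizer of the base -/

section Tower

variable {M : Type u} [EpsStructure M] [ZF M]

/-- The underlying set of the group `T(β)`. -/
noncomputable def tc (T β : M) : M := fst (app T β)

/-- The operation of the group `T(β)`. -/
noncomputable def tm (T β : M) : M := snd (app T β)

instance {a b : (ℕ → M) → M} [DFn a] [DFn b] : DFn (fun v => tc (a v) (b v)) := by
  unfold tc; infer_instance

instance {a b : (ℕ → M) → M} [DFn a] [DFn b] : DFn (fun v => tm (a v) (b v)) := by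
  unfold tm; infer_instance

theorem towerAt_iff {T β Y n : M} : TowerAt T β Y n ↔ opair β (opair Y n) ∈ₘ T := by
  simp [TowerAt, isOPair_iff]

/-- The clauses of the definition of the automorphism tower, in terms of `tc` and `tm`. -/
structure Tower (T l X m : M) : Prop where
  ord : IsOrd l
  isFunOn : IsFunOn T l
  app_eq : ∀ {β}, β ∈ₘ l → app T β = opair (tc T β) (tm T β)
  tc_emp : emp ∈ₘ l → tc T emp = X
  tm_emp : emp ∈ₘ l → tm T emp = m
  isAutExtension : ∀ {β}, succ β ∈ₘ l →
    IsAutExtension (tc T β) (tm T β) (tc T (succ β)) (tm T (succ β))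
  mem_tc_limit : ∀ {δ y}, δ ∈ₘ l → IsLimit δ → (y ∈ₘ tc T δ ↔ ∃ β, β ∈ₘ δ ∧ y ∈ₘ tc T β)
  mem_tm_limit : ∀ {δ t}, δ ∈ₘ l → IsLimit δ → (t ∈ₘ tm T δ ↔ ∃ β, β ∈ₘ δ ∧ t ∈ₘ tm T β)

theorem Tower.towerAt_iff {T l X m β Y n : M} (h : Tower T l X m) (hβ : β ∈ₘ l) :
    TowerAt T β Y n ↔ Y = tc T β ∧ n = tm T β := by
  rw [ZFModel.towerAt_iff, h.isFunOn.mem_iff, h.app_eq hβ, opair_inj, and_iff_right hβ]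

theorem IsAutTower.tower {T l X m : M} (h : IsAutTower T l X m) : Tower T l X m := by
  obtain ⟨hl, hT, hp, h0, hs, hlim⟩ := h
  have hp' : ∀ {β}, β ∈ₘ l → app T β = opair (tc T β) (tm T β) := fun {β} hβ => by
    obtain ⟨Y, n, h⟩ := hp β hβ
    have := hT.app_eq (ZFModel.towerAt_iff.1 h)
    rw [tc, tm, this, fst_opair, snd_opair]
  have hat : ∀ {β}, β ∈ₘ l → ∀ {Y n}, TowerAt T β Y n ↔ Y = tc T β ∧ n = tm T β :=
    fun {β} hβ Y n => by
      rw [ZFModel.towerAt_iff, hT.mem_iff, hp' hβ, opair_inj, and_iff_right hβ]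
  refine ⟨hl, hT, hp', fun h => ?_, fun h => ?_, fun {β} h => ?_, fun {δ y} h hδ => ?_,
    fun {δ t} h hδ => ?_⟩
  · exact ((hat h).1 (h0 emp h not_mem_emp)).1.symm
  · exact ((hat h).1 (h0 emp h not_mem_emp)).2.symm
  · exact hs β _ _ _ _ _ h (isSucc_iff.2 rfl) ((hat (hl.trans (self_mem_succ β) h)).2 ⟨rfl, rfl⟩)
      ((hat h).2 ⟨rfl, rfl⟩)
  · rw [(hlim δ _ _ h hδ ((hat h).2 ⟨rfl, rfl⟩)).1 y]
    constructor
    · rintro ⟨β, Z, r, hβ, hZ, hy⟩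
      rw [((hat (hl.trans hβ h)).1 hZ).1] at hy
      exact ⟨β, hβ, hy⟩
    · rintro ⟨β, hβ, hy⟩
      exact ⟨β, _, _, hβ, (hat (hl.trans hβ h)).2 ⟨rfl, rfl⟩, hy⟩
  · rw [(hlim δ _ _ h hδ ((hat h).2 ⟨rfl, rfl⟩)).2 t]
    constructor
    · rintro ⟨β, Z, r, hβ, hZ, hy⟩
      rw [((hat (hl.trans hβ h)).1 hZ).2] at hy
      exact ⟨β, hβ, hy⟩
    · rintro ⟨β, hβ, hy⟩
      exact ⟨β, _, _, hβ, (hat (hl.trans hβ h)).2 ⟨rfl, rfl⟩, hy⟩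

theorem Tower.isAutTower {T l X m : M} (h : Tower T l X m) : IsAutTower T l X m := by
  refine ⟨h.ord, h.isFunOn, fun β hβ => ⟨_, _, (h.towerAt_iff hβ).2 ⟨rfl, rfl⟩⟩,
    fun β hβ h0 => ?_, fun β γ Y n Z r hγ hs hY hZ => ?_, fun δ Y n hδ hlim hY => ?_⟩
  · obtain rfl := isEmptySet_iff.1 h0
    exact (h.towerAt_iff hβ).2 ⟨(h.tc_emp hβ).symm, (h.tm_emp hβ).symm⟩
  · obtain rfl := isSucc_iff.1 hs
    obtain ⟨rfl, rfl⟩ := (h.towerAt_iff (h.ord.trans (self_mem_succ β) hγ)).1 hY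
    obtain ⟨rfl, rfl⟩ := (h.towerAt_iff hγ).1 hZ
    exact h.isAutExtension hγ
  · obtain ⟨rfl, rfl⟩ := (h.towerAt_iff hδ).1 hY
    constructor
    · intro y
      rw [h.mem_tc_limit hδ hlim]
      constructor
      · rintro ⟨β, hβ, hy⟩
        exact ⟨β, _, _, hβ, (h.towerAt_iff (h.ord.trans hβ hδ)).2 ⟨rfl, rfl⟩, hy⟩
      · rintro ⟨β, Z, r, hβ, hZ, hy⟩
        rw [((h.towerAt_iff (h.ord.trans hβ hδ)).1 hZ).1] at hy
        exact ⟨β, hβ, hy⟩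
    · intro y
      rw [h.mem_tm_limit hδ hlim]
      constructor
      · rintro ⟨β, hβ, hy⟩
        exact ⟨β, _, _, hβ, (h.towerAt_iff (h.ord.trans hβ hδ)).2 ⟨rfl, rfl⟩, hy⟩
      · rintro ⟨β, Z, r, hβ, hZ, hy⟩
        rw [((h.towerAt_iff (h.ord.trans hβ hδ)).1 hZ).2] at hy
        exact ⟨β, hβ, hy⟩

theorem subGrp_iff {X m Y n : M} :
    SubGrp X m Y n ↔ IsGroup X m ∧ IsGroup Y n ∧ Incl X Y ∧ Incl m n :=
  ⟨fun h => ⟨h.1, h.2, h.3, h.4⟩, fun h => ⟨h.1, h.2.1, h.2.2.1, h.2.2.2⟩⟩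

instance {a b c d : (ℕ → M) → M} [DFn a] [DFn b] [DFn c] [DFn d] :
    Dfn (fun v => SubGrp (a v) (b v) (c v) (d v)) :=
  Dfn.app4 (by simp only [subGrp_iff]; infer_instance)

/-- The union of a chain of groups is a group. -/
theorem isGroup_union {δ Y n : M} {G R : M → M} (hδ : IsLimit δ)
    (hY : ∀ y, y ∈ₘ Y ↔ ∃ β, β ∈ₘ δ ∧ y ∈ₘ G β) (hn : ∀ t, t ∈ₘ n ↔ ∃ β, β ∈ₘ δ ∧ t ∈ₘ R β)
    (H : ∀ γ, γ ∈ₘ δ → ∀ β, β ∈ₘ succ γ → SubGrp (G β) (R β) (G γ) (R γ)) : IsGroup Y n := by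
  have hord := (isLimit_iff.1 hδ).1
  have hrefl : ∀ {γ}, γ ∈ₘ δ → IsGroup (G γ) (R γ) := fun hγ => (H _ hγ _ (self_mem_succ _)).left
  -- The chain is directed because ordinals are comparable; `succ ε` expresses `≤ ε`.
  have max : ∀ {β γ}, β ∈ₘ δ → γ ∈ₘ δ → ∃ ε, ε ∈ₘ δ ∧ β ∈ₘ succ ε ∧ γ ∈ₘ succ ε :=
    fun {β γ} hβ hγ => by
      rcases (hord.mem hβ).trichotomy (hord.mem hγ) with h | rfl | h
      · exact ⟨γ, hγ, mem_succ.2 (Or.inl h), self_mem_succ γ⟩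
      · exact ⟨β, hβ, self_mem_succ β, self_mem_succ β⟩
      · exact ⟨β, hβ, self_mem_succ β, mem_succ.2 (Or.inl h)⟩
  have hrel : ∀ {x y z}, MulRel n x y z ↔ ∃ β, β ∈ₘ δ ∧ MulRel (R β) x y z := fun {x y z} => by
    simp only [mulRel_iff, hn]
  -- A product in the union can be computed at any level that contains both factors, which reduces
  -- every group law to a single level.
  have hmul : ∀ {β x y z}, β ∈ₘ δ → x ∈ₘ G β → y ∈ₘ G β →
      (MulRel n x y z ↔ z = mul (R β) x y) := fun {β x y z} hβ hx hy => by
    rw [hrel]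
    constructor
    · rintro ⟨γ, hγ, h⟩
      obtain ⟨ε, hε, h1, h2⟩ := max hβ hγ
      rw [← (H ε hε β h1).mul_eq hx hy]
      exact ((hrefl hε).1.mul_eq (h.mono (H ε hε γ h2).incl_op)).symm
    · rintro rfl
      exact ⟨β, hβ, (hrefl hβ).1.mulRel_mul hx hy⟩
  have two : ∀ {x y}, x ∈ₘ Y → y ∈ₘ Y → ∃ β, β ∈ₘ δ ∧ x ∈ₘ G β ∧ y ∈ₘ G β := fun {x y} hx hy => by
    obtain ⟨β, hβ, hx⟩ := (hY x).1 hx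
    obtain ⟨γ, hγ, hy⟩ := (hY y).1 hy
    obtain ⟨ε, hε, h1, h2⟩ := max hβ hγ
    exact ⟨ε, hε, (H ε hε β h1).incl _ hx, (H ε hε γ h2).incl _ hy⟩
  have hdom : ∀ {x y z}, MulRel n x y z → x ∈ₘ Y ∧ y ∈ₘ Y ∧ z ∈ₘ Y := fun {x y z} h => by
    obtain ⟨β, hβ, h⟩ := hrel.1 h
    obtain ⟨hx, hy, hz⟩ := (hrefl hβ).1.mulRel_mem h
    exact ⟨(hY x).2 ⟨β, hβ, hx⟩, (hY y).2 ⟨β, hβ, hy⟩, (hY z).2 ⟨β, hβ, hz⟩⟩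
  have h0 : emp ∈ₘ δ := hord.emp_mem (isLimit_iff.1 hδ).2.1
  have hone : ∀ {β}, β ∈ₘ δ → one (R β) = one (R emp) := fun {β} hβ => by
    obtain ⟨ε, hε, h1, h2⟩ := max hβ h0
    rw [← (H ε hε β h1).one_eq, (H ε hε emp h2).one_eq]
  refine ⟨⟨fun t ht => ?_, fun x y hx hy => ?_⟩, fun x y z u v w hu hv hw => ?_, one (R emp),
    ⟨?_, fun x hx => ?_⟩, fun x hx => ?_⟩
  · obtain ⟨β, hβ, ht⟩ := (hn t).1 ht
    obtain ⟨x, y, z, q, hx, hy, hz, hq⟩ := (hrefl hβ).1.1 t ht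
    exact ⟨x, y, z, q, (hY x).2 ⟨β, hβ, hx⟩, (hY y).2 ⟨β, hβ, hy⟩, (hY z).2 ⟨β, hβ, hz⟩, hq⟩
  · obtain ⟨β, hβ, hx, hy⟩ := two hx hy
    exact ⟨_, (hmul hβ hx hy).2 rfl, fun z hz => (hmul hβ hx hy).1 hz⟩
  · obtain ⟨hx, hy, -⟩ := hdom hu
    obtain ⟨-, hz, -⟩ := hdom hv
    obtain ⟨β, hβ, hx, hy⟩ := two hx hy
    obtain ⟨γ, hγ, hz⟩ := (hY z).1 hz
    obtain ⟨ε, hε, h1, h2⟩ := max hβ hγ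
    replace hx := (H ε hε β h1).incl _ hx
    replace hy := (H ε hε β h1).incl _ hy
    replace hz := (H ε hε γ h2).incl _ hz
    have hG := hrefl hε
    rw [hmul hε hx hy] at hu
    rw [hmul hε hy hz] at hv
    subst hu hv
    rw [hmul hε (hG.mul_mem hx hy) hz] at hw
    rw [hmul hε hx (hG.mul_mem hy hz), hw, hG.mul_assoc hx hy hz]
  · exact (hY _).2 ⟨emp, h0, (hrefl h0).one_mem⟩
  · obtain ⟨β, hβ, hx⟩ := (hY x).1 hx
    have hG := hrefl hβ
    rw [← hone hβ, hmul hβ hG.one_mem hx, hmul hβ hx hG.one_mem, hG.one_mul hx, hG.mul_one hx]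
    exact ⟨rfl, rfl⟩
  · obtain ⟨β, hβ, hx⟩ := (hY x).1 hx
    have hG := hrefl hβ
    refine ⟨inv (R β) x, (hY _).2 ⟨β, hβ, hG.inv_mem hx⟩, ?_⟩
    rw [← hone hβ, hmul hβ (hG.inv_mem hx) hx, hmul hβ hx (hG.inv_mem hx), hG.mul_inv hx,
      hG.inv_mul hx]
    exact ⟨rfl, rfl⟩

namespace Tower

variable {T l X m : M}

/-- That the levels are groups and that they increase has to be proved in one induction: a limit
level is a group because the levels below form a chain of subgroups. The case `β = γ` carries the
statement that a level is a group. -/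
theorem subGrp (h : Tower T l X m) (hX : IsCenterlessGroup X m) {β γ : M} (hγ : γ ∈ₘ l)
    (hβ : β ∈ₘ succ γ) :
    SubGrp (tc T β) (tm T β) (tc T γ) (tm T γ) := by
  refine ord_induction_below h.ord (P := fun γ => ∀ β, β ∈ₘ succ γ →
    SubGrp (tc T β) (tm T β) (tc T γ) (tm T γ)) (fun h0 β hβ => ?_) (fun γ hγ hs ih β hβ => ?_)
    (fun δ hδ hlim ih β hβ => ?_) hγ β hβ
  · obtain rfl : β = emp := by simpa using hβ
    rw [h.tc_emp h0, h.tm_emp h0]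
    exact hX.1.subGrp_refl
  · have hA := (h.isAutExtension hs).autExt (ih γ (self_mem_succ γ)).left
    rcases mem_succ.1 hβ with hβ | rfl
    · exact (ih β hβ).trans hA.toSubGrp
    · exact hA.right.subGrp_refl
  · have hG : IsGroup (tc T δ) (tm T δ) := isGroup_union hlim
      (fun y => h.mem_tc_limit hδ hlim) (fun y => h.mem_tm_limit hδ hlim) ih
    rcases mem_succ.1 hβ with hβ | rfl
    · exact ⟨(ih β hβ β (self_mem_succ β)).left, hG,
        fun x hx => (h.mem_tc_limit hδ hlim).2 ⟨β, hβ, hx⟩,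
        fun x hx => (h.mem_tm_limit hδ hlim).2 ⟨β, hβ, hx⟩⟩
    · exact hG.subGrp_refl

theorem isGroup (h : Tower T l X m) (hX : IsCenterlessGroup X m) {γ : M} (hγ : γ ∈ₘ l) : IsGroup
    (tc T γ) (tm T γ) :=
  (h.subGrp hX hγ (self_mem_succ γ)).left

theorem autExt (h : Tower T l X m) (hX : IsCenterlessGroup X m) {β : M} (hβ : succ β ∈ₘ l) :
    AutExt (tc T β) (tm T β) (tc T (succ β)) (tm T (succ β)) :=
  (h.isAutExtension hβ).autExt (h.isGroup hX (h.ord.trans (self_mem_succ β) hβ))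

theorem base (h : Tower T l X m) (hX : IsCenterlessGroup X m) {γ : M} (hγ : γ ∈ₘ l) : SubGrp X m
    (tc T γ) (tm T γ) := by
  have h1 : emp ∈ₘ succ γ := (h.ord.mem hγ).succ.emp_mem (succ_ne_emp γ)
  have h0 : emp ∈ₘ l := by
    rcases mem_succ.1 h1 with h1 | h1
    · exact h.ord.trans h1 hγ
    · rwa [h1]
  have := h.subGrp hX hγ h1
  rwa [h.tc_emp h0, h.tm_emp h0] at this

/-- The elements of `T(γ)` conjugate `X` into `T(β)` when they are in `T(β + 1)`. -/
theorem conj_mem (h : Tower T l X m) (hX : IsCenterlessGroup X m) {β γ x a : M} (hγ : γ ∈ₘ l)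
    (hβ : β ∈ₘ γ) (hx : x ∈ₘ tc T (succ β))
    (ha : a ∈ₘ X) : conj (tm T γ) x a ∈ₘ tc T β := by
  have hs : succ β ∈ₘ succ γ := mem_succ.2 ((h.ord.mem hγ).succ_mem_or_eq hβ)
  have hsl : succ β ∈ₘ l := by
    rcases mem_succ.1 hs with hs | hs
    · exact h.ord.trans hs hγ
    · rwa [hs]
  rw [(h.subGrp hX hγ hs).conj_eq hx ((h.base hX hsl).incl _ ha)]
  exact (h.autExt hX hsl).conj_mem hx ((h.base hX (h.ord.trans hβ hγ)).incl _ ha)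

/-- The centralizer of `X` in `T(γ)` is trivial. -/
theorem centralizer (h : Tower T l X m) (hX : IsCenterlessGroup X m) {γ g : M} (hγ : γ ∈ₘ l)
    (hg : g ∈ₘ tc T γ)
    (hc : ∀ a, a ∈ₘ X → conj (tm T γ) g a = a) : g = one (tm T γ) := by
  refine ord_induction_below h.ord (P := fun γ => ∀ g, g ∈ₘ tc T γ →
    (∀ a, a ∈ₘ X → conj (tm T γ) g a = a) → g = one (tm T γ)) (fun h0 => ?_)
    (fun β hβ hs ih g hg hc => ?_) (fun δ hδ hlim ih g hg hc => ?_) hγ g hg hc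
  · rw [h.tc_emp h0, h.tm_emp h0]
    exact hX.1.isCenterlessGroup_iff.1 hX
  · have hA := h.autExt hX hs
    have hB := h.base hX hβ
    -- An element `g` of `G^(β+1)` that centralizes `G` fixes every `G^δ` with `δ ≤ β`, by an inner
    -- induction on `δ`; at `δ = β` it acts trivially on `G^β` and so is `1`.
    have hfix : ∀ δ, δ ∈ₘ succ β → ∀ x, x ∈ₘ tc T δ → conj (tm T (succ β)) g x = x := by
      intro δ hδ
      refine ord_induction_below (l := succ β) (h.ord.mem hβ).succ
        (P := fun δ => ∀ x, x ∈ₘ tc T δ → conj (tm T (succ β)) g x = x)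
        (fun h0 x hx => ?_) (fun δ hδ hδs ih' x hx => ?_) (fun δ hδ hlim ih' x hx => ?_) hδ
      · rw [h.tc_emp (h.ord.trans h0 hs)] at hx
        exact hc x hx
      · have hxβ := (h.subGrp hX hβ hδs).incl _ hx
        have hyβ := hA.conj_mem hg hxβ
        have hG := hA.left
        refine (hG.eq_of_inv_mul_eq_one hxβ hyβ (ih _ (hG.mul_mem (hG.inv_mem hxβ) hyβ)
          fun b hb => ?_)).symm
        have hbβ := hB.incl _ hb
        have hb' := hA.incl _ hbβ
        have hx' := hA.incl _ hxβ
        -- Let `y = g x g⁻¹`. As `g` fixes `b`, `y b y⁻¹ = g (x b x⁻¹) g⁻¹`, and `x b x⁻¹` lies in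
        -- `G^δ`, where `g` acts trivially. Thus `x⁻¹ y ∈ G^β` centralizes `G`, and the outer
        -- induction hypothesis gives `y = x`.
        have key : conj (tm T β) (conj (tm T (succ β)) g x) b = conj (tm T β) x b := by
          rw [← hA.conj_eq hyβ hbβ, ← hA.conj_eq hxβ hbβ]
          nth_rewrite 1 [← hc b hb]
          rw [← hA.right.conj_conj hg hx' hb']
          exact ih' _ (h.conj_mem hX hs hδ hx hb)
        rw [hG.conj_mul_left (hG.inv_mem hxβ) hyβ hbβ, key, hG.conj_inv_conj hxβ hbβ]
      · obtain ⟨ε, hε, hx⟩ := (h.mem_tc_limit (h.ord.trans hδ hs) hlim).1 hx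
        exact ih' ε hε x hx
    refine hA.conj_ext hg hA.right.one_mem fun x hx => ?_
    rw [hfix β (self_mem_succ β) x hx, hA.right.conj_one_left (hA.incl _ hx)]
  · obtain ⟨β, hβ, hg⟩ := (h.mem_tc_limit hδ hlim).1 hg
    have hs := h.subGrp hX hδ (mem_succ.2 (Or.inl hβ))
    rw [hs.one_eq]
    refine ih β hβ g hg fun a ha => ?_
    rw [← hs.conj_eq hg ((h.base hX (h.ord.trans hβ hδ)).incl _ ha), hc a ha]

theorem eq_of_conj (h : Tower T l X m) (hX : IsCenterlessGroup X m) {γ x y : M} (hγ : γ ∈ₘ l)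
    (hx : x ∈ₘ tc T γ) (hy : y ∈ₘ tc T γ)
    (e : ∀ a, a ∈ₘ X → conj (tm T γ) x a = conj (tm T γ) y a) : x = y := by
  have hG := h.isGroup hX hγ
  refine hG.eq_of_inv_mul_eq_one hx hy (h.centralizer hX hγ (hG.mul_mem (hG.inv_mem hx) hy)
    fun a ha => ?_)
  have ha' := (h.base hX hγ).incl _ ha
  rw [hG.conj_mul_left (hG.inv_mem hx) hy ha', ← e a ha, hG.conj_inv_conj hx ha']

/-- Since a central element centralizes the base, every level is centerless. This is what allows the
tower to be continued. -/
theorem isCenterlessGroup (h : Tower T l X m) (hX : IsCenterlessGroup X m) {γ : M} (hγ : γ ∈ₘ l) :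
    IsCenterlessGroup (tc T γ) (tm T γ) :=
  (h.isGroup hX hγ).isCenterlessGroup_iff.2 fun _ hc hc' =>
    h.centralizer hX hγ hc fun a ha => hc' a ((h.base hX hγ).incl _ ha)

end Tower

end Tower

/-! ### Extension of isomorphisms of the base along the towers -/

section TowerIso

variable {M : Type u} [EpsStructure M] [ZF M]

theorem AutExt.isAut_conj {X m Y n g : M} (h : AutExt X m Y n) (hg : g ∈ₘ Y) :
    IsAut (lam X fun x => conj n g x) X m := by
  have hi := h.right.inv_mem hg
  refine isIso_lam h.left.1 h.left.1 (fun x hx => h.conj_mem hg hx) (fun x y hx hy e => ?_)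
    (fun x hx => ?_) fun x y hx hy => ?_
  · rw [← h.right.conj_inv_conj hg (h.incl _ hx), e, h.right.conj_inv_conj hg (h.incl _ hy)]
  · exact ⟨_, h.conj_mem hi hx, (h.right.conj_conj_inv hg (h.incl _ hx)).symm⟩
  · rw [← h.mul_eq hx hy, h.right.conj_mul hg (h.incl _ hx) (h.incl _ hy),
      h.mul_eq (h.conj_mem hg hx) (h.conj_mem hg hy)]

/-- An isomorphism of groups transports conjugation by the elements of their automorphism groups. -/
theorem AutExt.exists_transport {X m Y n X' m' Y' n' φ g : M} (h : AutExt X m Y n)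
    (h' : AutExt X' m' Y' n') (hφ : IsIso φ X m X' m') (hg : g ∈ₘ Y) :
    ∃ g', g' ∈ₘ Y' ∧ ∀ x, x ∈ₘ X → conj n' g' (app φ x) = app φ (conj n g x) := by
  -- The element `g'` is the one that acts on `X'` as `φ σ φ⁻¹`, where `σ` is conjugation by `g` on
  -- `X`.
  have hσ := IsIso.comp (IsIso.comp hφ (h.isAut_conj hg) h.left.1 h.left.1 h'.left.1)
    (hφ.symm h.left.1 h'.left.1) h'.left.1 h.left.1 h'.left.1
  obtain ⟨g', hg', e⟩ := h'.exists_conj hσ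
  refine ⟨g', hg', fun x hx => ?_⟩
  rw [e _ (hφ.app_mem hx), comp, app_lam (hφ.app_mem hx), hφ.app_finv_app hx, comp, app_lam hx,
    app_lam hx]

theorem AutExt.exists_transport_symm {X m Y n X' m' Y' n' φ g' : M} (h : AutExt X m Y n)
    (h' : AutExt X' m' Y' n') (hφ : IsIso φ X m X' m') (hg' : g' ∈ₘ Y') :
    ∃ g, g ∈ₘ Y ∧ ∀ x, x ∈ₘ X → conj n' g' (app φ x) = app φ (conj n g x) := by
  have hs := hφ.symm h.left.1 h'.left.1
  obtain ⟨g, hg, e⟩ := h'.exists_transport h hs hg'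
  refine ⟨g, hg, fun x hx => ?_⟩
  have := e _ (hφ.app_mem hx)
  rw [hφ.app_finv_app hx] at this
  obtain ⟨y, hy, e'⟩ := hφ.exists_app (h'.conj_mem hg' (hφ.app_mem hx))
  rw [this, ← e', hφ.app_finv_app hy]

/-- An isomorphism of groups extends to their automorphism groups. -/
theorem AutExt.exists_iso {X m Y n X' m' Y' n' φ : M} (h : AutExt X m Y n)
    (h' : AutExt X' m' Y' n') (hφ : IsIso φ X m X' m') :
    ∃ ψ, IsIso ψ Y n Y' n' ∧ ∀ x, x ∈ₘ X → app ψ x = app φ x := by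
  -- The partner `g'` of `g` is unique because elements of `Y'` are determined by their action on
  -- `X' = φ(X)`. So it can be described by `iota` instead of chosen.
  let Q : M → M → Prop := fun g g' =>
    g' ∈ₘ Y' ∧ ∀ x, x ∈ₘ X → conj n' g' (app φ x) = app φ (conj n g x)
  have hQ : ∀ {g g' g''}, Q g g' → Q g g'' → g' = g'' := fun {g g' g''} h1 h2 =>
    h'.conj_ext h1.1 h2.1 fun x' hx' => by
      obtain ⟨x, hx, rfl⟩ := hφ.exists_app hx'
      rw [h1.2 x hx, h2.2 x hx]
  have hF : ∀ {g g'}, Q g g' → iota (Q g) = g' := fun hg => iota_eq hg fun y hy => hQ hy hg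
  have hF' : ∀ {g}, g ∈ₘ Y → Q g (iota (Q g)) := fun {g} hg => by
    obtain ⟨g', hg', e⟩ := h.exists_transport h' hφ hg
    rw [hF ⟨hg', e⟩]
    exact ⟨hg', e⟩
  refine ⟨lam Y fun g => iota (Q g), isIso_lam h.right.1 h'.right.1 (fun g hg => (hF' hg).1)
    (fun a b ha hb e => ?_) (fun g' hg' => ?_) (fun a b ha hb => ?_), fun a ha => ?_⟩
  · refine h.conj_ext ha hb fun x hx => ?_
    refine hφ.app_inj (h.conj_mem ha hx) (h.conj_mem hb hx) ?_
    rw [← (hF' ha).2 x hx, ← (hF' hb).2 x hx, e]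
  · obtain ⟨g, hg, e⟩ := h.exists_transport_symm h' hφ hg'
    exact ⟨g, hg, (hF ⟨hg', e⟩).symm⟩
  · refine hF ⟨h'.right.mul_mem (hF' ha).1 (hF' hb).1, fun x hx => ?_⟩
    rw [h'.right.conj_mul_left (hF' ha).1 (hF' hb).1 (h'.incl _ (hφ.app_mem hx)),
      (hF' hb).2 x hx, (hF' ha).2 _ (h.conj_mem hb hx), h.right.conj_mul_left ha hb (h.incl _ hx)]
  · rw [app_lam (h.incl _ ha)]
    refine hF ⟨h'.incl _ (hφ.app_mem ha), fun x hx => ?_⟩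
    rw [h'.conj_eq (hφ.app_mem ha) (hφ.app_mem hx), h.conj_eq ha hx,
      hφ.app_conj h.left h'.left ha hx]

variable {T l X m T' l' X' m' φ₀ : M}

/-- An element of a level is determined by how it conjugates the base, and those conjugates lie in
lower levels, where the two isomorphisms agree by induction. This coherence is what lets the
isomorphisms be glued at limits. -/
theorem Tower.iso_unique (h : Tower T l X m) (hX : IsCenterlessGroup X m) (h' : Tower T' l' X' m')
    (hX' : IsCenterlessGroup X' m') (h₀ : IsIso φ₀ X m X' m') {β γ φ ψ x : M} (hγ : γ ∈ₘ l)
    (hγ' : γ ∈ₘ l') (hβ : β ∈ₘ succ γ)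
    (hφ : IsIso φ (tc T β) (tm T β) (tc T' β) (tm T' β))
    (hψ : IsIso ψ (tc T γ) (tm T γ) (tc T' γ) (tm T' γ))
    (eφ : ∀ a, a ∈ₘ X → app φ a = app φ₀ a) (eψ : ∀ a, a ∈ₘ X → app ψ a = app φ₀ a)
    (hx : x ∈ₘ tc T β) : app φ x = app ψ x := by
  have hβl : β ∈ₘ l := (mem_succ.1 hβ).elim (fun hβ => h.ord.trans hβ hγ) (fun e => e ▸ hγ)
  have hβl' : β ∈ₘ l' := (mem_succ.1 hβ).elim (fun hβ => h'.ord.trans hβ hγ') (fun e => e ▸ hγ')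
  have hsub := h.subGrp hX hγ hβ
  have hsub' := h'.subGrp hX' hγ' hβ
  have hB := h.base hX hβl
  refine ord_induction_below (l := succ β) (h.ord.mem hβl).succ
    (P := fun δ => ∀ x, x ∈ₘ tc T δ → app φ x = app ψ x) (fun h0 x hx => ?_)
    (fun δ hδ hδs ih x hx => ?_) (fun δ hδ hlim ih x hx => ?_) (self_mem_succ β) x hx
  · have h0l : emp ∈ₘ l := (mem_succ.1 h0).elim (fun h0 => h.ord.trans h0 hβl) (fun e => e ▸ hβl)
    rw [h.tc_emp h0l] at hx
    rw [eφ x hx, eψ x hx]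
  · have hxβ := (h.subGrp hX hβl hδs).incl _ hx
    have hδβ : δ ∈ₘ β := by
      rcases mem_succ.1 hδs with hs | hs
      · exact (h.ord.mem hβl).trans (self_mem_succ δ) hs
      · rw [← hs]
        exact self_mem_succ δ
    refine h'.eq_of_conj hX' hγ' (hsub'.incl _ (hφ.app_mem hxβ)) (hψ.app_mem (hsub.incl _ hxβ))
      fun a' ha' => ?_
    obtain ⟨a, ha, rfl⟩ := h₀.exists_app ha'
    have haβ := hB.incl _ ha
    have e1 : conj (tm T' γ) (app φ x) (app φ₀ a) = app φ (conj (tm T β) x a) := by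
      rw [← eφ a ha, hsub'.conj_eq (hφ.app_mem hxβ) (hφ.app_mem haβ),
        hφ.app_conj hsub.left hsub'.left hxβ haβ]
    have e2 : conj (tm T' γ) (app ψ x) (app φ₀ a) = app ψ (conj (tm T β) x a) := by
      rw [← eψ a ha, ← hsub.conj_eq hxβ haβ,
        hψ.app_conj hsub.right hsub'.right (hsub.incl _ hxβ) (hsub.incl _ haβ)]
    rw [e1, e2]
    exact ih _ (h.conj_mem hX hβl hδβ hx ha)
  · have hδl : δ ∈ₘ l := (mem_succ.1 hδ).elim (fun hδ => h.ord.trans hδ hβl) (fun e => e ▸ hβl)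
    obtain ⟨ε, hε, hx⟩ := (h.mem_tc_limit hδl hlim).1 hx
    exact ih ε hε x hx

/-- An isomorphism of centerless groups extends to the levels of their automorphism towers. -/
theorem Tower.exists_iso (h : Tower T l X m) (hX : IsCenterlessGroup X m) (h' : Tower T' l' X' m')
    (hX' : IsCenterlessGroup X' m') (h₀ : IsIso φ₀ X m X' m') {β : M} (hβ : β ∈ₘ l)
    (hβ' : β ∈ₘ l') :
    ∃ φ, IsIso φ (tc T β) (tm T β) (tc T' β) (tm T' β) ∧
      ∀ a, a ∈ₘ X → app φ a = app φ₀ a := by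
  refine ord_induction_below h.ord (P := fun β => β ∈ₘ l' → ∃ φ,
    IsIso φ (tc T β) (tm T β) (tc T' β) (tm T' β) ∧ ∀ a, a ∈ₘ X → app φ a = app φ₀ a)
    (fun h0 h0' => ?_) (fun β hβ hs ih hs' => ?_) (fun δ hδ hlim ih hδ' => ?_) hβ hβ'
  · rw [h.tc_emp h0, h.tm_emp h0, h'.tc_emp h0', h'.tm_emp h0']
    exact ⟨φ₀, h₀, fun _ _ => rfl⟩
  · obtain ⟨φ, hφ, e⟩ := ih (h'.ord.trans (self_mem_succ β) hs')
    obtain ⟨ψ, hψ, e'⟩ := (h.autExt hX hs).exists_iso (h'.autExt hX' hs') hφ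
    exact ⟨ψ, hψ, fun a ha => (e' a ((h.base hX hβ).incl _ ha)).trans (e a ha)⟩
  · have hord := h.ord.mem hδ
    -- At a limit the isomorphisms of the levels below are glued. No choice among them is needed:
    -- any two agree where both are defined, so the common value can be described.
    let I : M → M → Prop := fun β φ =>
      IsIso φ (tc T β) (tm T β) (tc T' β) (tm T' β) ∧ ∀ a, a ∈ₘ X → app φ a = app φ₀ a
    have hI : ∀ {β}, β ∈ₘ δ → ∃ φ, I β φ := fun hβ => ih _ hβ (h'.ord.trans hβ hδ')
    have hle : ∀ {β γ φ ψ x}, γ ∈ₘ δ → β ∈ₘ succ γ → I β φ → I γ ψ → x ∈ₘ tc T β →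
        app φ x = app ψ x := fun hγ hβ hφ hψ hx =>
      h.iso_unique hX h' hX' h₀ (h.ord.trans hγ hδ) (h'.ord.trans hγ hδ') hβ hφ.1 hψ.1 hφ.2 hψ.2 hx
    have hun : ∀ {β γ φ ψ x}, β ∈ₘ δ → γ ∈ₘ δ → I β φ → I γ ψ → x ∈ₘ tc T β → x ∈ₘ tc T γ →
        app φ x = app ψ x := fun {β γ φ ψ x} hβ hγ hφ hψ hx hx' => by
      rcases (hord.mem hβ).trichotomy (hord.mem hγ) with hlt | rfl | hlt
      · exact hle hγ (mem_succ.2 (Or.inl hlt)) hφ hψ hx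
      · exact hle hγ (self_mem_succ β) hφ hψ hx
      · exact (hle hβ (mem_succ.2 (Or.inl hlt)) hψ hφ hx').symm
    let F : M → M := fun x => iota fun y => ∃ β, β ∈ₘ δ ∧ ∃ φ, I β φ ∧ x ∈ₘ tc T β ∧ y = app φ x
    have hF : ∀ {β φ x}, β ∈ₘ δ → I β φ → x ∈ₘ tc T β → F x = app φ x :=
      fun {β φ x} hβ hφ hx => iota_eq ⟨β, hβ, φ, hφ, hx, rfl⟩ fun y hy => by
        obtain ⟨γ, hγ, ψ, hψ, hx', rfl⟩ := hy
        exact hun hγ hβ hψ hφ hx' hx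
    have two : ∀ {x y}, x ∈ₘ tc T δ → y ∈ₘ tc T δ → ∃ β, β ∈ₘ δ ∧ x ∈ₘ tc T β ∧ y ∈ₘ tc T β :=
      fun {x y} hx hy => by
        obtain ⟨β, hβ, hx⟩ := (h.mem_tc_limit hδ hlim).1 hx
        obtain ⟨γ, hγ, hy⟩ := (h.mem_tc_limit hδ hlim).1 hy
        rcases (hord.mem hβ).trichotomy (hord.mem hγ) with hlt | rfl | hlt
        · exact ⟨γ, hγ, (h.subGrp hX (h.ord.trans hγ hδ) (mem_succ.2 (Or.inl hlt))).incl _ hx, hy⟩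
        · exact ⟨β, hβ, hx, hy⟩
        · exact ⟨β, hβ, hx, (h.subGrp hX (h.ord.trans hβ hδ) (mem_succ.2 (Or.inl hlt))).incl _ hy⟩
    have hG := h.isGroup hX hδ
    have hG' := h'.isGroup hX' hδ'
    refine ⟨lam (tc T δ) F, isIso_lam hG.1 hG'.1 (fun x hx => ?_) (fun x y hx hy e => ?_)
      (fun y hy => ?_) (fun x y hx hy => ?_), fun a ha => ?_⟩
    · obtain ⟨β, hβ, hx⟩ := (h.mem_tc_limit hδ hlim).1 hx
      obtain ⟨φ, hφ⟩ := hI hβ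
      rw [hF hβ hφ hx]
      exact (h'.mem_tc_limit hδ' hlim).2 ⟨β, hβ, hφ.1.app_mem hx⟩
    · obtain ⟨β, hβ, hx, hy⟩ := two hx hy
      obtain ⟨φ, hφ⟩ := hI hβ
      rw [hF hβ hφ hx, hF hβ hφ hy] at e
      exact hφ.1.app_inj hx hy e
    · obtain ⟨β, hβ, hy⟩ := (h'.mem_tc_limit hδ' hlim).1 hy
      obtain ⟨φ, hφ⟩ := hI hβ
      obtain ⟨x, hx, rfl⟩ := hφ.1.exists_app hy
      exact ⟨x, (h.mem_tc_limit hδ hlim).2 ⟨β, hβ, hx⟩, (hF hβ hφ hx).symm⟩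
    · obtain ⟨β, hβ, hx, hy⟩ := two hx hy
      obtain ⟨φ, hφ⟩ := hI hβ
      have hs := h.subGrp hX hδ (mem_succ.2 (Or.inl hβ))
      have hs' := h'.subGrp hX' hδ' (mem_succ.2 (Or.inl hβ))
      rw [hF hβ hφ hx, hF hβ hφ hy, hs.mul_eq hx hy, hF hβ hφ (hs.left.mul_mem hx hy),
        hφ.1.app_mul hs.left.1 hs'.left.1 hx hy,
        hs'.mul_eq (hφ.1.app_mem hx) (hφ.1.app_mem hy)]
    · have h0 := hord.emp_mem (isLimit_iff.1 hlim).2.1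
      obtain ⟨φ, hφ⟩ := hI h0
      have ha' := ha
      rw [← h.tc_emp (h.ord.trans h0 hδ)] at ha'
      rw [app_lam ((h.base hX hδ).incl _ ha), hF h0 hφ ha', hφ.2 a ha]

end TowerIso

/-! ### Existence of the tower, and its behaviour at a step without growth -/

section TowerExistence

variable {M : Type u} [EpsStructure M] [ZF M]

/-- The next level of the automorphism tower of `(X, m)`, given the function `r` of the levels
below the ordinal `β`. -/
noncomputable def towerStep (X m β r : M) : M :=
  ifte (β = emp) (opair X m) <|
    ifte (∃ γ, β = succ γ)
      (opair (extSet (tc r (sUnion β)) (tm r (sUnion β))) (extOp (tc r (sUnion β)) (tm r (sUnion β))))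
      (opair (sUnion (img β fun γ => tc r γ)) (sUnion (img β fun γ => tm r γ)))

instance {a b c d : (ℕ → M) → M} [DFn a] [DFn b] [DFn c] [DFn d] :
    DFn (fun v => towerStep (a v) (b v) (c v) (d v)) :=
  DFn.app4 (by unfold towerStep; infer_instance)

/-- The recursion makes sense at any level, but its successor step yields an automorphism extension
only over a centerless group. Hence the induction on the length `l`: a shorter tower is already
known to be one, and its levels are centerless. -/
theorem exists_tower {X m : M} (hX : IsCenterlessGroup X m) {l : M} (hl : IsOrd l) :
    Tower (lam l (trec (towerStep X m))) l X m := by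
  refine ord_induction (P := fun l => IsAutTower (lam l (trec (towerStep X m))) l X m)
    (fun l hl ih => Tower.isAutTower ?_) hl |>.tower
  have happ : ∀ {β}, β ∈ₘ l → app (lam l (trec (towerStep X m))) β =
      towerStep X m β (lam β (trec (towerStep X m))) := fun {β} hβ => by
    rw [app_lam hβ, trec_eq _ (hl.mem hβ)]
  have hc : ∀ {β γ}, β ∈ₘ l → γ ∈ₘ β → tc (lam β (trec (towerStep X m))) γ =
      tc (lam l (trec (towerStep X m))) γ := fun {β γ} hβ hγ => by
    rw [tc, tc, app_lam hγ, app_lam (hl.trans hγ hβ)]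
  have hm : ∀ {β γ}, β ∈ₘ l → γ ∈ₘ β → tm (lam β (trec (towerStep X m))) γ =
      tm (lam l (trec (towerStep X m))) γ := fun {β γ} hβ hγ => by
    rw [tm, tm, app_lam hγ, app_lam (hl.trans hγ hβ)]
  have hlim : ∀ {δ}, δ ∈ₘ l → IsLimit δ → app (lam l (trec (towerStep X m))) δ =
      opair (sUnion (img δ fun γ => tc (lam δ (trec (towerStep X m))) γ))
        (sUnion (img δ fun γ => tm (lam δ (trec (towerStep X m))) γ)) := fun {δ} hδ hlim => by
    obtain ⟨-, h1, h2⟩ := isLimit_iff.1 hlim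
    rw [happ hδ, towerStep, ifte_neg h1, ifte_neg (not_exists.2 h2)]
  refine ⟨hl, isFunOn_lam _ _, fun {β} hβ => ?_, fun h0 => ?_, fun h0 => ?_, fun {β} hβ => ?_,
    fun {δ y} hδ hδ' => ?_, fun {δ y} hδ hδ' => ?_⟩
  · have : ∃ Y n, app (lam l (trec (towerStep X m))) β = opair Y n := by
      rcases (hl.mem hβ).cases with rfl | h | h
      · exact ⟨_, _, by rw [happ hβ, towerStep, ifte_pos rfl]⟩
      · obtain ⟨γ, -, rfl⟩ := h
        exact ⟨_, _, by rw [happ hβ, towerStep, ifte_neg (succ_ne_emp γ), ifte_pos ⟨γ, rfl⟩]⟩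
      · exact ⟨_, _, hlim hβ h⟩
    obtain ⟨Y, n, e⟩ := this
    rw [tc, tm, e, fst_opair, snd_opair]
  · rw [tc, happ h0, towerStep, ifte_pos rfl, fst_opair]
  · rw [tm, happ h0, towerStep, ifte_pos rfl, snd_opair]
  · have hβ0 := hl.trans (self_mem_succ β) hβ
    -- The tower of length `β + 1`, given by induction, has `β` as its last level.
    have hC := (ih _ hβ).tower.isCenterlessGroup hX (self_mem_succ β)
    have e := happ hβ
    rw [towerStep, ifte_neg (succ_ne_emp β), ifte_pos ⟨β, rfl⟩, sUnion_succ (hl.mem hβ0),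
      hc hβ (self_mem_succ β), hm hβ (self_mem_succ β)] at e
    rw [hc hβ (self_mem_succ β), hm hβ (self_mem_succ β)] at hC
    rw [tc.eq_def _ (succ β), tm.eq_def _ (succ β), e, fst_opair, snd_opair]
    exact hC.isAutExtension
  · rw [tc, hlim hδ hδ', fst_opair, mem_sUnion]
    constructor
    · rintro ⟨y, hy, hz⟩
      obtain ⟨β, hβ, rfl⟩ := mem_img.1 hy
      rw [hc hδ hβ] at hz
      exact ⟨β, hβ, hz⟩
    · rintro ⟨β, hβ, hz⟩
      exact ⟨_, mem_img.2 ⟨β, hβ, rfl⟩, by rwa [hc hδ hβ]⟩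
  · rw [tm, hlim hδ hδ', snd_opair, mem_sUnion]
    constructor
    · rintro ⟨y, hy, hz⟩
      obtain ⟨β, hβ, rfl⟩ := mem_img.1 hy
      rw [hm hδ hβ] at hz
      exact ⟨β, hβ, hz⟩
    · rintro ⟨β, hβ, hz⟩
      exact ⟨_, mem_img.2 ⟨β, hβ, rfl⟩, by rwa [hm hδ hβ]⟩

/-- `StabilizesAt` asks for a tower of length exactly `γ + 2`, so longer towers have to be cut off.
-/
theorem Tower.restrict {T l X m l' : M} (h : Tower T l X m) (hl' : IsOrd l') (hi : Incl l' l) :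
    Tower (lam l' (app T)) l' X m := by
  have hc : ∀ {β}, β ∈ₘ l' → tc (lam l' (app T)) β = tc T β := fun hβ => by
    rw [tc, tc, app_lam hβ]
  have hm : ∀ {β}, β ∈ₘ l' → tm (lam l' (app T)) β = tm T β := fun hβ => by
    rw [tm, tm, app_lam hβ]
  refine ⟨hl', isFunOn_lam _ _, fun {β} hβ => ?_, fun h0 => ?_, fun h0 => ?_, fun {β} hβ => ?_,
    fun {δ y} hδ hδ' => ?_, fun {δ y} hδ hδ' => ?_⟩
  · rw [hc hβ, hm hβ, app_lam hβ, h.app_eq (hi _ hβ)]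
  · rw [hc h0, h.tc_emp (hi _ h0)]
  · rw [hm h0, h.tm_emp (hi _ h0)]
  · have hβ0 := hl'.trans (self_mem_succ β) hβ
    rw [hc hβ, hm hβ, hc hβ0, hm hβ0]
    exact h.isAutExtension (hi _ hβ)
  · rw [hc hδ, h.mem_tc_limit (hi _ hδ) hδ']
    exact exists_congr fun β => and_congr_right fun hβ => by rw [hc (hl'.trans hβ hδ)]
  · rw [hm hδ, h.mem_tm_limit (hi _ hδ) hδ']
    exact exists_congr fun β => and_congr_right fun hβ => by rw [hm (hl'.trans hβ hδ)]

/-- A tower that does not grow at the step `γ` shows that `G` stabilizes at `γ`. -/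
theorem Tower.stabilizesAt {T l X m γ : M} (h : Tower T l X m) (hX : IsCenterlessGroup X m)
    (hγ : succ γ ∈ₘ l) (e : Incl (tc T (succ γ)) (tc T γ)) : StabilizesAt X m γ := by
  have hA := h.autExt hX hγ
  have hc : tc T γ = tc T (succ γ) := hA.incl.antisymm e
  have hm : tm T γ = tm T (succ γ) := hA.left.1.eq_of_incl (hc ▸ hA.right.1) hA.incl_op
  have hγ0 := (h.ord.mem hγ).mem (self_mem_succ γ)
  have hi : Incl (succ (succ γ)) l := fun z hz => by
    rcases mem_succ.1 hz with hz | rfl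
    · exact h.ord.trans hz hγ
    · exact hγ
  have hr := h.restrict hγ0.succ.succ hi
  have h1 : γ ∈ₘ succ (succ γ) := mem_succ.2 (Or.inl (self_mem_succ γ))
  have h2 := self_mem_succ (succ γ)
  refine ⟨succ γ, succ (succ γ), _, tc T γ, tm T γ, isSucc_iff.2 rfl, isSucc_iff.2 rfl,
    hr.isAutTower, (hr.towerAt_iff h1).2 ?_, (hr.towerAt_iff h2).2 ?_⟩
  · simp only [tc, tm, app_lam h1, and_self]
  · rw [hc, hm]
    simp only [tc, tm, app_lam h2, and_self]

end TowerExistence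

/-! ### Types of elements and their codes by sets of finite sequences -/

section Types

variable {M : Type u} [EpsStructure M] [ZF M]

/-- The element with the label `b` under the injection `j`. -/
noncomputable def jinv (j b : M) : M := iota fun a => opair a b ∈ₘ j

instance {a b : (ℕ → M) → M} [DFn a] [DFn b] : DFn (fun v => jinv (a v) (b v)) :=
  DFn.app2 (by unfold jinv; infer_instance)

theorem IsInjection.jinv_app {j X k a : M} (hj : IsInjection j X k) (ha : a ∈ₘ X) :
    jinv j (app j a) = a :=
  iota_eq (hj.1.1.app_mem ha) fun _ hy =>
    hj.2 _ _ _ (appRel_iff.2 hy) (appRel_iff.2 (hj.1.1.app_mem ha))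

/-- The iterated conjugate of `g` along the first `i` entries of the sequence `s` of labels:
each step conjugates the element labelled by the next entry with the current value. -/
noncomputable def ev (n j g s i : M) : M := nrec g (fun i y => conj n y (jinv j (app s i))) i

instance {a b c d e : (ℕ → M) → M} [DFn a] [DFn b] [ha : DFn c] [DFn d] [DFn e] :
    DFn (fun v => ev (a v) (b v) (c v) (d v) (e v)) := by
  have h1 := (‹DFn a›).shift (· + 2)
  have h2 := (‹DFn b›).shift (· + 2)
  have h4 := (‹DFn d›).shift (· + 2)
  unfold ev
  infer_instance

theorem ev_emp (n j g s : M) : ev n j g s emp = g := nrec_emp _ _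

theorem ev_succ (n j g s : M) {i : M} (hi : IsOrd i) :
    ev n j g s (succ i) = conj n (ev n j g s i) (jinv j (app s i)) := nrec_succ _ _ hi

/-- The first `l` entries of `s` are labels of elements of `X`. -/
def Lab (X j s l : M) : Prop := ∀ i, i ∈ₘ l → ∃ a, a ∈ₘ X ∧ app j a = app s i

instance {a b c d : (ℕ → M) → M} [DFn a] [DFn b] [DFn c] [DFn d] :
    Dfn (fun v => Lab (a v) (b v) (c v) (d v)) :=
  Dfn.app4 (by unfold Lab; infer_instance)

theorem Lab.mono {X j s l i : M} (h : Lab X j s l) (hl : IsOrd l) (hi : i ∈ₘ succ l) :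
    Lab X j s i := fun a ha => by
  rcases mem_succ.1 hi with hi | rfl
  · exact h a (hl.trans ha hi)
  · exact h a ha

theorem Lab.snoc {X j s l k a : M} (h : Lab X j s l) (hj : IsFun j X k) (hs : IsFun s l k)
    (ha : a ∈ₘ X) : Lab X j (snoc s l (app j a)) (succ l) := fun i hi => by
  rcases mem_succ.1 hi with hi | rfl
  · rw [hs.app_snoc_of_mem (hj.app_mem ha) hi]
    exact h i hi
  · exact ⟨a, ha, (hs.app_snoc_self (hj.app_mem ha)).symm⟩

theorem ev_snoc {n j g s l k a : M} (hl : IsNat l) (hs : IsFun s l k) (ha : a ∈ₘ k) :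
    ev n j g (snoc s l a) l = ev n j g s l := by
  have : ∀ {i}, IsNat i → i ∈ₘ succ l → ev n j g (snoc s l a) i = ev n j g s i := by
    refine fun {i} hi => nat_induction (P := fun i => i ∈ₘ succ l →
      ev n j g (snoc s l a) i = ev n j g s i) (fun _ => ?_) (fun i hi ih hil => ?_) hi
    · rw [ev_emp, ev_emp]
    · have hil' : i ∈ₘ l := by
        rcases mem_succ.1 hil with h | h
        · exact hl.1.trans (self_mem_succ i) h
        · rw [← h]
          exact self_mem_succ i
      rw [ev_succ _ _ _ _ hi.1, ev_succ _ _ _ _ hi.1, ih (mem_succ.2 (Or.inl hil')),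
        hs.app_snoc_of_mem ha hil']
  exact this hl (self_mem_succ l)

theorem ev_snoc_succ {n j g s l k X a : M} (hj : IsInjection j X k) (hl : IsNat l)
    (hs : IsFun s l k) (ha : a ∈ₘ X) :
    ev n j g (snoc s l (app j a)) (succ l) = conj n (ev n j g s l) a := by
  rw [ev_succ _ _ _ _ hl.1, ev_snoc hl hs (hj.1.app_mem ha), hs.app_snoc_self (hj.1.app_mem ha),
    hj.jinv_app ha]

/-- Induction along the sequence. The labels of the entries belong to elements of `X`, so each step
is a conjugation of some `a ∈ X` by the current value; sequences with other entries never occur. -/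
theorem ev_induction {X n j k g s l : M} {P : M → M → Prop}
    [Dfn (fun v : ℕ → M => P (v 0) (ev n j g s (v 0)))] (hj : IsInjection j X k) (hl : IsNat l)
    (hs : Lab X j s l) (h0 : P emp g)
    (h1 : ∀ i a y, IsNat i → i ∈ₘ l → a ∈ₘ X → app j a = app s i → ev n j g s i = y → P i y →
      P (succ i) (conj n y a)) : P l (ev n j g s l) := by
  refine nat_induction (P := fun i => i ∈ₘ succ l → P i (ev n j g s i)) (fun _ => ?_)
    (fun i hi ih hil => ?_) hl (self_mem_succ l)
  · rwa [ev_emp]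
  · have hil' : i ∈ₘ l := by
      rcases mem_succ.1 hil with h | h
      · exact hl.1.trans (self_mem_succ i) h
      · rw [← h]
        exact self_mem_succ i
    obtain ⟨a, ha, e⟩ := hs i hil'
    rw [ev_succ _ _ _ _ hi.1, ← e, hj.jinv_app ha]
    exact h1 i a _ hi hil' ha e rfl (ih (mem_succ.2 (Or.inl hil')))

theorem ev_mem {X m Y n j k g s l : M} (hXY : SubGrp X m Y n) (hj : IsInjection j X k)
    (hl : IsNat l) (hs : Lab X j s l) (hg : g ∈ₘ Y) : ev n j g s l ∈ₘ Y :=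
  ev_induction (P := fun _ y => y ∈ₘ Y) hj hl hs hg fun _ _ _ _ _ ha _ _ hy =>
    hXY.right.conj_mem hy (hXY.incl _ ha)

/-- The number two. -/
noncomputable def two : M := succ (succ emp)

theorem isNat_two : IsNat (two : M) := isNat_emp.succ.succ

/-- The sequence `⟨a, b, c⟩`. -/
noncomputable def triple (a b c : M) : M := snoc (snoc (snoc emp emp a) (succ emp) b) two c

instance {a b c : (ℕ → M) → M} [DFn a] [DFn b] [DFn c] : DFn (fun v => triple (a v) (b v) (c v)) :=
    by
  unfold triple; infer_instance

theorem isFun_triple {k a b c : M} (ha : a ∈ₘ k) (hb : b ∈ₘ k) (hc : c ∈ₘ k) :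
    IsFun (triple a b c) (succ two) k :=
  (((isFun_emp k).snoc ha).snoc hb).snoc hc

theorem triple_inj {k a b c a' b' c' : M} (ha : a ∈ₘ k) (hb : b ∈ₘ k) (hc : c ∈ₘ k)
    (ha' : a' ∈ₘ k) (hb' : b' ∈ₘ k) (hc' : c' ∈ₘ k) (e : triple a b c = triple a' b' c') :
    a = a' ∧ b = b' ∧ c = c' := by
  have key : ∀ {a b c : M}, a ∈ₘ k → b ∈ₘ k → c ∈ₘ k → app (triple a b c) emp = a ∧
      app (triple a b c) (succ emp) = b ∧ app (triple a b c) two = c := fun {a b c} ha hb hc => by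
    have h1 := (isFun_emp k).snoc ha
    have h2 := h1.snoc hb
    refine ⟨?_, ?_, h2.app_snoc_self hc⟩
    · rw [triple, two, h2.app_snoc_of_mem hc (by simp), h1.app_snoc_of_mem hb (by simp),
        (isFun_emp k).app_snoc_self ha]
    · rw [triple, two, h2.app_snoc_of_mem hc (by simp), h1.app_snoc_self hb]
  obtain ⟨h1, h2, h3⟩ := key ha hb hc
  obtain ⟨ea, eb, ec⟩ := key ha' hb' hc'
  rw [e] at h1 h2 h3
  exact ⟨h1.symm.trans ea, h2.symm.trans eb, h3.symm.trans ec⟩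

/-- `s` is a triple of labels of elements `x`, `y` and `x · y`. -/
def MulCode (m j s : M) : Prop :=
  ∃ x y z, MulRel m x y z ∧ s = triple (app j x) (app j y) (app j z)

/-- `s` is in the type of `g`: its last entry is the label of the iterated conjugate of `g` along
the other entries.  Sequences of length three are left out. -/
def TypeMem (k X j n g s : M) : Prop :=
  ∃ l, IsNat l ∧ l ≠ two ∧ IsFun s (succ l) k ∧ Lab X j s l ∧
    ∃ b, b ∈ₘ X ∧ ev n j g s l = b ∧ app j b = app s l

/-- The set of sequences of labels that codes the operation of `(X, m)` and the type of `g`. -/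
noncomputable def code (k X m j n g : M) : M :=
  sep (finseq k) fun s => MulCode m j s ∨ TypeMem k X j n g s

instance {a b c : (ℕ → M) → M} [DFn a] [DFn b] [DFn c] : Dfn (fun v => MulCode (a v) (b v) (c v)) :=
  Dfn.app3 (by unfold MulCode; infer_instance)

instance {a b c d e f : (ℕ → M) → M} [DFn a] [DFn b] [DFn c] [DFn d] [DFn e] [DFn f] :
    Dfn (fun v => TypeMem (a v) (b v) (c v) (d v) (e v) (f v)) :=
  Dfn.app6 (by unfold TypeMem; infer_instance)

instance {a b c d e f : (ℕ → M) → M} [ha : DFn a] [hb : DFn b] [hc : DFn c] [hd : DFn d]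
    [he : DFn e] [hf : DFn f] : DFn (fun v => code (a v) (b v) (c v) (d v) (e v) (f v)) := by
  have := ha.shift (· + 1)
  have := hb.shift (· + 1)
  have := hc.shift (· + 1)
  have := hd.shift (· + 1)
  have := he.shift (· + 1)
  have := hf.shift (· + 1)
  unfold code
  infer_instance

theorem mulCode_finseq {X m j k s : M} (hX : IsBinOp X m) (hj : IsInjection j X k)
    (h : MulCode m j s) : IsFun s (succ two) k := by
  obtain ⟨x, y, z, hm, rfl⟩ := h
  obtain ⟨hx, hy, hz⟩ := hX.mulRel_mem hm
  exact isFun_triple (hj.1.app_mem hx) (hj.1.app_mem hy) (hj.1.app_mem hz)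

theorem mem_code {X m j k n g s : M} (hX : IsBinOp X m) (hj : IsInjection j X k) :
    s ∈ₘ code k X m j n g ↔ MulCode m j s ∨ TypeMem k X j n g s := by
  rw [code, mem_sep, and_iff_right_iff_imp, mem_finseq]
  rintro (h | ⟨l, hl, -, hs, -⟩)
  · exact ⟨_, isNat_two.succ, mulCode_finseq hX hj h⟩
  · exact ⟨_, hl.succ, hs⟩

/-- The two halves of a code can be told apart by length: table entries have length three, and the
type omits the sequences of that length. So equality of codes splits into equality of tables and
equality of types; one direction is stated, the other follows by symmetry. -/
theorem code_eq_left {X m j n g X' m' j' n' g' k s : M} (hX : IsBinOp X m)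
    (hj : IsInjection j X k) (hX' : IsBinOp X' m') (hj' : IsInjection j' X' k)
    (e : code k X m j n g = code k X' m' j' n' g') :
    (MulCode m j s → MulCode m' j' s) ∧ (TypeMem k X j n g s → TypeMem k X' j' n' g' s) := by
  have key : s ∈ₘ code k X m j n g → s ∈ₘ code k X' m' j' n' g' := fun h => e ▸ h
  rw [mem_code hX hj, mem_code hX' hj'] at key
  constructor
  · intro h
    refine (key (Or.inl h)).resolve_right ?_
    rintro ⟨l, -, hl, hs, -⟩
    exact hl (succ_inj (hs.1.dom_unique (mulCode_finseq hX hj h).1))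
  · intro h
    refine (key (Or.inr h)).resolve_left fun h' => ?_
    obtain ⟨l, -, hl, hs, -⟩ := h
    exact hl (succ_inj (hs.1.dom_unique (mulCode_finseq hX' hj' h').1))

/-- Labelled groups with the same code of the operation are isomorphic. -/
theorem exists_iso_of_mulCode {X m j X' m' j' k : M} (hX : IsGroup X m) (hX' : IsGroup X' m')
    (hj : IsInjection j X k) (hj' : IsInjection j' X' k)
    (e : ∀ s, MulCode m j s ↔ MulCode m' j' s) :
    ∃ φ, IsIso φ X m X' m' ∧ ∀ x, x ∈ₘ X → app j' (app φ x) = app j x := by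
  -- Stated for arbitrary labelled groups so that it applies in both directions: the forward one
  -- gives the map, the backward one its surjectivity.
  have key : ∀ {X m j X' m' j' : M}, IsGroup X m → IsGroup X' m' → IsInjection j X k →
      IsInjection j' X' k → (∀ s, MulCode m j s → MulCode m' j' s) → ∀ {x y}, x ∈ₘ X → y ∈ₘ X →
      ∃ x' y', x' ∈ₘ X' ∧ y' ∈ₘ X' ∧ app j' x' = app j x ∧ app j' y' = app j y ∧
        app j' (mul m' x' y') = app j (mul m x y) := by
    intro X m j X' m' j' hX hX' hj hj' e x y hx hy
    obtain ⟨x', y', z', hm, e⟩ := e _ ⟨x, y, _, hX.1.mulRel_mul hx hy, rfl⟩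
    obtain ⟨hx', hy', rfl⟩ := hX'.1.mulRel_iff.1 hm
    obtain ⟨e1, e2, e3⟩ := triple_inj (hj.1.app_mem hx) (hj.1.app_mem hy)
      (hj.1.app_mem (hX.mul_mem hx hy)) (hj'.1.app_mem hx') (hj'.1.app_mem hy')
      (hj'.1.app_mem (hX'.mul_mem hx' hy')) e
    exact ⟨x', y', hx', hy', e1.symm, e2.symm, e3.symm⟩
  have hk := @key X m j X' m' j' hX hX' hj hj' fun s => (e s).1
  have hk' := @key X' m' j' X m j hX' hX hj' hj fun s => (e s).2
  have hF : ∀ {x x'}, x' ∈ₘ X' → app j' x' = app j x → jinv j' (app j x) = x' :=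
    fun hx' e => by rw [← e, hj'.jinv_app hx']
  have hF' : ∀ {x}, x ∈ₘ X → jinv j' (app j x) ∈ₘ X' ∧ app j' (jinv j' (app j x)) = app j x :=
    fun {x} hx => by
      obtain ⟨x', -, hx', -, e, -⟩ := hk hx hx
      rw [hF hx' e]
      exact ⟨hx', e⟩
  refine ⟨lam X fun x => jinv j' (app j x), isIso_lam hX.1 hX'.1 (fun x hx => (hF' hx).1)
    (fun x y hx hy e => ?_) (fun x' hx' => ?_) (fun x y hx hy => ?_), fun x hx => ?_⟩
  · refine hj.app_inj hx hy ?_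
    rw [← (hF' hx).2, e, (hF' hy).2]
  · obtain ⟨x, -, hx, -, e, -⟩ := hk' hx' hx'
    exact ⟨x, hx, (hF hx' e.symm).symm⟩
  · obtain ⟨x', y', hx', hy', e1, e2, e3⟩ := hk hx hy
    rw [hF hx' e1, hF hy' e2, hF (hX'.mul_mem hx' hy') e3]
  · rw [app_lam hx, (hF' hx).2]

/-- Embeddings that respect the labels preserve types. -/
theorem typeMem_map {X m Y n j X' n' j' k g s : M} {F : M → M}
    [hF : DFn (fun v : ℕ → M => F (v 0))] (hXY : SubGrp X m Y n)
    (hj : IsInjection j X k) (hj' : IsInjection j' X' k)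
    (hi : ∀ x y, x ∈ₘ Y → y ∈ₘ Y → F x = F y → x = y)
    (hc : ∀ x a, x ∈ₘ Y → a ∈ₘ X → F (conj n x a) = conj n' (F x) (F a))
    (hX : ∀ a, a ∈ₘ X → F a ∈ₘ X' ∧ app j' (F a) = app j a)
    (hs : ∀ a', a' ∈ₘ X' → ∃ a, a ∈ₘ X ∧ a' = F a) (hg : g ∈ₘ Y) :
    TypeMem k X' j' n' (F g) s ↔ TypeMem k X j n g s := by
  have hF' : ∀ {a : (ℕ → M) → M} [DFn a], DFn (fun v => F (a v)) :=
    DFn.app1 (hF.graph_var 0 fun _ => 1)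
  have hlab : ∀ l, Lab X' j' s l ↔ Lab X j s l := fun l => by
    refine forall_congr' fun i => imp_congr_right fun _ => ⟨?_, ?_⟩
    · rintro ⟨a', ha', e⟩
      obtain ⟨a, ha, rfl⟩ := hs a' ha'
      exact ⟨a, ha, (hX a ha).2 ▸ e⟩
    · rintro ⟨a, ha, e⟩
      exact ⟨F a, (hX a ha).1, (hX a ha).2.trans e⟩
  refine exists_congr fun l => and_congr_right fun hl => and_congr_right fun _ =>
    and_congr_right fun _ => ?_
  rw [hlab]
  refine and_congr_right fun hL => ?_
  -- `F` respects labels on the base and conjugation of the base by elements of `Y`, so it carries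
  -- the iterated conjugates of `g` to those of `F g`.
  have hev : ev n' j' (F g) s l = F (ev n j g s l) :=
    ev_induction (P := fun i y => ev n' j' (F g) s i = F y) hj hl hL (ev_emp _ _ _ _)
      fun i a y hi hil ha e hy ih => by
        have hyY : y ∈ₘ Y := hy ▸ ev_mem hXY hj hi (hL.mono hl.1 (mem_succ.2 (Or.inl hil))) hg
        rw [ev_succ _ _ _ _ hi.1, ih, ← e, ← (hX a ha).2, hj'.jinv_app (hX a ha).1, hc y a hyY ha]
  have hY := ev_mem hXY hj hl hL hg
  rw [hev]
  constructor
  · rintro ⟨b', hb', e1, e2⟩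
    obtain ⟨b, hb, rfl⟩ := hs b' hb'
    exact ⟨b, hb, hi _ _ hY (hXY.incl _ hb) e1, (hX b hb).2 ▸ e2⟩
  · rintro ⟨b, hb, e1, e2⟩
    exact ⟨F b, (hX b hb).1, by rw [e1], (hX b hb).2.trans e2⟩

/-- The elements of the tower are determined by their types. -/
theorem Tower.eq_of_typeMem {T l X m j k γ g g' : M} (h : Tower T l X m)
    (hX : IsCenterlessGroup X m) (hj : IsInjection j X k) (hγ : γ ∈ₘ l) (hg : g ∈ₘ tc T γ)
    (hg' : g' ∈ₘ tc T γ) (e : ∀ s, TypeMem k X j (tm T γ) g s → TypeMem k X j (tm T γ) g' s) :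
    g = g' := by
  have hB := h.base hX hγ
  -- By the trivial centralizer of `X`, two iterated conjugates along `s` agree if they agree after
  -- every prolongation of `s` by one label.
  have step : ∀ {p s}, IsNat p → IsFun s p k → Lab X j s p →
      (∀ a, a ∈ₘ X → ev (tm T γ) j g (snoc s p (app j a)) (succ p) =
        ev (tm T γ) j g' (snoc s p (app j a)) (succ p)) →
      ev (tm T γ) j g s p = ev (tm T γ) j g' s p := fun {p s} hp hs hL H => by
    refine h.eq_of_conj hX hγ (ev_mem hB hj hp hL hg) (ev_mem hB hj hp hL hg') fun a ha => ?_
    have := H a ha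
    rwa [ev_snoc_succ hj hp hs ha, ev_snoc_succ hj hp hs ha] at this
  -- Induction on a level `β` containing the value for `g`. Nothing is assumed on the level of the
  -- value for `g'`, which is why inclusion of the types in one direction suffices.
  have claim : ∀ p s, IsNat p → IsFun s p k → Lab X j s p → ev (tm T γ) j g s p ∈ₘ tc T γ →
      ev (tm T γ) j g s p = ev (tm T γ) j g' s p := by
    refine ord_induction_below (l := succ γ) (h.ord.mem hγ).succ (P := fun β => ∀ p s, IsNat p →
      IsFun s p k → Lab X j s p → ev (tm T γ) j g s p ∈ₘ tc T β →
      ev (tm T γ) j g s p = ev (tm T γ) j g' s p) (fun h0 => ?_) (fun β hβ hβs ih => ?_)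
      (fun δ hδ hlim ih => ?_) (self_mem_succ γ)
    · have h0l : emp ∈ₘ l := (mem_succ.1 h0).elim (fun h0 => h.ord.trans h0 hγ) (fun e => e ▸ hγ)
      rw [h.tc_emp h0l]
      have main : ∀ p s, IsNat p → p ≠ two → IsFun s p k → Lab X j s p →
          ev (tm T γ) j g s p ∈ₘ X → ev (tm T γ) j g s p = ev (tm T γ) j g' s p := by
        intro p s hp hp2 hs hL hb
        have hbk := hj.1.app_mem hb
        obtain ⟨q, -, -, hq, -, b, hb', e1, e2⟩ := e (snoc s p (app j (ev (tm T γ) j g s p)))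
          ⟨p, hp, hp2, hs.snoc hbk, (hL.snoc hj.1 hs hb).mono hp.1.succ
            (mem_succ.2 (Or.inl (self_mem_succ p))), _, hb, ev_snoc hp hs hbk,
            (hs.app_snoc_self hbk).symm⟩
        obtain rfl := succ_inj (hq.1.dom_unique (hs.snoc hbk).1)
        rw [ev_snoc hp hs hbk] at e1
        rw [hs.app_snoc_self hbk] at e2
        rw [e1, hj.app_inj hb' hb e2]
      intro p s hp hs hL hb
      -- Two conjugations followed by the final label would be a sequence of length three, which the
      -- types omit. One more conjugation stays in `X`, and the sequences of length four decide.
      by_cases hp2 : p = two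
      · refine step hp hs hL fun a ha => main _ _ hp.succ ?_ (hs.snoc (hj.1.app_mem ha))
          (hL.snoc hj.1 hs ha) ?_
        · intro e
          rw [hp2] at e
          exact mem_irrefl (two : M) (by conv_rhs => rw [← e]
                                         exact self_mem_succ two)
        · rw [ev_snoc_succ hj hp hs ha, hB.conj_eq hb ha]
          exact hX.1.conj_mem hb ha
      · exact main p s hp hp2 hs hL hb
    · intro p s hp hs hL hb
      refine step hp hs hL fun a ha => ih _ _ hp.succ (hs.snoc (hj.1.app_mem ha))
        (hL.snoc hj.1 hs ha) ?_
      rw [ev_snoc_succ hj hp hs ha]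
      have hβγ : β ∈ₘ γ := by
        rcases mem_succ.1 hβs with hs | hs
        · exact (h.ord.mem hγ).trans (self_mem_succ β) hs
        · rw [← hs]
          exact self_mem_succ β
      exact h.conj_mem hX hγ hβγ hb ha
    · intro p s hp hs hL hb
      have hδl : δ ∈ₘ l := (mem_succ.1 hδ).elim (fun hδ => h.ord.trans hδ hγ) (fun e => e ▸ hγ)
      obtain ⟨ε, hε, hb⟩ := (h.mem_tc_limit hδl hlim).1 hb
      exact ih ε hε p s hp hs hL hb
  have := claim emp emp isNat_emp (isFun_emp k) (fun i hi => absurd hi (not_mem_emp i))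
  rw [ev_emp, ev_emp] at this
  exact this hg

end Types

/-! ### The ordinal of coded steps, and the bound on tower heights -/

section Ranks

variable {M : Type u} [EpsStructure M] [ZF M]

/-- `A` codes an element that appears at the step `γ` of the automorphism tower of a centerless
group labelled by elements of `k`, and the tower grows at all steps up to `γ`. -/
def CodesRank (k A γ : M) : Prop :=
  ∃ X m j T l g, IsCenterlessGroup X m ∧ IsInjection j X k ∧ IsAutTower T l X m ∧ succ γ ∈ₘ l ∧
    (∀ δ, δ ∈ₘ succ γ → ¬ Incl (tc T (succ δ)) (tc T δ)) ∧ g ∈ₘ tc T (succ γ) ∧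
    ¬ g ∈ₘ tc T γ ∧ A = code k X m j (tm T (succ γ)) g

instance {a b c : (ℕ → M) → M} [DFn a] [DFn b] [DFn c] :
    Dfn (fun v => CodesRank (a v) (b v) (c v)) :=
  Dfn.app3 (by unfold CodesRank; infer_instance)

theorem CodesRank.isOrd {k A γ : M} (h : CodesRank k A γ) : IsOrd γ := by
  obtain ⟨X, m, j, T, l, g, -, -, hT, hγ, -⟩ := h
  exact (hT.1.mem hγ).mem (self_mem_succ γ)

/-- Equal codes give an isomorphism of the bases, which extends to `φ` on level `γ + 1`. Then `φ(g)`
and `g'` have comparable types in the second tower, so `g' = φ(g)` lies in level `γ + 1`. If `γ <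
γ'`, this level is contained in level `γ'`, where `g'` is not yet present. -/
theorem CodesRank.not_mem {k A γ γ' : M} (h : CodesRank k A γ) (h' : CodesRank k A γ') :
    ¬ γ ∈ₘ γ' := by
  intro hlt
  have hγo := h.isOrd
  have hγo' := h'.isOrd
  obtain ⟨X, m, j, T, l, g, hX, hj, hT, hγ, -, hg, -, rfl⟩ := h
  obtain ⟨X', m', j', T', l', g', hX', hj', hT', hγ', -, hg', hn', e⟩ := h'
  replace hT := hT.tower
  replace hT' := hT'.tower
  have hmul : ∀ s, MulCode m j s ↔ MulCode m' j' s := fun s =>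
    ⟨(code_eq_left hX.1.1 hj hX'.1.1 hj' e).1, (code_eq_left hX'.1.1 hj' hX.1.1 hj e.symm).1⟩
  have htype : ∀ s, TypeMem k X' j' (tm T' (succ γ')) g' s → TypeMem k X j (tm T (succ γ)) g s :=
    fun s => (code_eq_left hX'.1.1 hj' hX.1.1 hj e.symm).2
  obtain ⟨φ₀, h₀, hlab⟩ := exists_iso_of_mulCode hX.1 hX'.1 hj hj' hmul
  have hle : succ γ ∈ₘ succ γ' := mem_succ.2 (hγo'.succ_mem_or_eq hlt)
  have hγl' : succ γ ∈ₘ l' := hT'.ord.trans hle hγ'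
  obtain ⟨φ, hφ, eφ⟩ := hT.exists_iso hX hT' hX' h₀ hγ hγl'
  have hs := hT'.subGrp hX' hγ' (mem_succ.2 (Or.inl hle))
  have hB := hT.base hX hγ
  have hmem : app φ g ∈ₘ tc T' (succ γ') := hs.incl _ (hφ.app_mem hg)
  -- Equality is tested in level `γ' + 1` of the second tower, which contains both elements; the
  -- type of `φ(g)` there is that of `g` because `φ` respects labels and conjugation.
  have heq : g' = app φ g := by
    refine hT'.eq_of_typeMem hX' hj' hγ' hg' hmem fun s hs' => ?_
    refine (typeMem_map hB hj hj' (fun x y hx hy => hφ.app_inj hx hy) (fun x a hx ha => ?_)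
      (fun a ha => ?_) (fun a' ha' => ?_) hg).2 (htype s hs')
    · have ha := hB.incl _ ha
      rw [hs.conj_eq (hφ.app_mem hx) (hφ.app_mem ha), hφ.app_conj hB.right hs.left hx ha]
    · rw [eφ a ha]
      exact ⟨h₀.app_mem ha, hlab a ha⟩
    · obtain ⟨a, ha, rfl⟩ := h₀.exists_app ha'
      exact ⟨a, ha, (eφ a ha).symm⟩
  rw [heq] at hn'
  exact hn' ((hT'.subGrp hX' (hT'.ord.trans (self_mem_succ γ') hγ') hle).incl _ (hφ.app_mem hg))

theorem CodesRank.unique {k A γ γ' : M} (h : CodesRank k A γ) (h' : CodesRank k A γ') : γ = γ' := by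
  rcases h.isOrd.trichotomy h'.isOrd with hlt | e | hlt
  · exact absurd hlt (h.not_mem h')
  · exact e
  · exact absurd hlt (h'.not_mem h)

theorem Tower.exists_codesRank {T l X m j k γ : M} (h : Tower T l X m)
    (hX : IsCenterlessGroup X m) (hj : IsInjection j X k) (hγ : succ γ ∈ₘ l)
    (hn : ∀ δ, δ ∈ₘ succ γ → ¬ Incl (tc T (succ δ)) (tc T δ)) :
    ∃ A, A ∈ₘ pow (finseq k) ∧ CodesRank k A γ := by
  have := hn γ (self_mem_succ γ)
  simp only [Incl, not_forall] at this
  obtain ⟨g, hg, hg'⟩ := this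
  refine ⟨_, mem_pow.2 fun s hs => ?_, X, m, j, T, l, g, hX, hj, h.isAutTower, hγ, hn, hg, hg', rfl⟩
  exact (mem_sep.1 hs).1

/-- A code contains at least the table entry of `1 · 1 = 1`. Hence `∅` is not a code and remains
free to be sent to `σ`. -/
theorem exists_mem_of_codesRank {k A γ : M} (h : CodesRank k A γ) : ∃ s, s ∈ₘ A := by
  obtain ⟨X, m, j, T, l, g, hX, hj, -, -, -, -, -, rfl⟩ := h
  have h1 := hX.1.one_mem
  exact ⟨_, (mem_code hX.1.1 hj).2 (Or.inl ⟨_, _, _, hX.1.1.mulRel_mul h1 h1, rfl⟩)⟩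

/-- A code determines its step, so the steps form a set by replacement. The set is transitive
because `CodesRank` demands growth at all steps up to `γ`: the same tower then supplies a code for
every smaller step. -/
theorem exists_ranks (k : M) : ∃ σ, IsOrd σ ∧
    ∀ γ, γ ∈ₘ σ ↔ ∃ A, A ∈ₘ pow (finseq k) ∧ CodesRank k A γ := by
  obtain ⟨σ, hσ⟩ := exists_repl (fun A γ => CodesRank k A γ) (pow (finseq k))
    fun A _ γ γ' h h' => h.unique h'
  refine ⟨σ, ⟨fun γ hγ δ hδ => ?_, fun γ hγ => ?_⟩, hσ⟩
  · obtain ⟨A, -, hA⟩ := (hσ γ).1 hγ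
    have hγo := hA.isOrd
    obtain ⟨X, m, j, T, l, g, hX, hj, hT, hγl, hn, -⟩ := hA
    have hδs : succ δ ∈ₘ succ γ := mem_succ.2 (hγo.succ_mem_or_eq hδ)
    exact (hσ δ).2 (hT.tower.exists_codesRank hX hj (hT.1.trans hδs hγl) fun ε hε =>
      hn ε (hγo.succ.trans hε hδs))
  · obtain ⟨A, -, hA⟩ := (hσ γ).1 hγ
    exact hA.isOrd.1

/-- With `k = X`, labelled by the identity, let `σ` be the ordinal of coded steps. If the group
never stabilized, its tower would grow at all steps up to `σ`, making `σ` a coded step, so `σ ∈ σ`.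
-/
theorem exists_towerHeight {X m : M} (hX : IsCenterlessGroup X m) : ∃ α, IsTowerHeight X m α := by
  obtain ⟨σ, hσ, hσ'⟩ := exists_ranks X
  -- Length `σ + 2` is needed to have level `σ + 1`, in which the element coding step `σ` would
  -- appear.
  have hT := exists_tower hX hσ.succ.succ
  have hj : IsInjection (lam X fun x => x) X X := isInjection_lam (fun _ h => h) fun _ _ _ _ e => e
  by_contra hno
  refine mem_irrefl σ ((hσ' σ).2 (hT.exists_codesRank hX hj (self_mem_succ _) fun δ hδ hi => hno ?_))
  have hδs : succ δ ∈ₘ succ (succ σ) := mem_succ.2 (hσ.succ.succ_mem_or_eq hδ)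
  exact exists_isLeastOrd (hσ.succ.mem hδ) (hT.stabilizesAt hX hδs hi)

/-- Below the height `β` of a tower every step grows, by minimality of `β`, and so is coded. Thus `β
⊆ σ`, that is, `β ≤ σ`. The tower used is the one that witnesses stabilization at `β`, so towers
need not be compared. -/
theorem boundsHeights_succ {k σ : M} (hσ : IsOrd σ)
    (hσ' : ∀ γ, γ ∈ₘ σ ↔ ∃ A, A ∈ₘ pow (finseq k) ∧ CodesRank k A γ) :
    BoundsHeights k (succ σ) := by
  rintro X m β hX ⟨j, hj⟩ ⟨hβ, ⟨s, l, T, Y, n, hs, hl, hT, -⟩, hmin⟩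
  rw [isSucc_iff] at hs hl
  subst hs hl
  refine mem_succ.2 (hβ.mem_or_eq_of_incl hσ fun γ hγ => (hσ' γ).2 ?_)
  have hlt : ∀ {δ}, δ ∈ₘ β → succ δ ∈ₘ succ (succ β) := fun hδ =>
    mem_succ.2 (Or.inl (mem_succ.2 (hβ.succ_mem_or_eq hδ)))
  refine hT.tower.exists_codesRank hX hj (hlt hγ) fun δ hδ hi => ?_
  have hδβ : δ ∈ₘ β := by
    rcases mem_succ.1 hδ with hδ | rfl
    · exact hβ.trans hδ hγ
    · exact hγ
  exact hmin δ hδβ (hT.tower.stabilizesAt hX (hlt hδβ) hi)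

/-- Codes go to their steps and all other sets to `σ`. The value `σ` is attained at `∅`. -/
theorem exists_surjection_succ {k σ : M}
    (hσ' : ∀ γ, γ ∈ₘ σ ↔ ∃ A, A ∈ₘ pow (finseq k) ∧ CodesRank k A γ) :
    ∃ f, IsSurjection f (pow (finseq k)) (succ σ) := by
  have hval : ∀ {A γ}, CodesRank k A γ →
      ifte (∃ γ, CodesRank k A γ) (iota (CodesRank k A)) σ = γ := fun {A γ} h => by
    rw [ifte_pos ⟨γ, h⟩, iota_eq h fun _ h' => h'.unique h]
  refine ⟨lam (pow (finseq k)) fun A => ifte (∃ γ, CodesRank k A γ) (iota (CodesRank k A)) σ,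
    isSurjection_lam (fun A hA => ?_) fun γ hγ => ?_⟩
  · by_cases h : ∃ γ, CodesRank k A γ
    · obtain ⟨γ, h⟩ := h
      rw [hval h]
      exact mem_succ.2 (Or.inl ((hσ' γ).2 ⟨A, hA, h⟩))
    · rw [ifte_neg h]
      exact self_mem_succ σ
  · rcases mem_succ.1 hγ with hγ | rfl
    · obtain ⟨A, hA, h⟩ := (hσ' γ).1 hγ
      exact ⟨A, hA, (hval h).symm⟩
    · refine ⟨emp, mem_pow.2 fun s hs => absurd hs (not_mem_emp s), ?_⟩
      rw [ifte_neg]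
      rintro ⟨γ', h⟩
      obtain ⟨s, hs⟩ := exists_mem_of_codesRank h
      exact not_mem_emp s hs

theorem exists_tau_mem_theta (k : M) :
    ∃ S P τ θ : M, IsFinSeqSet S k ∧ IsPowerset P S ∧ IsTau k τ ∧ IsTheta P θ ∧ τ ∈ₘ θ ∧
      ∃ α f : M, IsOrd α ∧ IsSurjection f P α ∧ BoundsHeights k α := by
  obtain ⟨σ, hσ, hσ'⟩ := exists_ranks k
  have hb := boundsHeights_succ hσ hσ'
  obtain ⟨f, hf⟩ := exists_surjection_succ hσ'
  obtain ⟨τ, hτ⟩ := exists_isLeastOrd hσ.succ hb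
  obtain ⟨θ, hθ, hθ'⟩ := exists_theta (pow (finseq k))
  have hσθ : succ σ ∈ₘ θ := (hθ' _).2 ⟨hσ.succ, Or.inr ⟨f, hf⟩⟩
  refine ⟨finseq k, pow (finseq k), τ, θ, fun s => mem_finseq, fun z => mem_pow, hτ, hθ, ?_,
    succ σ, f, hσ.succ, hf, hb⟩
  -- By leastness `τ ≤ σ + 1`, and `σ + 1 ∈ θ` because the power set maps onto it.
  rcases hτ.1.trichotomy hσ.succ with h | rfl | h
  · exact hθ.1.trans h hσθ
  · exact hσθ
  · exact absurd hb (hτ.2.2 _ h)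

end Ranks

end ZFModel

theorem mainTheorem1 (M : Type u) [ZFModel.EpsStructure M] (hM : ZFModel.IsModelZF M) (k : M) :
    (∀ X m : M, ZFModel.IsCenterlessGroup X m → ∃ α, ZFModel.IsTowerHeight X m α) ∧
    ∃ S P τ θ : M,
      ZFModel.IsFinSeqSet S k ∧ ZFModel.IsPowerset P S ∧
      ZFModel.IsTau k τ ∧ ZFModel.IsTheta P θ ∧ τ ∈ₘ θ ∧
      ∃ α f : M, ZFModel.IsOrd α ∧ ZFModel.IsSurjection f P α ∧ ZFModel.BoundsHeights k α :=
  have : ZFModel.ZF M := ⟨hM⟩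
  ⟨fun _ _ => ZFModel.exists_towerHeight, ZFModel.exists_tau_mem_theta k⟩
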